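/- Let $(M,g)$ be a closed (i.e. compact without boundary) smooth Riemannian manifold of dimension $n\ge 3$ whose scalar curvature $R$ is everywhere positive. Write $dv$ for the Riemannian volume measure, $B(p,r)$ for the open geodesic ball with center $p$ and radius $r$, $V(p,r)$ for its volume, and let $$ Y=Y(M,[g]):=\inf_{0<\varphi\in C^\infty(M)}\frac{\frac{4(n-1)}{n-2}\int_M|\nabla\varphi|^2\,dv+\int_M R\,\varphi^2\,dv}{\left(\int_M\varphi^{\frac{2n}{n-2}}\,dv\right)^{\frac{n-2}{n}}} $$ be the Yamabe constant. Then $Y>0$, and for every point $p\in M$ and every $r>0$ the function $R$ is integrable on $B(p,r)$ and $$ \frac n2\ln\frac{2eY}{n}\le\frac{16(n-1)}{n-2}\cdot\frac{V(p,r)}{V\left(p,\frac r2\right)}+\frac{r^2}{V\left(p,\frac r2\right)}\int_{B(p,r)}R\,dv+\ln\frac{V(p,r)}{r^n}. $$ -/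

import Mathlib

open Bundle
open scoped Manifold ContDiff ENNReal

noncomputable section

namespace RiemannianGeometry

variable {n : ℕ} {M : Type*} [TopologicalSpace M] [ChartedSpace (EuclideanSpace ℝ (Fin n)) M]
  [RiemannianBundle (fun x : M ↦ TangentSpace (𝓡 n) x)]

/-- The partial derivative `∂ᵢ f` at `y` of a function on an open part of `ℝⁿ`. -/
def partialDeriv (i : Fin n) (f : EuclideanSpace ℝ (Fin n) → ℝ)
    (y : EuclideanSpace ℝ (Fin n)) : ℝ :=
  fderiv ℝ f y (EuclideanSpace.single i 1)

/-- The coordinate vector field `∂ᵢ` of the preferred chart at `x₀`, at the point of `M` whose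
coordinates are `y`. -/
def coordVec (x₀ : M) (i : Fin n) (y : EuclideanSpace ℝ (Fin n)) :
    TangentSpace (𝓡 n) ((extChartAt (𝓡 n) x₀).symm y) :=
  mfderiv 𝓘(ℝ, EuclideanSpace ℝ (Fin n)) (𝓡 n) (extChartAt (𝓡 n) x₀).symm y
    (EuclideanSpace.single i (1 : ℝ) : EuclideanSpace ℝ (Fin n))

/-- The matrix `gᵢⱼ(y) = g(∂ᵢ, ∂ⱼ)` of the Riemannian metric in the preferred chart at `x₀`. -/
def metricMatrix (x₀ : M) (y : EuclideanSpace ℝ (Fin n)) : Matrix (Fin n) (Fin n) ℝ :=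
  Matrix.of fun i j ↦ inner ℝ (coordVec x₀ i y) (coordVec x₀ j y)

/-- The Christoffel symbol `Γᵏᵢⱼ = ½ gᵏˡ (∂ᵢ gⱼₗ + ∂ⱼ gᵢₗ - ∂ₗ gᵢⱼ)` of the Levi-Civita connection
in the preferred chart at `x₀`. -/
def christoffel (x₀ : M) (k i j : Fin n) (y : EuclideanSpace ℝ (Fin n)) : ℝ :=
  (1 / 2 : ℝ) * ∑ l, (metricMatrix x₀ y)⁻¹ k l *
    (partialDeriv i (fun z ↦ metricMatrix x₀ z j l) y
      + partialDeriv j (fun z ↦ metricMatrix x₀ z i l) y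
      - partialDeriv l (fun z ↦ metricMatrix x₀ z i j) y)

/-- The component `Rˡᵢⱼₖ` of the curvature tensor in the preferred chart at `x₀`, with the
convention `R(∂ᵢ, ∂ⱼ)∂ₖ = ∇ᵢ∇ⱼ∂ₖ - ∇ⱼ∇ᵢ∂ₖ = Rˡᵢⱼₖ ∂ₗ`. -/
def curvatureCoeff (x₀ : M) (l i j k : Fin n) (y : EuclideanSpace ℝ (Fin n)) : ℝ :=
  partialDeriv i (christoffel x₀ l j k) y - partialDeriv j (christoffel x₀ l i k) y
    + ∑ m, (christoffel x₀ l i m y * christoffel x₀ m j k y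
      - christoffel x₀ l j m y * christoffel x₀ m i k y)

/-- The component `Ricⱼₖ = Rⁱᵢⱼₖ` of the Ricci tensor in the preferred chart at `x₀`
(with this sign the Ricci tensor of a round sphere is positive). -/
def ricciCoeff (x₀ : M) (j k : Fin n) (y : EuclideanSpace ℝ (Fin n)) : ℝ :=
  ∑ i, curvatureCoeff x₀ i i j k y

variable (n) in
/-- The scalar curvature `R = gʲᵏ Ricⱼₖ` at `x`, computed in the preferred chart at `x`. -/
def scalarCurvature (x : M) : ℝ :=
  ∑ j, ∑ k, (metricMatrix x (extChartAt (𝓡 n) x x))⁻¹ j k *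
    ricciCoeff x j k (extChartAt (𝓡 n) x x)

variable (n) in
/-- The Riemannian volume `√(det gᵢⱼ) dy¹ ⋯ dyⁿ` on the domain of the preferred chart at `x₀`,
as a measure on `M` carried by that domain. -/
def chartVolume [MeasurableSpace M] (x₀ : M) : MeasureTheory.Measure M :=
  ((MeasureTheory.volume.restrict (extChartAt (𝓡 n) x₀).target).withDensity
    fun y ↦ ENNReal.ofReal √(metricMatrix x₀ y).det).map (extChartAt (𝓡 n) x₀).symm

variable (n M) in
/-- The Riemannian volume measure `dv`. The chart volumes agree where the chart domains overlap, so
their supremum in the lattice of measures is the measure which restricts to each of them on the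
corresponding chart domain. -/
def riemannianVolume [MeasurableSpace M] : MeasureTheory.Measure M :=
  ⨆ x₀ : M, chartVolume n x₀

variable (n) in
/-- The gradient of `φ` at `x`: the tangent vector with `⟪∇φ, v⟫ = dφ(v)` for all `v`. -/
def gradient (φ : M → ℝ) (x : M) : TangentSpace (𝓡 n) x :=
  haveI : FiniteDimensional ℝ (TangentSpace (𝓡 n) x) :=
    inferInstanceAs (FiniteDimensional ℝ (EuclideanSpace ℝ (Fin n)))
  haveI : CompleteSpace (TangentSpace (𝓡 n) x) := FiniteDimensional.complete ℝ _
  (InnerProductSpace.toDual ℝ (TangentSpace (𝓡 n) x)).symm (mvfderiv (𝓡 n) φ x)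

variable (n) in
/-- The Yamabe quotient of a positive function `φ`: the normalized total scalar curvature of the
conformal metric `φ ^ (4 / (n - 2)) g`, written in terms of `g`. -/
def yamabeQuotient [MeasurableSpace M] (φ : M → ℝ) : ℝ :=
  (4 * ((n : ℝ) - 1) / ((n : ℝ) - 2) * (∫ x, ‖gradient n φ x‖ ^ 2 ∂riemannianVolume n M)
      + (∫ x, scalarCurvature n x * φ x ^ 2 ∂riemannianVolume n M))
    / (∫ x, φ x ^ (2 * (n : ℝ) / ((n : ℝ) - 2)) ∂riemannianVolume n M) ^ (((n : ℝ) - 2) / (n : ℝ))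

variable (n M) in
/-- The Yamabe constant `Y(M, [g])`: the infimum of the Yamabe quotient over all positive smooth
functions. -/
def yamabeConstant [MeasurableSpace M] : ℝ :=
  ⨅ φ : {φ : M → ℝ // ContMDiff (𝓡 n) 𝓘(ℝ, ℝ) ∞ φ ∧ ∀ x, 0 < φ x}, yamabeQuotient n φ.1

/-- The open geodesic ball `B(p, r)`; the extended distance of a Riemannian manifold is the infimum
of the lengths of the `C¹` paths between two points. -/
def geodesicBall {X : Type*} [EMetricSpace X] (p : X) (r : ℝ) : Set X :=
  Metric.eball p (ENNReal.ofReal r)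

variable (n) in
/-- The volume `V(p, r)` of the geodesic ball `B(p, r)`. -/
def ballVolume {X : Type*} [EMetricSpace X] [ChartedSpace (EuclideanSpace ℝ (Fin n)) X]
    [RiemannianBundle (fun x : X ↦ TangentSpace (𝓡 n) x)] [MeasurableSpace X]
    (p : X) (r : ℝ) : ℝ :=
  (riemannianVolume n X).real (geodesicBall p r)

end RiemannianGeometry

end

open RiemannianGeometry MeasureTheory

/-!
The inequality is the Yamabe inequality `Y ‖h‖²_{2n/(n-2)} ≤ a ∫ |∇h|² + ∫ R h²`, where
`a = 4 (n - 1) / (n - 2)`, tested with cutoff functions `h` of the ball `B(p, r)` which are `1` on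
`B(p, r / 2)` and have slope close to `2 / r`. By Hölder's inequality
`V(p, r / 2) ≤ ∫ h² ≤ ‖h‖²_{2n/(n-2)} V(p, r) ^ (2 / n)`, so in the limit (see
`yamabeConstant_mul_ballVolume_le`)
`Y ≤ V(p, r) ^ (2 / n) X` with `X = (4 a V(p, r) / r² + ∫_{B(p, r)} R) / V(p, r / 2)`.
Taking logarithms and estimating `log X ≤ σ X - log σ - 1` for `σ = 2 r² / n` gives the claim
(`log_le_of_le_rpow_mul`).

The Riemannian geometry behind this argument is developed from charts.

* The scalar curvature is defined in the preferred chart at each point. Its continuity, which gives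
  integrability and a positive minimum, needs that all charts give the same value. A change of
  coordinates acts on the matrices of the Levi-Civita connection as a gauge transformation
  (`jacobian_mul_connectionMatrix`), hence on the curvature by conjugation, and the contraction is
  invariant (`coordScalarCurvature_eq`, `scalarCurvature_eq`).
* The Riemannian volume is a supremum of chart volumes. By the change of variables formula these
  agree on overlaps, so the volume is given by `√(det gᵢⱼ)` in each chart
  (`riemannianVolume_restrict_source`); it is locally finite and positive on open sets.
* `Y > 0` follows from the Sobolev inequality on the closed manifold (`exists_sobolev`), which is
  transported from `ℝⁿ` with a partition of unity, since `R` has a positive minimum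
  (`yamabeConstant_pos`).
* The distance function is only `1`-Lipschitz. It is mollified in charts and glued; as the metric is
  nearly constant at small scales, this costs only a factor `1 + ε` in the gradient
  (`exists_local_mollification`, `exists_smooth_approximation`). Composition with a step function
  gives the cutoff functions (`exists_smooth_cutoff`).
-/

noncomputable section

namespace RiemannianGeometry

open Filter Topology Set

/-! ### The calculus of partial derivatives -/

section Coordinates

variable {n : ℕ}

lemma partialDeriv_congr {f g : EuclideanSpace ℝ (Fin n) → ℝ} {y : EuclideanSpace ℝ (Fin n)}
    (h : f =ᶠ[𝓝 y] g) (i : Fin n) : partialDeriv i f y = partialDeriv i g y := by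
  simp only [partialDeriv, h.fderiv_eq]

lemma partialDeriv_add {f g : EuclideanSpace ℝ (Fin n) → ℝ} {y : EuclideanSpace ℝ (Fin n)}
    (hf : DifferentiableAt ℝ f y) (hg : DifferentiableAt ℝ g y) (i : Fin n) :
    partialDeriv i (fun z ↦ f z + g z) y = partialDeriv i f y + partialDeriv i g y := by
  simp [partialDeriv, fderiv_fun_add hf hg]

lemma partialDeriv_mul {f g : EuclideanSpace ℝ (Fin n) → ℝ} {y : EuclideanSpace ℝ (Fin n)}
    (hf : DifferentiableAt ℝ f y) (hg : DifferentiableAt ℝ g y) (i : Fin n) :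
    partialDeriv i (fun z ↦ f z * g z) y
      = partialDeriv i f y * g y + f y * partialDeriv i g y := by
  simp [partialDeriv, fderiv_fun_mul hf hg]
  ring

lemma partialDeriv_sum {ι : Type*} {s : Finset ι} {f : ι → EuclideanSpace ℝ (Fin n) → ℝ}
    {y : EuclideanSpace ℝ (Fin n)} (hf : ∀ k ∈ s, DifferentiableAt ℝ (f k) y) (i : Fin n) :
    partialDeriv i (fun z ↦ ∑ k ∈ s, f k z) y = ∑ k ∈ s, partialDeriv i (f k) y := by
  simp [partialDeriv, fderiv_fun_sum hf]

lemma contDiffAt_partialDeriv {f : EuclideanSpace ℝ (Fin n) → ℝ} {y : EuclideanSpace ℝ (Fin n)}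
    (hf : ContDiffAt ℝ ∞ f y) (i : Fin n) : ContDiffAt ℝ ∞ (partialDeriv i f) y := by
  have h : ContDiffAt ℝ ∞ (fderiv ℝ f) y := hf.fderiv_right (by norm_cast)
  exact h.clm_apply contDiffAt_const

lemma partialDeriv_comm {f : EuclideanSpace ℝ (Fin n) → ℝ} {y : EuclideanSpace ℝ (Fin n)}
    (hf : ContDiffAt ℝ ∞ f y) (i j : Fin n) :
    partialDeriv i (partialDeriv j f) y = partialDeriv j (partialDeriv i f) y := by
  have h : DifferentiableAt ℝ (fderiv ℝ f) y :=
    (hf.fderiv_right (m := 1) (by norm_cast)).differentiableAt (by simp)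
  have key (a b : Fin n) : partialDeriv a (partialDeriv b f) y
      = fderiv ℝ (fderiv ℝ f) y (EuclideanSpace.single a 1) (EuclideanSpace.single b 1) := by
    change fderiv ℝ (fun z ↦ fderiv ℝ f z (EuclideanSpace.single b 1)) y _ = _
    rw [fderiv_clm_apply h (differentiableAt_const _)]
    simp
  rw [key, key]
  exact (hf.isSymmSndFDerivAt (by simpa using ENat.LEInfty.out)) _ _

/-- The Jacobian matrix `∂ᵢψᵃ` of a map between open parts of `ℝⁿ`. -/
def jacobian (ψ : EuclideanSpace ℝ (Fin n) → EuclideanSpace ℝ (Fin n))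
    (y : EuclideanSpace ℝ (Fin n)) : Matrix (Fin n) (Fin n) ℝ :=
  Matrix.of fun a i ↦ partialDeriv i (fun z ↦ ψ z a) y

lemma contDiffAt_coord {ψ : EuclideanSpace ℝ (Fin n) → EuclideanSpace ℝ (Fin n)}
    {y : EuclideanSpace ℝ (Fin n)} (hψ : ContDiffAt ℝ ∞ ψ y) (a : Fin n) :
    ContDiffAt ℝ ∞ (fun z ↦ ψ z a) y :=
  (EuclideanSpace.proj (𝕜 := ℝ) a).contDiff.contDiffAt.comp y hψ

lemma jacobian_apply_eq {ψ : EuclideanSpace ℝ (Fin n) → EuclideanSpace ℝ (Fin n)}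
    {y : EuclideanSpace ℝ (Fin n)} (hψ : DifferentiableAt ℝ ψ y) (a i : Fin n) :
    jacobian ψ y a i = (fderiv ℝ ψ y (EuclideanSpace.single i 1)) a := by
  have h := ((EuclideanSpace.proj (𝕜 := ℝ) a).hasFDerivAt.comp y hψ.hasFDerivAt).fderiv
  simp only [jacobian, Matrix.of_apply, partialDeriv]
  exact congrArg (fun L ↦ L (EuclideanSpace.single i 1)) h

lemma partialDeriv_comp {f : EuclideanSpace ℝ (Fin n) → ℝ}
    {ψ : EuclideanSpace ℝ (Fin n) → EuclideanSpace ℝ (Fin n)} {y : EuclideanSpace ℝ (Fin n)}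
    (hf : DifferentiableAt ℝ f (ψ y)) (hψ : DifferentiableAt ℝ ψ y) (i : Fin n) :
    partialDeriv i (fun z ↦ f (ψ z)) y
      = ∑ b, jacobian ψ y b i * partialDeriv b f (ψ y) := by
  have h := (hf.hasFDerivAt.comp y hψ.hasFDerivAt).fderiv
  have h1 : partialDeriv i (fun z ↦ f (ψ z)) y
      = fderiv ℝ f (ψ y) (fderiv ℝ ψ y (EuclideanSpace.single i 1)) :=
    congrArg (fun L ↦ L (EuclideanSpace.single i 1)) h
  rw [h1, ← (EuclideanSpace.basisFun (Fin n) ℝ).sum_repr (fderiv ℝ ψ y _), map_sum]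
  refine Finset.sum_congr rfl fun b _ ↦ ?_
  rw [map_smul, jacobian_apply_eq hψ, partialDeriv]
  simp

/-- The entrywise partial derivative `∂ᵢA` of a matrix-valued function. -/
def matrixPartialDeriv (i : Fin n) (A : EuclideanSpace ℝ (Fin n) → Matrix (Fin n) (Fin n) ℝ)
    (y : EuclideanSpace ℝ (Fin n)) : Matrix (Fin n) (Fin n) ℝ :=
  Matrix.of fun a b ↦ partialDeriv i (fun z ↦ A z a b) y

lemma matrixPartialDeriv_congr
    {A B : EuclideanSpace ℝ (Fin n) → Matrix (Fin n) (Fin n) ℝ} {y : EuclideanSpace ℝ (Fin n)}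
    (h : A =ᶠ[𝓝 y] B) (i : Fin n) : matrixPartialDeriv i A y = matrixPartialDeriv i B y := by
  ext a b
  exact partialDeriv_congr (h.mono fun z hz ↦ by simp only [hz]) i

lemma matrixPartialDeriv_add
    {A B : EuclideanSpace ℝ (Fin n) → Matrix (Fin n) (Fin n) ℝ} {y : EuclideanSpace ℝ (Fin n)}
    (hA : ∀ a b, DifferentiableAt ℝ (fun z ↦ A z a b) y)
    (hB : ∀ a b, DifferentiableAt ℝ (fun z ↦ B z a b) y) (i : Fin n) :
    matrixPartialDeriv i (fun z ↦ A z + B z) y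
      = matrixPartialDeriv i A y + matrixPartialDeriv i B y := by
  ext a b
  exact partialDeriv_add (hA a b) (hB a b) i

lemma matrixPartialDeriv_mul
    {A B : EuclideanSpace ℝ (Fin n) → Matrix (Fin n) (Fin n) ℝ} {y : EuclideanSpace ℝ (Fin n)}
    (hA : ∀ a b, DifferentiableAt ℝ (fun z ↦ A z a b) y)
    (hB : ∀ a b, DifferentiableAt ℝ (fun z ↦ B z a b) y) (i : Fin n) :
    matrixPartialDeriv i (fun z ↦ A z * B z) y
      = matrixPartialDeriv i A y * B y + A y * matrixPartialDeriv i B y := by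
  ext a b
  simp only [matrixPartialDeriv, Matrix.of_apply, Matrix.add_apply, Matrix.mul_apply]
  rw [partialDeriv_sum (f := fun k z ↦ A z a k * B z k b) (fun k _ ↦ (hA a k).mul (hB k b)),
    ← Finset.sum_add_distrib]
  exact Finset.sum_congr rfl fun k _ ↦ partialDeriv_mul (hA a k) (hB k b) i

lemma matrixPartialDeriv_transpose
    (A : EuclideanSpace ℝ (Fin n) → Matrix (Fin n) (Fin n) ℝ) (y : EuclideanSpace ℝ (Fin n))
    (i : Fin n) : matrixPartialDeriv i (fun z ↦ (A z).transpose) y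
      = (matrixPartialDeriv i A y).transpose := rfl

lemma matrixPartialDeriv_comp
    {A : EuclideanSpace ℝ (Fin n) → Matrix (Fin n) (Fin n) ℝ}
    {ψ : EuclideanSpace ℝ (Fin n) → EuclideanSpace ℝ (Fin n)} {y : EuclideanSpace ℝ (Fin n)}
    (hA : ∀ a b, DifferentiableAt ℝ (fun z ↦ A z a b) (ψ y)) (hψ : DifferentiableAt ℝ ψ y)
    (i : Fin n) :
    matrixPartialDeriv i (fun z ↦ A (ψ z)) y
      = ∑ b, jacobian ψ y b i • matrixPartialDeriv b A (ψ y) := by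
  ext a c
  simp only [matrixPartialDeriv, Matrix.of_apply, Matrix.sum_apply, Matrix.smul_apply, smul_eq_mul]
  exact partialDeriv_comp (hA a c) hψ i

/-! ### Smoothness of the entries of an inverse matrix -/

lemma contDiffAt_det {A : EuclideanSpace ℝ (Fin n) → Matrix (Fin n) (Fin n) ℝ}
    {y : EuclideanSpace ℝ (Fin n)} (hA : ∀ a b, ContDiffAt ℝ ∞ (fun z ↦ A z a b) y) :
    ContDiffAt ℝ ∞ (fun z ↦ (A z).det) y := by
  simp only [Matrix.det_apply']
  exact ContDiffAt.sum fun σ _ ↦ contDiffAt_const.mul (contDiffAt_prod fun i _ ↦ hA _ _)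

lemma contDiffAt_inv_apply {A : EuclideanSpace ℝ (Fin n) → Matrix (Fin n) (Fin n) ℝ}
    {y : EuclideanSpace ℝ (Fin n)} (hA : ∀ a b, ContDiffAt ℝ ∞ (fun z ↦ A z a b) y)
    (hdet : (A y).det ≠ 0) (a b : Fin n) : ContDiffAt ℝ ∞ (fun z ↦ (A z)⁻¹ a b) y := by
  simp only [Matrix.inv_def, Matrix.smul_apply, smul_eq_mul, Ring.inverse_eq_inv',
    Matrix.adjugate_apply]
  refine ((contDiffAt_det hA).inv hdet).mul (contDiffAt_det fun c d ↦ ?_)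
  by_cases hc : c = b
  · subst hc
    simpa using contDiffAt_const
  · simpa [Matrix.updateRow_apply, hc] using hA c d

/-! ### The Levi-Civita connection and its curvature in coordinates -/

/-- The connection matrices `(Γᵢ)ᵏⱼ = Γᵏᵢⱼ` of the Levi-Civita connection of a metric `G` on an open
part of `ℝⁿ`. -/
def connectionMatrix (G : EuclideanSpace ℝ (Fin n) → Matrix (Fin n) (Fin n) ℝ) (i : Fin n)
    (y : EuclideanSpace ℝ (Fin n)) : Matrix (Fin n) (Fin n) ℝ :=
  Matrix.of fun k j ↦ (1 / 2 : ℝ) * ∑ l, (G y)⁻¹ k l *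
    (partialDeriv i (fun z ↦ G z j l) y + partialDeriv j (fun z ↦ G z i l) y
      - partialDeriv l (fun z ↦ G z i j) y)

/-- The curvature matrices `∂ᵢAⱼ - ∂ⱼAᵢ + [Aᵢ, Aⱼ]` of the connection `d + ∑ᵢ Aᵢ dyⁱ`. -/
def curvatureMatrix (A : Fin n → EuclideanSpace ℝ (Fin n) → Matrix (Fin n) (Fin n) ℝ)
    (i j : Fin n) (y : EuclideanSpace ℝ (Fin n)) : Matrix (Fin n) (Fin n) ℝ :=
  matrixPartialDeriv i (A j) y - matrixPartialDeriv j (A i) y + (A i y * A j y - A j y * A i y)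

/-- The scalar curvature of a metric `G` on an open part of `ℝⁿ`. -/
def coordScalarCurvature (G : EuclideanSpace ℝ (Fin n) → Matrix (Fin n) (Fin n) ℝ)
    (y : EuclideanSpace ℝ (Fin n)) : ℝ :=
  ∑ j, ∑ k, (G y)⁻¹ j k * ∑ i, curvatureMatrix (connectionMatrix G) i j y i k

lemma contDiffAt_connectionMatrix {G : EuclideanSpace ℝ (Fin n) → Matrix (Fin n) (Fin n) ℝ}
    {y : EuclideanSpace ℝ (Fin n)} (hG : ∀ a b, ContDiffAt ℝ ∞ (fun z ↦ G z a b) y)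
    (hdet : (G y).det ≠ 0) (i a b : Fin n) :
    ContDiffAt ℝ ∞ (fun z ↦ connectionMatrix G i z a b) y := by
  simp only [connectionMatrix, Matrix.of_apply]
  refine contDiffAt_const.mul (ContDiffAt.sum fun l _ ↦ (contDiffAt_inv_apply hG hdet a l).mul ?_)
  exact ((contDiffAt_partialDeriv (hG _ _) _).add (contDiffAt_partialDeriv (hG _ _) _)).sub
    (contDiffAt_partialDeriv (hG _ _) _)

lemma contDiffAt_coordScalarCurvature {G : EuclideanSpace ℝ (Fin n) → Matrix (Fin n) (Fin n) ℝ}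
    {y : EuclideanSpace ℝ (Fin n)} (hG : ∀ a b, ContDiffAt ℝ ∞ (fun z ↦ G z a b) y)
    (hdet : (G y).det ≠ 0) : ContDiffAt ℝ ∞ (coordScalarCurvature G) y := by
  have hΓ := contDiffAt_connectionMatrix hG hdet
  refine ContDiffAt.sum fun j _ ↦ ContDiffAt.sum fun k _ ↦
    (contDiffAt_inv_apply hG hdet j k).mul (ContDiffAt.sum fun i _ ↦ ?_)
  simp only [curvatureMatrix, Matrix.add_apply, Matrix.sub_apply, Matrix.mul_apply,
    matrixPartialDeriv, Matrix.of_apply]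
  refine ((contDiffAt_partialDeriv (hΓ _ _ _) _).sub (contDiffAt_partialDeriv (hΓ _ _ _) _)).add
    ((ContDiffAt.sum fun m _ ↦ ?_).sub (ContDiffAt.sum fun m _ ↦ ?_))
  · exact (hΓ _ _ _).mul (hΓ _ _ _)
  · exact (hΓ _ _ _).mul (hΓ _ _ _)

/-- Lowering the index of the Levi-Civita connection gives the Christoffel symbols of the first
kind. -/
lemma mul_connectionMatrix_apply {G : EuclideanSpace ℝ (Fin n) → Matrix (Fin n) (Fin n) ℝ}
    {y : EuclideanSpace ℝ (Fin n)} (hdet : (G y).det ≠ 0) (i l j : Fin n) :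
    (G y * connectionMatrix G i y) l j
      = 1 / 2 * (partialDeriv i (fun z ↦ G z j l) y + partialDeriv j (fun z ↦ G z i l) y
      - partialDeriv l (fun z ↦ G z i j) y) := by
  set w : Fin n → ℝ := fun l ↦ partialDeriv i (fun z ↦ G z j l) y
    + partialDeriv j (fun z ↦ G z i l) y - partialDeriv l (fun z ↦ G z i j) y with hw
  have h1 : (fun k ↦ connectionMatrix G i y k j) = (1 / 2 : ℝ) • ((G y)⁻¹).mulVec w := by
    ext k
    simp [connectionMatrix, Matrix.mulVec, dotProduct, hw]
  have h2 : (G y * connectionMatrix G i y) l j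
      = (G y).mulVec (fun k ↦ connectionMatrix G i y k j) l := by
    simp [Matrix.mul_apply, Matrix.mulVec, dotProduct]
  rw [h2, h1, Matrix.mulVec_smul, Matrix.mulVec_mulVec,
    Matrix.mul_nonsing_inv _ (isUnit_iff_ne_zero.2 hdet)]
  simp [hw]

lemma connectionMatrix_torsionFree {G : EuclideanSpace ℝ (Fin n) → Matrix (Fin n) (Fin n) ℝ}
    (hsymm : ∀ z, (G z).transpose = G z) (y : EuclideanSpace ℝ (Fin n)) (i j k : Fin n) :
    connectionMatrix G i y k j = connectionMatrix G j y k i := by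
  have h (a b : Fin n) : (fun z ↦ G z a b) = fun z ↦ G z b a := by
    ext z
    exact congrFun (congrFun (hsymm z) b) a
  simp only [connectionMatrix, Matrix.of_apply]
  rw [h i j]
  congr 1
  refine Finset.sum_congr rfl fun l _ ↦ ?_
  ring

lemma connectionMatrix_metricCompatible
    {G : EuclideanSpace ℝ (Fin n) → Matrix (Fin n) (Fin n) ℝ}
    {y : EuclideanSpace ℝ (Fin n)} (hsymm : ∀ z, (G z).transpose = G z)
    (hdet : (G y).det ≠ 0) (i : Fin n) :
    matrixPartialDeriv i G y
      = (connectionMatrix G i y).transpose * G y + G y * connectionMatrix G i y := by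
  have h (a b : Fin n) : (fun z ↦ G z a b) = fun z ↦ G z b a := by
    ext z
    exact congrFun (congrFun (hsymm z) b) a
  have h1 : (connectionMatrix G i y).transpose * G y
      = (G y * connectionMatrix G i y).transpose := by
    rw [Matrix.transpose_mul, hsymm]
  ext a b
  rw [h1, Matrix.add_apply, Matrix.transpose_apply, mul_connectionMatrix_apply hdet,
    mul_connectionMatrix_apply hdet]
  simp only [matrixPartialDeriv, Matrix.of_apply]
  rw [h b a]
  ring

/-- Uniqueness of the torsion-free metric connection, by the usual cyclic permutation of the
derivatives of the metric (Koszul's formula). -/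
lemma eq_connectionMatrix {G : EuclideanSpace ℝ (Fin n) → Matrix (Fin n) (Fin n) ℝ}
    {y : EuclideanSpace ℝ (Fin n)} (hsymm : ∀ z, (G z).transpose = G z)
    (hdet : (G y).det ≠ 0) {B : Fin n → Matrix (Fin n) (Fin n) ℝ}
    (htors : ∀ i j k, B i k j = B j k i)
    (hcomp : ∀ i, matrixPartialDeriv i G y = (B i).transpose * G y + G y * B i) (i : Fin n) :
    B i = connectionMatrix G i y := by
  have h0 (i a b : Fin n) : partialDeriv i (fun z ↦ G z a b) y
      = (G y * B i) b a + (G y * B i) a b := by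
    have h1 : (B i).transpose * G y = (G y * B i).transpose := by
      rw [Matrix.transpose_mul, hsymm]
    have h2 := congrFun (congrFun (hcomp i) a) b
    rwa [h1, Matrix.add_apply, Matrix.transpose_apply] at h2
  have ht (i j l : Fin n) : (G y * B i) l j = (G y * B j) l i := by
    simp only [Matrix.mul_apply, htors i j]
  have h3 : G y * B i = G y * connectionMatrix G i y := by
    ext l j
    rw [mul_connectionMatrix_apply hdet, h0, h0, h0, ht j i l, ht j l i, ht l i j]
    ring
  have hu : IsUnit (G y).det := isUnit_iff_ne_zero.2 hdet
  rw [← Matrix.nonsing_inv_mul_cancel_left (A := G y) (B := B i) hu, h3,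
    Matrix.nonsing_inv_mul_cancel_left _ _ hu]

/-! ### Change of coordinates -/

/-- The connection matrices of the pullback by `ψ` of the connection `d + ∑ Aᵦ dyᵝ`. -/
def pullbackConnection (ψ : EuclideanSpace ℝ (Fin n) → EuclideanSpace ℝ (Fin n))
    (A : Fin n → EuclideanSpace ℝ (Fin n) → Matrix (Fin n) (Fin n) ℝ) (i : Fin n)
    (y : EuclideanSpace ℝ (Fin n)) : Matrix (Fin n) (Fin n) ℝ :=
  ∑ b, jacobian ψ y b i • A b (ψ y)

lemma contDiffAt_jacobian {ψ : EuclideanSpace ℝ (Fin n) → EuclideanSpace ℝ (Fin n)}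
    {y : EuclideanSpace ℝ (Fin n)} (hψ : ContDiffAt ℝ ∞ ψ y) (a b : Fin n) :
    ContDiffAt ℝ ∞ (fun z ↦ jacobian ψ z a b) y :=
  contDiffAt_partialDeriv (contDiffAt_coord hψ a) b

lemma contDiffAt_pullbackConnection {ψ : EuclideanSpace ℝ (Fin n) → EuclideanSpace ℝ (Fin n)}
    {A : Fin n → EuclideanSpace ℝ (Fin n) → Matrix (Fin n) (Fin n) ℝ}
    {y : EuclideanSpace ℝ (Fin n)} (hψ : ContDiffAt ℝ ∞ ψ y)
    (hA : ∀ i a b, ContDiffAt ℝ ∞ (fun z ↦ A i z a b) (ψ y)) (i a b : Fin n) :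
    ContDiffAt ℝ ∞ (fun z ↦ pullbackConnection ψ A i z a b) y := by
  simp only [pullbackConnection, Matrix.sum_apply, Matrix.smul_apply, smul_eq_mul]
  exact ContDiffAt.sum fun c _ ↦ (contDiffAt_jacobian hψ c i).mul ((hA c a b).comp y hψ)

/-- The curvature of a pullback connection is the pullback of the curvature. -/
lemma curvatureMatrix_pullbackConnection
    {ψ : EuclideanSpace ℝ (Fin n) → EuclideanSpace ℝ (Fin n)}
    {A : Fin n → EuclideanSpace ℝ (Fin n) → Matrix (Fin n) (Fin n) ℝ}
    {y : EuclideanSpace ℝ (Fin n)} (hψ : ContDiffAt ℝ ∞ ψ y)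
    (hA : ∀ i a b, ContDiffAt ℝ ∞ (fun z ↦ A i z a b) (ψ y)) (i j : Fin n) :
    curvatureMatrix (pullbackConnection ψ A) i j y
      = ∑ b, ∑ c, (jacobian ψ y b i * jacobian ψ y c j) • curvatureMatrix A b c (ψ y) := by
  have hψd : DifferentiableAt ℝ ψ y := hψ.differentiableAt (by simp)
  have hJd (a b) : DifferentiableAt ℝ (fun z ↦ jacobian ψ z a b) y :=
    (contDiffAt_jacobian hψ a b).differentiableAt (by simp)
  have hAd (i a b) : DifferentiableAt ℝ (fun z ↦ A i z a b) (ψ y) :=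
    (hA i a b).differentiableAt (by simp)
  have hder (i j : Fin n) : matrixPartialDeriv i (pullbackConnection ψ A j) y
      = (∑ b, partialDeriv i (fun z ↦ jacobian ψ z b j) y • A b (ψ y))
        + ∑ b, ∑ c, (jacobian ψ y b i * jacobian ψ y c j) • matrixPartialDeriv b (A c) (ψ y) := by
    ext p q
    simp only [matrixPartialDeriv, pullbackConnection, Matrix.of_apply, Matrix.sum_apply,
      Matrix.smul_apply, smul_eq_mul, Matrix.add_apply]
    rw [partialDeriv_sum (f := fun c z ↦ jacobian ψ z c j * A c (ψ z) p q)
        (fun c _ ↦ (hJd c j).mul ((hAd c p q).comp y hψd)),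
      Finset.sum_comm, ← Finset.sum_add_distrib]
    refine Finset.sum_congr rfl fun c _ ↦ ?_
    rw [partialDeriv_mul (g := fun z ↦ A c (ψ z) p q) (hJd c j) ((hAd c p q).comp y hψd),
      partialDeriv_comp (hAd c p q) hψd, Finset.mul_sum]
    congr 1
    exact Finset.sum_congr rfl fun b _ ↦ by ring
  have hsym (b : Fin n) : partialDeriv i (fun z ↦ jacobian ψ z b j) y
      = partialDeriv j (fun z ↦ jacobian ψ z b i) y :=
    partialDeriv_comm (contDiffAt_coord hψ b) i j
  have hprod (i j : Fin n) : pullbackConnection ψ A i y * pullbackConnection ψ A j y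
      = ∑ b, ∑ c, (jacobian ψ y b i * jacobian ψ y c j) • (A b (ψ y) * A c (ψ y)) := by
    simp only [pullbackConnection, Finset.sum_mul, Finset.mul_sum, Matrix.smul_mul,
      Matrix.mul_smul, smul_smul]
    rw [Finset.sum_comm]
    exact Finset.sum_congr rfl fun _ _ ↦ Finset.sum_congr rfl fun _ _ ↦ by rw [mul_comm]
  have hswap (F : Fin n → Fin n → Matrix (Fin n) (Fin n) ℝ) :
      ∑ b, ∑ c, (jacobian ψ y b j * jacobian ψ y c i) • F b c
        = ∑ b, ∑ c, (jacobian ψ y b i * jacobian ψ y c j) • F c b := by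
    rw [Finset.sum_comm]
    exact Finset.sum_congr rfl fun _ _ ↦ Finset.sum_congr rfl fun _ _ ↦ by rw [mul_comm]
  rw [curvatureMatrix, hder, hder, hprod, hprod, hswap, hswap]
  simp only [hsym, curvatureMatrix, smul_add, smul_sub, Finset.sum_add_distrib,
    Finset.sum_sub_distrib]
  abel

/-- Transformation law of the Levi-Civita connection: the Jacobian matrix is a gauge
transformation between the Levi-Civita connection of `ψ^* G'` and the pullback of that of `G'`. The
gauge transform `B` of the pullback is torsion free, because the second derivatives of `ψ` are
symmetric, and it is compatible with `ψ^* G'`; the uniqueness lemma applies. -/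
lemma jacobian_mul_connectionMatrix
    {G G' : EuclideanSpace ℝ (Fin n) → Matrix (Fin n) (Fin n) ℝ}
    {ψ : EuclideanSpace ℝ (Fin n) → EuclideanSpace ℝ (Fin n)} {y : EuclideanSpace ℝ (Fin n)}
    (hψ : ContDiffAt ℝ ∞ ψ y) (hJ : (jacobian ψ y).det ≠ 0)
    (hsymm : ∀ z, (G z).transpose = G z) (hsymm' : ∀ z, (G' z).transpose = G' z)
    (hdet' : (G' (ψ y)).det ≠ 0) (hG' : ∀ a b, ContDiffAt ℝ ∞ (fun z ↦ G' z a b) (ψ y))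
    (hGG' : G =ᶠ[𝓝 y] fun z ↦ (jacobian ψ z).transpose * G' (ψ z) * jacobian ψ z) (i : Fin n) :
    jacobian ψ y * connectionMatrix G i y
      = matrixPartialDeriv i (jacobian ψ) y
        + pullbackConnection ψ (connectionMatrix G') i y * jacobian ψ y := by
  have hψd : DifferentiableAt ℝ ψ y := hψ.differentiableAt (by simp)
  have hJd (a b) : DifferentiableAt ℝ (fun z ↦ jacobian ψ z a b) y :=
    (contDiffAt_jacobian hψ a b).differentiableAt (by simp)
  have hG'd (a b) : DifferentiableAt ℝ (fun z ↦ G' z a b) (ψ y) :=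
    (hG' a b).differentiableAt (by simp)
  have hu : IsUnit (jacobian ψ y).det := isUnit_iff_ne_zero.2 hJ
  have hy : G y = (jacobian ψ y).transpose * G' (ψ y) * jacobian ψ y := hGG'.self_of_nhds
  have hdet : (G y).det ≠ 0 := by
    rw [hy, Matrix.det_mul, Matrix.det_mul, Matrix.det_transpose]
    positivity
  set J := jacobian ψ y with hJdef
  set A := fun i ↦ pullbackConnection ψ (connectionMatrix G') i y with hAdef
  set B : Fin n → Matrix (Fin n) (Fin n) ℝ :=
    fun i ↦ J⁻¹ * (matrixPartialDeriv i (jacobian ψ) y + A i * J) with hB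
  have hJB (i : Fin n) : J * B i = matrixPartialDeriv i (jacobian ψ) y + A i * J :=
    Matrix.mul_nonsing_inv_cancel_left _ _ hu
  have htors (i j k : Fin n) : B i k j = B j k i := by
    have h (a : Fin n) : (matrixPartialDeriv i (jacobian ψ) y + A i * J) a j
        = (matrixPartialDeriv j (jacobian ψ) y + A j * J) a i := by
      rw [Matrix.add_apply, Matrix.add_apply]
      congr 1
      · exact partialDeriv_comm (contDiffAt_coord hψ a) i j
      · simp only [hAdef, pullbackConnection, Matrix.mul_apply, Matrix.sum_apply,
          Matrix.smul_apply, smul_eq_mul, Finset.sum_mul]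
        rw [Finset.sum_comm]
        refine Finset.sum_congr rfl fun b _ ↦ Finset.sum_congr rfl fun c _ ↦ ?_
        rw [connectionMatrix_torsionFree hsymm' (ψ y) c b a]
        ring
    simp only [hB, Matrix.mul_apply (M := J⁻¹), h]
  have hpull (i : Fin n) : matrixPartialDeriv i (fun z ↦ G' (ψ z)) y
      = (A i).transpose * G' (ψ y) + G' (ψ y) * A i := by
    rw [matrixPartialDeriv_comp hG'd hψd]
    simp only [connectionMatrix_metricCompatible hsymm' hdet', hAdef, pullbackConnection,
      Matrix.transpose_sum, Matrix.transpose_smul, Finset.sum_mul, Finset.mul_sum, smul_add,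
      Finset.sum_add_distrib, Matrix.smul_mul, Matrix.mul_smul]
  have hcompd (a b) : DifferentiableAt ℝ (fun z ↦ G' (ψ z) a b) y := (hG'd a b).comp y hψd
  have hcomp (i : Fin n) : matrixPartialDeriv i G y = (B i).transpose * G y + G y * B i := by
    rw [matrixPartialDeriv_congr hGG',
      matrixPartialDeriv_mul (A := fun z ↦ (jacobian ψ z).transpose * G' (ψ z)) ?_ hJd,
      matrixPartialDeriv_mul (A := fun z ↦ (jacobian ψ z).transpose) (fun a b ↦ hJd b a) hcompd,
      matrixPartialDeriv_transpose, hpull, hy]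
    · have h1 : matrixPartialDeriv i (jacobian ψ) y = J * B i - A i * J := by
        rw [hJB]
        abel
      rw [h1, ← hJdef]
      simp only [Matrix.transpose_sub, Matrix.transpose_mul]
      noncomm_ring
    · intro a b
      simp only [Matrix.mul_apply, Matrix.transpose_apply]
      exact DifferentiableAt.fun_sum fun k _ ↦ (hJd k a).mul (hcompd k b)
  rw [← eq_connectionMatrix hsymm hdet htors hcomp i, hJB]

/-- Transformation law of the curvature under a change of coordinates: the gauge relation of
`jacobian_mul_connectionMatrix` is differentiated once more and antisymmetrized, which cancels the
second derivatives of the Jacobian matrix. -/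
lemma jacobian_mul_curvatureMatrix
    {G G' : EuclideanSpace ℝ (Fin n) → Matrix (Fin n) (Fin n) ℝ}
    {ψ : EuclideanSpace ℝ (Fin n) → EuclideanSpace ℝ (Fin n)} {y : EuclideanSpace ℝ (Fin n)}
    (hψ' : ∀ᶠ z in 𝓝 y, ContDiffAt ℝ ∞ ψ z) (hJ : (jacobian ψ y).det ≠ 0)
    (hsymm : ∀ z, (G z).transpose = G z) (hsymm' : ∀ z, (G' z).transpose = G' z)
    (hdet' : (G' (ψ y)).det ≠ 0) (hG : ∀ a b, ContDiffAt ℝ ∞ (fun z ↦ G z a b) y)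
    (hGs' : ∀ᶠ w in 𝓝 (ψ y), ∀ a b, ContDiffAt ℝ ∞ (fun z ↦ G' z a b) w)
    (hGG' : G =ᶠ[𝓝 y] fun z ↦ (jacobian ψ z).transpose * G' (ψ z) * jacobian ψ z) (i j : Fin n) :
    jacobian ψ y * curvatureMatrix (connectionMatrix G) i j y
      = (∑ b, ∑ c, (jacobian ψ y b i * jacobian ψ y c j) •
          curvatureMatrix (connectionMatrix G') b c (ψ y)) * jacobian ψ y := by
  have hψ := hψ'.self_of_nhds
  have hG' := hGs'.self_of_nhds
  have hJd (a b) : DifferentiableAt ℝ (fun z ↦ jacobian ψ z a b) y :=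
    (contDiffAt_jacobian hψ a b).differentiableAt (by simp)
  have hy : G y = (jacobian ψ y).transpose * G' (ψ y) * jacobian ψ y := hGG'.self_of_nhds
  have hdet : (G y).det ≠ 0 := by
    rw [hy, Matrix.det_mul, Matrix.det_mul, Matrix.det_transpose]
    positivity
  have hΓ (i a b) : DifferentiableAt ℝ (fun z ↦ connectionMatrix G i z a b) y :=
    (contDiffAt_connectionMatrix hG hdet i a b).differentiableAt (by simp)
  have hΓ' := contDiffAt_connectionMatrix hG' hdet'
  set A := pullbackConnection ψ (connectionMatrix G') with hAdef
  have hA (i a b) : DifferentiableAt ℝ (fun z ↦ A i z a b) y :=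
    (contDiffAt_pullbackConnection hψ hΓ' i a b).differentiableAt (by simp)
  have hgauge (i : Fin n) : (fun z ↦ jacobian ψ z * connectionMatrix G i z) =ᶠ[𝓝 y]
      fun z ↦ matrixPartialDeriv i (jacobian ψ) z + A i z * jacobian ψ z := by
    have e2 : ∀ᶠ z in 𝓝 y, (jacobian ψ z).det ≠ 0 :=
      (contDiffAt_det (contDiffAt_jacobian hψ)).continuousAt.eventually_ne hJ
    have e3 : ∀ᶠ z in 𝓝 y, (G' (ψ z)).det ≠ 0 :=
      ((contDiffAt_det hG').continuousAt.comp hψ.continuousAt).eventually_ne hdet'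
    have e4 : ∀ᶠ z in 𝓝 y, ∀ a b, ContDiffAt ℝ ∞ (fun z ↦ G' z a b) (ψ z) :=
      hψ.continuousAt.eventually hGs'
    filter_upwards [hψ', e2, e3, e4, hGG'.eventuallyEq_nhds] with z h1 h2 h3 h4 h5
    exact jacobian_mul_connectionMatrix h1 h2 hsymm hsymm' h3 h4 h5 i
  have hg (i : Fin n) : matrixPartialDeriv i (jacobian ψ) y
      = jacobian ψ y * connectionMatrix G i y - A i y * jacobian ψ y := by
    have h : jacobian ψ y * connectionMatrix G i y = matrixPartialDeriv i (jacobian ψ) y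
        + A i y * jacobian ψ y := (hgauge i).self_of_nhds
    rw [h]
    abel
  have hgd (i j : Fin n) : matrixPartialDeriv i (jacobian ψ) y * connectionMatrix G j y
        + jacobian ψ y * matrixPartialDeriv i (connectionMatrix G j) y
      = matrixPartialDeriv i (matrixPartialDeriv j (jacobian ψ)) y
        + (matrixPartialDeriv i (A j) y * jacobian ψ y
          + A j y * matrixPartialDeriv i (jacobian ψ) y) := by
    have h := matrixPartialDeriv_congr (hgauge j) i
    rwa [matrixPartialDeriv_mul hJd (hΓ j), matrixPartialDeriv_add,
      matrixPartialDeriv_mul (hA j) hJd] at h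
    · intro a b
      exact (contDiffAt_partialDeriv (contDiffAt_jacobian hψ a b) j).differentiableAt (by simp)
    · intro a b
      simp only [Matrix.mul_apply]
      exact DifferentiableAt.fun_sum fun k _ ↦ (hA j a k).mul (hJd k b)
  have hsym : matrixPartialDeriv i (matrixPartialDeriv j (jacobian ψ)) y
      = matrixPartialDeriv j (matrixPartialDeriv i (jacobian ψ)) y := by
    ext a b
    exact partialDeriv_comm (contDiffAt_jacobian hψ a b) i j
  have h1 := hgd i j
  have h2 := hgd j i
  rw [← curvatureMatrix_pullbackConnection hψ hΓ', ← hAdef, curvatureMatrix, curvatureMatrix]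
  rw [hsym] at h1
  have h3 : jacobian ψ y * matrixPartialDeriv i (connectionMatrix G j) y
        - jacobian ψ y * matrixPartialDeriv j (connectionMatrix G i) y
      = matrixPartialDeriv i (A j) y * jacobian ψ y + A j y * matrixPartialDeriv i (jacobian ψ) y
        - matrixPartialDeriv i (jacobian ψ) y * connectionMatrix G j y
        - (matrixPartialDeriv j (A i) y * jacobian ψ y + A i y * matrixPartialDeriv j (jacobian ψ) y
        - matrixPartialDeriv j (jacobian ψ) y * connectionMatrix G i y) := by
    rw [eq_sub_of_add_eq' h1, eq_sub_of_add_eq' h2]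
    abel
  rw [mul_add, mul_sub, h3, hg, hg]
  noncomm_ring

/-- The scalar curvature is invariant under a change of coordinates. -/
theorem coordScalarCurvature_eq
    {G G' : EuclideanSpace ℝ (Fin n) → Matrix (Fin n) (Fin n) ℝ}
    {ψ : EuclideanSpace ℝ (Fin n) → EuclideanSpace ℝ (Fin n)} {y : EuclideanSpace ℝ (Fin n)}
    (hψ' : ∀ᶠ z in 𝓝 y, ContDiffAt ℝ ∞ ψ z) (hJ : (jacobian ψ y).det ≠ 0)
    (hsymm : ∀ z, (G z).transpose = G z) (hsymm' : ∀ z, (G' z).transpose = G' z)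
    (hdet' : (G' (ψ y)).det ≠ 0) (hG : ∀ a b, ContDiffAt ℝ ∞ (fun z ↦ G z a b) y)
    (hGs' : ∀ᶠ w in 𝓝 (ψ y), ∀ a b, ContDiffAt ℝ ∞ (fun z ↦ G' z a b) w)
    (hGG' : G =ᶠ[𝓝 y] fun z ↦ (jacobian ψ z).transpose * G' (ψ z) * jacobian ψ z) :
    coordScalarCurvature G y = coordScalarCurvature G' (ψ y) := by
  have hu : IsUnit (jacobian ψ y).det := isUnit_iff_ne_zero.2 hJ
  have hy : G y = (jacobian ψ y).transpose * G' (ψ y) * jacobian ψ y := hGG'.self_of_nhds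
  have hF := jacobian_mul_curvatureMatrix hψ' hJ hsymm hsymm' hdet' hG hGs' hGG'
  set J := jacobian ψ y with hJdef
  set F := curvatureMatrix (connectionMatrix G)
  set F' := curvatureMatrix (connectionMatrix G')
  set Ric : Matrix (Fin n) (Fin n) ℝ := Matrix.of fun j k ↦ ∑ i, F i j y i k with hRic
  set Ric' : Matrix (Fin n) (Fin n) ℝ := Matrix.of fun j k ↦ ∑ i, F' i j (ψ y) i k with hRic'
  have htr (H R : Matrix (Fin n) (Fin n) ℝ) :
      ∑ j, ∑ k, H j k * R j k = (H * R.transpose).trace := by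
    simp [Matrix.trace, Matrix.mul_apply]
  have hJJ : J * J⁻¹ = 1 := Matrix.mul_nonsing_inv _ hu
  have hRicEq : Ric = J.transpose * Ric' * J := by
    have hF2 (i j : Fin n) : F i j y
        = ∑ b, ∑ c, (J b i * J c j) • (J⁻¹ * F' b c (ψ y) * J) := by
      rw [← Matrix.nonsing_inv_mul_cancel_left J (F i j y) hu, hF i j]
      simp only [Finset.sum_mul, Finset.mul_sum, Matrix.smul_mul, Matrix.mul_smul, mul_assoc]
    ext j k
    simp only [hRic, Matrix.of_apply, hF2, Matrix.sum_apply, Matrix.smul_apply, smul_eq_mul]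
    -- the contraction of the index `i` with the inverse Jacobian
    have hcontr (b : Fin n) (X : Matrix (Fin n) (Fin n) ℝ) :
        ∑ i, J b i * (J⁻¹ * X * J) i k = (X * J) b k := by
      have : ∑ i, J b i * (J⁻¹ * X * J) i k = (J * (J⁻¹ * X * J)) b k := by
        rw [Matrix.mul_apply]
      rw [this, mul_assoc, ← mul_assoc, hJJ, one_mul]
    have h1 : ∑ i, ∑ b, ∑ c, J b i * J c j * (J⁻¹ * F' b c (ψ y) * J) i k
        = ∑ c, J c j * ∑ b, (F' b c (ψ y) * J) b k := by
      rw [Finset.sum_comm]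
      have : ∀ b, ∑ i, ∑ c, J b i * J c j * (J⁻¹ * F' b c (ψ y) * J) i k
          = ∑ c, J c j * (F' b c (ψ y) * J) b k := by
        intro b
        rw [Finset.sum_comm]
        refine Finset.sum_congr rfl fun c _ ↦ ?_
        rw [← hcontr, Finset.mul_sum]
        exact Finset.sum_congr rfl fun i _ ↦ by ring
      simp only [this]
      rw [Finset.sum_comm]
      simp only [Finset.mul_sum]
    rw [h1]
    simp only [mul_assoc J.transpose, Matrix.mul_apply (M := J.transpose), Matrix.transpose_apply]
    refine Finset.sum_congr rfl fun c _ ↦ ?_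
    congr 1
    simp only [Matrix.mul_apply, hRic', Matrix.of_apply, Finset.sum_mul]
    rw [Finset.sum_comm]
  have h1 : coordScalarCurvature G y = ((G y)⁻¹ * Ric.transpose).trace := by
    rw [← htr]
    rfl
  have h2 : coordScalarCurvature G' (ψ y) = ((G' (ψ y))⁻¹ * Ric'.transpose).trace := by
    rw [← htr]
    rfl
  rw [h1, h2, hRicEq, hy, Matrix.mul_inv_rev, Matrix.mul_inv_rev, Matrix.transpose_mul,
    Matrix.transpose_mul, Matrix.transpose_transpose, ← mul_assoc]
  have hut : IsUnit J.transpose.det := by rwa [Matrix.det_transpose]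
  have h3 : J⁻¹ * ((G' (ψ y))⁻¹ * J.transpose⁻¹) * J.transpose
      = J⁻¹ * (G' (ψ y))⁻¹ := by
    rw [mul_assoc, mul_assoc, Matrix.nonsing_inv_mul _ hut, mul_one]
  rw [h3, ← mul_assoc, Matrix.trace_mul_comm, ← mul_assoc, ← mul_assoc, hJJ, one_mul]

end Coordinates

/-! ### Transition maps between charts -/

section Transition

variable {n : ℕ} {M : Type*} [TopologicalSpace M] [ChartedSpace (EuclideanSpace ℝ (Fin n)) M]

/-- The derivative at `y` of the inverse of the preferred chart at `x₀`, as an endomorphism of the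
model space. -/
def chartSymmDeriv (x₀ : M) (y : EuclideanSpace ℝ (Fin n)) :
    EuclideanSpace ℝ (Fin n) →L[ℝ] EuclideanSpace ℝ (Fin n) :=
  mfderiv 𝓘(ℝ, EuclideanSpace ℝ (Fin n)) (𝓡 n) (extChartAt (𝓡 n) x₀).symm y

/-- The transition map from the preferred chart at `x₀` to that at `x₁`. -/
def chartTransition (x₀ x₁ : M) (y : EuclideanSpace ℝ (Fin n)) : EuclideanSpace ℝ (Fin n) :=
  extChartAt (𝓡 n) x₁ ((extChartAt (𝓡 n) x₀).symm y)

/-- The open set of `ℝⁿ` where the transition map from the preferred chart at `x₀` to that at `x₁`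
is defined. -/
def chartOverlap (x₀ x₁ : M) : Set (EuclideanSpace ℝ (Fin n)) :=
  (extChartAt (𝓡 n) x₀).target ∩ (extChartAt (𝓡 n) x₀).symm ⁻¹' (extChartAt (𝓡 n) x₁).source

lemma isOpen_chartOverlap (x₀ x₁ : M) : IsOpen (chartOverlap (n := n) x₀ x₁) :=
  (continuousOn_extChartAt_symm x₀).isOpen_inter_preimage (isOpen_extChartAt_target x₀)
    (isOpen_extChartAt_source x₁)

variable [IsManifold (𝓡 n) ∞ M]

lemma mdifferentiableAt_extChartAt_symm' {x₀ : M} {y : EuclideanSpace ℝ (Fin n)}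
    (hy : y ∈ (extChartAt (𝓡 n) x₀).target) :
    MDifferentiableAt 𝓘(ℝ, EuclideanSpace ℝ (Fin n)) (𝓡 n) (extChartAt (𝓡 n) x₀).symm y :=
  ((contMDiffOn_extChartAt_symm (n := ∞) x₀).contMDiffAt
    ((isOpen_extChartAt_target x₀).mem_nhds hy)).mdifferentiableAt (by simp)

lemma chartSymmDeriv_bijective {x₀ : M} {y : EuclideanSpace ℝ (Fin n)}
    (hy : y ∈ (extChartAt (𝓡 n) x₀).target) : Function.Bijective (chartSymmDeriv x₀ y) := by
  have h := isInvertible_mfderivWithin_extChartAt_symm (I := 𝓡 n) hy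
  rw [ModelWithCorners.range_eq_univ, mfderivWithin_univ] at h
  exact h.bijective

lemma contDiffAt_chartTransition {x₀ x₁ : M} {y : EuclideanSpace ℝ (Fin n)}
    (hy : y ∈ chartOverlap x₀ x₁) : ContDiffAt ℝ ∞ (chartTransition x₀ x₁) y := by
  have h := contDiffWithinAt_ext_coord_change (I := 𝓡 n) (n := ∞) x₁ x₀ (y := y)
    (by simpa [PartialEquiv.trans_source, chartOverlap] using hy)
  rwa [ModelWithCorners.range_eq_univ, contDiffWithinAt_univ] at h

lemma chartSymmDeriv_eq_comp {x₀ x₁ : M} {y : EuclideanSpace ℝ (Fin n)}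
    (hy : y ∈ chartOverlap x₀ x₁) : chartSymmDeriv x₀ y
      = (chartSymmDeriv x₁ (chartTransition x₀ x₁ y)).comp (fderiv ℝ (chartTransition x₀ x₁) y) := by
  have hev : ((extChartAt (𝓡 n) x₀).symm : EuclideanSpace ℝ (Fin n) → M) =ᶠ[𝓝 y]
      (extChartAt (𝓡 n) x₁).symm ∘ chartTransition x₀ x₁ := by
    filter_upwards [(isOpen_chartOverlap x₀ x₁).mem_nhds hy] with z hz
    exact ((extChartAt (𝓡 n) x₁).left_inv hz.2).symm
  have hψ : ContDiffAt ℝ ∞ (chartTransition x₀ x₁) y := contDiffAt_chartTransition hy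
  have h2 : MDifferentiableAt 𝓘(ℝ, EuclideanSpace ℝ (Fin n)) 𝓘(ℝ, EuclideanSpace ℝ (Fin n))
      (chartTransition x₀ x₁) y := (hψ.differentiableAt (by simp)).mdifferentiableAt
  have h3 : MDifferentiableAt 𝓘(ℝ, EuclideanSpace ℝ (Fin n)) (𝓡 n) (extChartAt (𝓡 n) x₁).symm
      (chartTransition x₀ x₁ y) :=
    mdifferentiableAt_extChartAt_symm' ((extChartAt (𝓡 n) x₁).map_source hy.2)
  have h4 := mfderiv_comp y h3 h2
  rw [mfderiv_eq_fderiv] at h4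
  unfold chartSymmDeriv
  rw [hev.mfderiv_eq]
  exact h4

end Transition

/-! ### The metric and the scalar curvature in charts -/

section Charts

variable {n : ℕ} {M : Type*} [TopologicalSpace M] [ChartedSpace (EuclideanSpace ℝ (Fin n)) M]
  [RiemannianBundle (fun x : M ↦ TangentSpace (𝓡 n) x)]

/-- The Riemannian inner product at `x`, as a function on the model space of the tangent spaces:
in this form the base point can be rewritten. -/
def metricAt (x : M) (v w : EuclideanSpace ℝ (Fin n)) : ℝ :=
  inner ℝ (show TangentSpace (𝓡 n) x from v) (show TangentSpace (𝓡 n) x from w)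

lemma metricMatrix_apply (x₀ : M) (y : EuclideanSpace ℝ (Fin n)) (i j : Fin n) :
    metricMatrix x₀ y i j = metricAt ((extChartAt (𝓡 n) x₀).symm y)
      (chartSymmDeriv x₀ y (EuclideanSpace.single i 1))
      (chartSymmDeriv x₀ y (EuclideanSpace.single j 1)) := rfl

lemma metricAt_sum (x : M) {ι κ : Type*} (s : Finset ι) (t : Finset κ) (a : ι → ℝ) (b : κ → ℝ)
    (v : ι → EuclideanSpace ℝ (Fin n)) (w : κ → EuclideanSpace ℝ (Fin n)) :
    metricAt x (∑ i ∈ s, a i • v i) (∑ j ∈ t, b j • w j)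
      = ∑ i ∈ s, ∑ j ∈ t, a i * b j * metricAt x (v i) (w j) := by
  have h : metricAt x (∑ i ∈ s, a i • v i) (∑ j ∈ t, b j • w j)
      = inner ℝ (∑ i ∈ s, a i • (show TangentSpace (𝓡 n) x from v i))
        (∑ j ∈ t, b j • (show TangentSpace (𝓡 n) x from w j)) := rfl
  rw [h, sum_inner]
  refine Finset.sum_congr rfl fun i _ ↦ ?_
  rw [inner_sum]
  refine Finset.sum_congr rfl fun j _ ↦ ?_
  rw [real_inner_smul_left, real_inner_smul_right, mul_assoc]
  rfl

/-- The metric in a chart, evaluated on vectors of the model space. -/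
lemma metricAt_chartSymmDeriv (x₀ : M) (y v w : EuclideanSpace ℝ (Fin n)) :
    metricAt ((extChartAt (𝓡 n) x₀).symm y) (chartSymmDeriv x₀ y v) (chartSymmDeriv x₀ y w)
      = ∑ i, ∑ j, v i * w j * metricMatrix x₀ y i j := by
  have hv (u : EuclideanSpace ℝ (Fin n)) :
      chartSymmDeriv x₀ y u = ∑ i, u i • chartSymmDeriv x₀ y (EuclideanSpace.single i 1) := by
    conv_lhs => rw [← (EuclideanSpace.basisFun (Fin n) ℝ).sum_repr u, map_sum]
    simp
  rw [hv v, hv w, metricAt_sum]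
  rfl

lemma metricMatrix_symm (x₀ : M) (y : EuclideanSpace ℝ (Fin n)) :
    (metricMatrix x₀ y).transpose = metricMatrix x₀ y := by
  ext i j
  exact real_inner_comm (coordVec x₀ i y) (coordVec x₀ j y)

lemma scalarCurvature_eq_self (x : M) :
    scalarCurvature n x = coordScalarCurvature (metricMatrix x) (extChartAt (𝓡 n) x x) := by
  unfold scalarCurvature coordScalarCurvature
  refine Finset.sum_congr rfl fun j _ ↦ Finset.sum_congr rfl fun k _ ↦ ?_
  congr 1
  unfold ricciCoeff
  refine Finset.sum_congr rfl fun i _ ↦ ?_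
  simp only [curvatureCoeff, curvatureMatrix, Matrix.add_apply, Matrix.sub_apply,
    Matrix.mul_apply, Finset.sum_sub_distrib]
  rfl

variable [IsManifold (𝓡 n) ∞ M]

lemma metricMatrix_posDef {x₀ : M} {y : EuclideanSpace ℝ (Fin n)}
    (hy : y ∈ (extChartAt (𝓡 n) x₀).target) : (metricMatrix x₀ y).PosDef := by
  have hlin : LinearIndependent ℝ fun i ↦ coordVec x₀ i y := by
    have h1 : LinearIndependent ℝ fun i ↦ EuclideanSpace.single (𝕜 := ℝ) (i : Fin n) (1 : ℝ) := by
      convert! (EuclideanSpace.basisFun (Fin n) ℝ).toBasis.linearIndependent with i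
      simp
    exact h1.map' (chartSymmDeriv x₀ y).toLinearMap
      (LinearMap.ker_eq_bot.2 (chartSymmDeriv_bijective hy).injective)
  exact Matrix.posDef_gram_of_linearIndependent hlin

lemma metricMatrix_det_pos {x₀ : M} {y : EuclideanSpace ℝ (Fin n)}
    (hy : y ∈ (extChartAt (𝓡 n) x₀).target) : 0 < (metricMatrix x₀ y).det :=
  (metricMatrix_posDef hy).det_pos

lemma metricMatrix_eq_transition {x₀ x₁ : M} {y : EuclideanSpace ℝ (Fin n)}
    (hy : y ∈ chartOverlap x₀ x₁) : metricMatrix x₀ y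
      = (jacobian (chartTransition x₀ x₁) y).transpose
        * metricMatrix x₁ (chartTransition x₀ x₁ y) * jacobian (chartTransition x₀ x₁) y := by
  have hψ : DifferentiableAt ℝ (chartTransition x₀ x₁) y :=
    (contDiffAt_chartTransition hy).differentiableAt (by simp)
  have hx : (extChartAt (𝓡 n) x₀).symm y
      = (extChartAt (𝓡 n) x₁).symm (chartTransition x₀ x₁ y) :=
    ((extChartAt (𝓡 n) x₁).left_inv hy.2).symm
  ext i j
  rw [metricMatrix_apply, chartSymmDeriv_eq_comp hy, hx]
  simp only [ContinuousLinearMap.comp_apply]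
  rw [metricAt_chartSymmDeriv]
  simp only [Matrix.mul_apply, Matrix.transpose_apply, jacobian_apply_eq hψ, Finset.sum_mul]
  rw [Finset.sum_comm]
  exact Finset.sum_congr rfl fun a _ ↦ Finset.sum_congr rfl fun b _ ↦ by ring

lemma jacobian_chartTransition_det_ne_zero {x₀ x₁ : M} {y : EuclideanSpace ℝ (Fin n)}
    (hy : y ∈ chartOverlap x₀ x₁) : (jacobian (chartTransition x₀ x₁) y).det ≠ 0 := by
  intro h
  have h1 := (metricMatrix_det_pos hy.1).ne'
  rw [metricMatrix_eq_transition hy, Matrix.det_mul, h, mul_zero] at h1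
  exact h1 rfl

variable [IsContMDiffRiemannianBundle (𝓡 n) ∞ (EuclideanSpace ℝ (Fin n))
      (fun x : M ↦ TangentSpace (𝓡 n) x)]

lemma contDiffAt_metricMatrix {x₀ : M} {y : EuclideanSpace ℝ (Fin n)}
    (hy : y ∈ (extChartAt (𝓡 n) x₀).target) (i j : Fin n) :
    ContDiffAt ℝ ∞ (fun z ↦ metricMatrix x₀ z i j) y := by
  have hopen : IsOpen (extChartAt (𝓡 n) x₀).target := isOpen_extChartAt_target x₀
  have hsec (i : Fin n) : ContMDiffOn 𝓘(ℝ, EuclideanSpace ℝ (Fin n)) (𝓡 n).tangent ∞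
      (fun z ↦ (⟨(extChartAt (𝓡 n) x₀).symm z, coordVec x₀ i z⟩ : TangentBundle (𝓡 n) M))
      (extChartAt (𝓡 n) x₀).target := by
    have h1 := (contMDiffOn_extChartAt_symm (I := 𝓡 n) (n := ∞) x₀).contMDiffOn_tangentMapWithin
      (m := ∞) (by simp) hopen.uniqueMDiffOn
    have h2 : ContMDiff 𝓘(ℝ, EuclideanSpace ℝ (Fin n))
        (𝓘(ℝ, EuclideanSpace ℝ (Fin n))).tangent ∞
        (fun z ↦ (⟨z, EuclideanSpace.single i (1 : ℝ)⟩ :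
          TangentBundle 𝓘(ℝ, EuclideanSpace ℝ (Fin n)) (EuclideanSpace ℝ (Fin n)))) :=
      contMDiff_vectorSpace_iff_contDiff.2 contDiff_const
    refine (h1.comp h2.contMDiffOn (fun z hz ↦ hz)).congr fun z hz ↦ ?_
    simp only [Function.comp_apply, tangentMapWithin, coordVec,
      mfderivWithin_of_mem_nhds (hopen.mem_nhds hz)]
  have h := (hsec i).inner_bundle (hsec j)
  exact (h.contDiffOn).contDiffAt (hopen.mem_nhds hy)

/-- The scalar curvature can be computed in every chart, not just in the preferred chart at the
point. -/
theorem scalarCurvature_eq {x₀ x : M} (hx : x ∈ (extChartAt (𝓡 n) x₀).source) :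
    scalarCurvature n x = coordScalarCurvature (metricMatrix x₀) (extChartAt (𝓡 n) x₀ x) := by
  have hxx : (extChartAt (𝓡 n) x).symm (extChartAt (𝓡 n) x x) = x := by simp
  have hψ : chartTransition x x₀ (extChartAt (𝓡 n) x x) = extChartAt (𝓡 n) x₀ x := by
    rw [chartTransition, hxx]
  have hy : extChartAt (𝓡 n) x x ∈ chartOverlap x x₀ :=
    ⟨mem_extChartAt_target x, by rwa [mem_preimage, hxx]⟩
  have hnhds := (isOpen_chartOverlap x x₀).mem_nhds hy
  have hmem : extChartAt (𝓡 n) x₀ x ∈ (extChartAt (𝓡 n) x₀).target :=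
    (extChartAt (𝓡 n) x₀).map_source hx
  rw [scalarCurvature_eq_self, ← hψ]
  refine coordScalarCurvature_eq ?_ (jacobian_chartTransition_det_ne_zero hy)
    (metricMatrix_symm x) (metricMatrix_symm x₀) ?_ ?_ ?_ ?_
  · filter_upwards [hnhds] with z hz using contDiffAt_chartTransition hz
  · rw [hψ]
    exact (metricMatrix_det_pos hmem).ne'
  · exact contDiffAt_metricMatrix hy.1
  · rw [hψ]
    filter_upwards [(isOpen_extChartAt_target x₀).mem_nhds hmem] with z hz
      using contDiffAt_metricMatrix hz
  · filter_upwards [hnhds] with z hz using metricMatrix_eq_transition hz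

theorem continuous_scalarCurvature : Continuous (scalarCurvature n : M → ℝ) := by
  rw [continuous_iff_continuousAt]
  intro x₀
  have h1 : ContinuousAt (coordScalarCurvature (metricMatrix x₀)) (extChartAt (𝓡 n) x₀ x₀) :=
    (contDiffAt_coordScalarCurvature (contDiffAt_metricMatrix (mem_extChartAt_target x₀))
      (metricMatrix_det_pos (mem_extChartAt_target x₀)).ne').continuousAt
  refine (h1.comp (continuousAt_extChartAt x₀)).congr ?_
  filter_upwards [extChartAt_source_mem_nhds (I := 𝓡 n) x₀] with x hx
  exact (scalarCurvature_eq hx).symm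

end Charts

/-! ### The Riemannian volume -/

section VolumeDensity

variable {n : ℕ} {M : Type*} [TopologicalSpace M] [ChartedSpace (EuclideanSpace ℝ (Fin n)) M]
  [RiemannianBundle (fun x : M ↦ TangentSpace (𝓡 n) x)]

/-- The Riemannian volume density `√(det gᵢⱼ)` in the preferred chart at `x₀`. -/
def volumeDensity (x₀ : M) (y : EuclideanSpace ℝ (Fin n)) : ℝ≥0∞ :=
  ENNReal.ofReal √(metricMatrix x₀ y).det

variable [IsManifold (𝓡 n) ∞ M]

lemma volumeDensity_pos {x₀ : M} {y : EuclideanSpace ℝ (Fin n)}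
    (hy : y ∈ (extChartAt (𝓡 n) x₀).target) : 0 < volumeDensity x₀ y := by
  have := metricMatrix_det_pos hy
  simp only [volumeDensity, ENNReal.ofReal_pos]
  positivity

lemma volumeDensity_eq_transition {x₀ x₁ : M} {y : EuclideanSpace ℝ (Fin n)}
    (hy : y ∈ chartOverlap x₀ x₁) : volumeDensity x₀ y
      = ENNReal.ofReal |(fderiv ℝ (chartTransition x₀ x₁) y).det|
        * volumeDensity x₁ (chartTransition x₀ x₁ y) := by
  have hψ : DifferentiableAt ℝ (chartTransition x₀ x₁) y :=
    (contDiffAt_chartTransition hy).differentiableAt (by simp)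
  have hdet : (jacobian (chartTransition x₀ x₁) y).det
      = (fderiv ℝ (chartTransition x₀ x₁) y).det := by
    rw [ContinuousLinearMap.det,
      ← LinearMap.det_toMatrix (EuclideanSpace.basisFun (Fin n) ℝ).toBasis]
    congr 1
    ext a i
    rw [jacobian_apply_eq hψ, LinearMap.toMatrix_apply]
    simp
  rw [volumeDensity, volumeDensity, ← ENNReal.ofReal_mul (abs_nonneg _),
    metricMatrix_eq_transition hy,
    Matrix.det_mul, Matrix.det_mul, Matrix.det_transpose, hdet, ← Real.sqrt_sq_eq_abs,
    ← Real.sqrt_mul (sq_nonneg _)]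
  congr 2
  ring

variable [IsContMDiffRiemannianBundle (𝓡 n) ∞ (EuclideanSpace ℝ (Fin n))
      (fun x : M ↦ TangentSpace (𝓡 n) x)]

lemma continuousOn_volumeDensity (x₀ : M) :
    ContinuousOn (volumeDensity (n := n) x₀) (extChartAt (𝓡 n) x₀).target := by
  intro y hy
  have h := (contDiffAt_det (contDiffAt_metricMatrix hy)).continuousAt
  exact (ENNReal.continuous_ofReal.continuousAt.comp
    (Real.continuous_sqrt.continuousAt.comp h)).continuousWithinAt

lemma aemeasurable_volumeDensity (x₀ : M) : AEMeasurable (volumeDensity (n := n) x₀)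
    (volume.restrict (extChartAt (𝓡 n) x₀).target) :=
  (continuousOn_volumeDensity x₀).aemeasurable (isOpen_extChartAt_target x₀).measurableSet

end VolumeDensity

lemma measurableSet_target_inter_preimage {n : ℕ} {M : Type*} [TopologicalSpace M]
    [ChartedSpace (EuclideanSpace ℝ (Fin n)) M] [MeasurableSpace M] [BorelSpace M] (x₀ : M)
    {s : Set M} (hs : MeasurableSet s) :
    MeasurableSet ((extChartAt (𝓡 n) x₀).target ∩ (extChartAt (𝓡 n) x₀).symm ⁻¹' s) := by
  have h1 := (continuousOn_iff_continuous_domRestrict.1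
    (continuousOn_extChartAt_symm (I := 𝓡 n) x₀)).measurable hs
  have h2 := (isOpen_extChartAt_target (I := 𝓡 n) x₀).measurableSet.subtype_image h1
  convert h2 using 1
  ext y
  simp [and_comm]

section Volume

variable {n : ℕ} {M : Type*} [TopologicalSpace M] [ChartedSpace (EuclideanSpace ℝ (Fin n)) M]
  [RiemannianBundle (fun x : M ↦ TangentSpace (𝓡 n) x)] [MeasurableSpace M] [BorelSpace M]

lemma aemeasurable_extChartAt_symm (x₀ : M) : AEMeasurable (extChartAt (𝓡 n) x₀).symm
    ((volume.restrict (extChartAt (𝓡 n) x₀).target).withDensity (volumeDensity x₀)) :=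
  ((continuousOn_extChartAt_symm x₀).aemeasurable
    (isOpen_extChartAt_target x₀).measurableSet).mono_ac (withDensity_absolutelyContinuous _ _)

lemma chartVolume_apply (x₀ : M) {s : Set M} (hs : MeasurableSet s) :
    chartVolume n x₀ s = ∫⁻ y in (extChartAt (𝓡 n) x₀).target ∩ (extChartAt (𝓡 n) x₀).symm ⁻¹' s,
      volumeDensity x₀ y := by
  have h : chartVolume n x₀ s = Measure.map (extChartAt (𝓡 n) x₀).symm
    ((volume.restrict (extChartAt (𝓡 n) x₀).target).withDensity (volumeDensity x₀)) s := rfl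
  rw [h, Measure.map_apply_of_aemeasurable (aemeasurable_extChartAt_symm x₀) hs,
    withDensity_apply', Measure.restrict_restrict'
      (isOpen_extChartAt_target (I := 𝓡 n) x₀).measurableSet, inter_comm]

lemma chartVolume_inter_source (x₀ : M) {s : Set M} (hs : MeasurableSet s) :
    chartVolume n x₀ (s ∩ (extChartAt (𝓡 n) x₀).source) = chartVolume n x₀ s := by
  rw [chartVolume_apply _ hs,
    chartVolume_apply _ (hs.inter (isOpen_extChartAt_source x₀).measurableSet)]
  congr 2
  ext y
  simp only [mem_inter_iff, mem_preimage]
  exact ⟨fun h ↦ ⟨h.1, h.2.1⟩, fun h ↦ ⟨h.1, h.2, (extChartAt (𝓡 n) x₀).map_target h.1⟩⟩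

variable [IsManifold (𝓡 n) ∞ M]

/-- The chart volumes agree on the overlap of two charts. -/
lemma chartVolume_eq_of_subset (x₀ x₁ : M) {s : Set M} (hs : MeasurableSet s)
    (h₀ : s ⊆ (extChartAt (𝓡 n) x₀).source) (h₁ : s ⊆ (extChartAt (𝓡 n) x₁).source) :
    chartVolume n x₀ s = chartVolume n x₁ s := by
  rw [chartVolume_apply _ hs, chartVolume_apply _ hs]
  set A := (extChartAt (𝓡 n) x₀).target ∩ (extChartAt (𝓡 n) x₀).symm ⁻¹' s with hA
  have hAmeas : MeasurableSet A := measurableSet_target_inter_preimage x₀ hs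
  have hAo : A ⊆ chartOverlap x₀ x₁ := fun y hy ↦ ⟨hy.1, h₁ hy.2⟩
  have himage : (extChartAt (𝓡 n) x₁).target ∩ (extChartAt (𝓡 n) x₁).symm ⁻¹' s
      = chartTransition x₀ x₁ '' A := by
    ext z
    constructor
    · rintro ⟨hz, hzs⟩
      refine ⟨extChartAt (𝓡 n) x₀ ((extChartAt (𝓡 n) x₁).symm z),
        ⟨(extChartAt (𝓡 n) x₀).map_source (h₀ hzs), ?_⟩, ?_⟩
      · rwa [mem_preimage, (extChartAt (𝓡 n) x₀).left_inv (h₀ hzs)]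
      · rw [chartTransition, (extChartAt (𝓡 n) x₀).left_inv (h₀ hzs),
          (extChartAt (𝓡 n) x₁).right_inv hz]
    · rintro ⟨y, hy, rfl⟩
      refine ⟨(extChartAt (𝓡 n) x₁).map_source (h₁ hy.2), ?_⟩
      rw [mem_preimage, chartTransition, (extChartAt (𝓡 n) x₁).left_inv (h₁ hy.2)]
      exact hy.2
  have hinj : InjOn (chartTransition x₀ x₁) A := by
    intro y hy z hz hyz
    have h := (extChartAt (𝓡 n) x₁).injOn (h₁ hy.2) (h₁ hz.2) hyz
    exact (extChartAt (𝓡 n) x₀).symm.injOn hy.1 hz.1 h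
  rw [himage, lintegral_image_eq_lintegral_abs_det_fderiv_mul volume hAmeas
    (f' := fderiv ℝ (chartTransition x₀ x₁)) ?_ hinj]
  · exact setLIntegral_congr_fun hAmeas fun y hy ↦ volumeDensity_eq_transition (hAo hy)
  · exact fun y hy ↦ ((contDiffAt_chartTransition (hAo hy)).differentiableAt
      (by simp)).hasFDerivAt.hasFDerivWithinAt

/-- On the domain `S` of a chart, the Riemannian volume is the volume of that chart: the chart volume
plus the part of the Riemannian volume outside of `S` is an upper bound of all the chart volumes,
hence of their supremum. -/
theorem riemannianVolume_restrict_source (x₀ : M) :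
    (riemannianVolume n M).restrict (extChartAt (𝓡 n) x₀).source = chartVolume n x₀ := by
  set S := (extChartAt (𝓡 n) x₀).source with hS
  have hSm : MeasurableSet S := (isOpen_extChartAt_source x₀).measurableSet
  have key (x₁ : M) : (chartVolume n x₁).restrict S ≤ chartVolume n x₀ := by
    refine Measure.le_iff.2 fun s hs ↦ ?_
    rw [Measure.restrict_apply hs, ← chartVolume_inter_source x₁ (hs.inter hSm),
      chartVolume_eq_of_subset x₁ x₀
        ((hs.inter hSm).inter (isOpen_extChartAt_source x₁).measurableSet)
        inter_subset_right (inter_subset_left.trans inter_subset_right)]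
    exact measure_mono (inter_subset_left.trans inter_subset_left)
  apply le_antisymm
  · have h : riemannianVolume n M
        ≤ chartVolume n x₀ + (riemannianVolume n M).restrict Sᶜ := by
      refine iSup_le fun x₁ ↦ ?_
      rw [← Measure.restrict_add_restrict_compl (μ := chartVolume n x₁) hSm]
      exact add_le_add (key x₁)
        (Measure.restrict_mono le_rfl (le_iSup (fun x : M ↦ chartVolume n x) x₁))
    calc (riemannianVolume n M).restrict S
        ≤ (chartVolume n x₀ + (riemannianVolume n M).restrict Sᶜ).restrict S :=
          Measure.restrict_mono le_rfl h
      _ = (chartVolume n x₀).restrict S := by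
          rw [Measure.restrict_add, Measure.restrict_restrict hSm]
          simp
      _ ≤ chartVolume n x₀ := Measure.restrict_le_self
  · have h : (chartVolume n x₀).restrict S = chartVolume n x₀ := by
      ext s hs
      rw [Measure.restrict_apply hs, chartVolume_inter_source x₀ hs]
    rw [← h]
    exact Measure.restrict_mono le_rfl (le_iSup (fun x : M ↦ chartVolume n x) x₀)

variable [IsContMDiffRiemannianBundle (𝓡 n) ∞ (EuclideanSpace ℝ (Fin n))
      (fun x : M ↦ TangentSpace (𝓡 n) x)]

lemma lintegral_chartVolume (x₀ : M) {f : M → ℝ≥0∞} (hf : Measurable f) :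
    ∫⁻ x, f x ∂chartVolume n x₀ = ∫⁻ y in (extChartAt (𝓡 n) x₀).target,
      volumeDensity x₀ y * f ((extChartAt (𝓡 n) x₀).symm y) := by
  have h : chartVolume n x₀ = Measure.map (extChartAt (𝓡 n) x₀).symm
    ((volume.restrict (extChartAt (𝓡 n) x₀).target).withDensity (volumeDensity x₀)) := rfl
  rw [h, lintegral_map' hf.aemeasurable (aemeasurable_extChartAt_symm x₀),
    lintegral_withDensity_eq_lintegral_mul₀ (aemeasurable_volumeDensity x₀)]
  · rfl
  · exact hf.comp_aemeasurable ((continuousOn_extChartAt_symm x₀).aemeasurable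
      (isOpen_extChartAt_target x₀).measurableSet)

lemma setLIntegral_riemannianVolume (x₀ : M) {f : M → ℝ≥0∞} (hf : Measurable f) :
    ∫⁻ x in (extChartAt (𝓡 n) x₀).source, f x ∂riemannianVolume n M
      = ∫⁻ y in (extChartAt (𝓡 n) x₀).target,
        volumeDensity x₀ y * f ((extChartAt (𝓡 n) x₀).symm y) := by
  rw [riemannianVolume_restrict_source, lintegral_chartVolume x₀ hf]

instance : IsLocallyFiniteMeasure (riemannianVolume n M) := by
  refine ⟨fun x ↦ ?_⟩
  have hc := (continuousOn_volumeDensity x).continuousAt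
    ((isOpen_extChartAt_target (I := 𝓡 n) x).mem_nhds (mem_extChartAt_target x))
  have hlt : volumeDensity x (extChartAt (𝓡 n) x x) < ⊤ := ENNReal.ofReal_lt_top
  obtain ⟨C, hC, hCt⟩ := exists_between hlt
  have hev : {y | volumeDensity x y < C} ∈ 𝓝 (extChartAt (𝓡 n) x x) := hc.eventually_lt_const hC
  obtain ⟨ε, hε, hball⟩ := Metric.mem_nhds_iff.1 hev
  set U := (extChartAt (𝓡 n) x).source ∩
    (extChartAt (𝓡 n) x) ⁻¹' Metric.ball (extChartAt (𝓡 n) x x) ε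
  have hUo : IsOpen U :=
    (continuousOn_extChartAt x).isOpen_inter_preimage (isOpen_extChartAt_source x)
      Metric.isOpen_ball
  refine ⟨U, hUo.mem_nhds ⟨mem_extChartAt_source x, Metric.mem_ball_self hε⟩, ?_⟩
  have h1 : riemannianVolume n M U = chartVolume n x U := by
    rw [← riemannianVolume_restrict_source, Measure.restrict_apply hUo.measurableSet,
      inter_eq_left.2 inter_subset_left]
  rw [h1, chartVolume_apply _ hUo.measurableSet]
  have hsub : (extChartAt (𝓡 n) x).target ∩ (extChartAt (𝓡 n) x).symm ⁻¹' U
      ⊆ Metric.ball (extChartAt (𝓡 n) x x) ε := by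
    rintro y ⟨hy, -, hy2⟩
    rwa [mem_preimage, (extChartAt (𝓡 n) x).right_inv hy] at hy2
  calc _ ≤ ∫⁻ y in Metric.ball (extChartAt (𝓡 n) x x) ε, volumeDensity x y :=
        lintegral_mono_set hsub
    _ ≤ ∫⁻ _ in Metric.ball (extChartAt (𝓡 n) x x) ε, C :=
        setLIntegral_mono' measurableSet_ball fun y hy ↦ (hball hy).le
    _ < ⊤ := by
        rw [setLIntegral_const]
        exact ENNReal.mul_lt_top hCt measure_ball_lt_top

instance : (riemannianVolume n M).IsOpenPosMeasure := by
  refine ⟨fun U hU hne h0 ↦ ?_⟩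
  obtain ⟨x, hx⟩ := hne
  have h1 : chartVolume n x U = 0 :=
    le_antisymm ((le_iSup (fun x : M ↦ chartVolume n x) x U).trans h0.le) bot_le
  have hopen : IsOpen ((extChartAt (𝓡 n) x).target ∩ (extChartAt (𝓡 n) x).symm ⁻¹' U) :=
    (continuousOn_extChartAt_symm x).isOpen_inter_preimage (isOpen_extChartAt_target x) hU
  rw [chartVolume_apply _ hU.measurableSet, lintegral_eq_zero_iff'
    ((aemeasurable_volumeDensity x).mono_measure (Measure.restrict_mono inter_subset_left le_rfl)),
    EventuallyEq, ae_restrict_iff' hopen.measurableSet] at h1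
  have h2 : volume ((extChartAt (𝓡 n) x).target ∩ (extChartAt (𝓡 n) x).symm ⁻¹' U) = 0 := by
    refine measure_mono_null (fun y hy ↦ ?_) (ae_iff.1 h1)
    simp only [mem_ofPred_eq, Classical.not_imp]
    exact ⟨hy, (volumeDensity_pos hy.1).ne'⟩
  refine (hopen.measure_pos volume ⟨extChartAt (𝓡 n) x x, mem_extChartAt_target x, ?_⟩).ne' h2
  simpa using hx

end Volume

/-! ### The gradient -/

section ChartDerivative

variable {n : ℕ} {M : Type*} [TopologicalSpace M] [ChartedSpace (EuclideanSpace ℝ (Fin n)) M]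

lemma mdifferentiableAt_sum {ι : Type*} (s : Finset ι) {f : ι → M → ℝ} {x : M}
    (hf : ∀ i ∈ s, MDifferentiableAt (𝓡 n) 𝓘(ℝ, ℝ) (f i) x) :
    MDifferentiableAt (𝓡 n) 𝓘(ℝ, ℝ) (fun z ↦ ∑ i ∈ s, f i z) x := by
  classical
  induction s using Finset.induction_on with
  | empty => simpa using mdifferentiableAt_const
  | insert a s ha ih =>
    simp only [Finset.sum_insert ha]
    exact (hf a (by simp)).add (ih fun i hi ↦ hf i (by simp [hi]))

variable [IsManifold (𝓡 n) ∞ M]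

lemma mvfderiv_chartSymmDeriv {x₀ : M} {y : EuclideanSpace ℝ (Fin n)}
    (hy : y ∈ (extChartAt (𝓡 n) x₀).target) {φ : M → ℝ}
    (hφ : MDifferentiableAt (𝓡 n) 𝓘(ℝ, ℝ) φ ((extChartAt (𝓡 n) x₀).symm y))
    (v : EuclideanSpace ℝ (Fin n)) :
    mvfderiv (𝓡 n) φ ((extChartAt (𝓡 n) x₀).symm y) (chartSymmDeriv x₀ y v)
      = fderiv ℝ (fun z ↦ φ ((extChartAt (𝓡 n) x₀).symm z)) y v := by
  have h := mfderiv_comp y hφ (mdifferentiableAt_extChartAt_symm' hy)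
  rw [mfderiv_eq_fderiv] at h
  exact (congrArg (fun L ↦ L v) h).symm

lemma contDiffAt_comp_extChartAt_symm {x₀ : M} {y : EuclideanSpace ℝ (Fin n)}
    (hy : y ∈ (extChartAt (𝓡 n) x₀).target) {φ : M → ℝ} (hφ : ContMDiff (𝓡 n) 𝓘(ℝ, ℝ) ∞ φ) :
    ContDiffAt ℝ ∞ (fun z ↦ φ ((extChartAt (𝓡 n) x₀).symm z)) y := by
  have h := hφ.comp_contMDiffOn (contMDiffOn_extChartAt_symm (I := 𝓡 n) (n := ∞) x₀)
  exact h.contDiffOn.contDiffAt ((isOpen_extChartAt_target x₀).mem_nhds hy)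

end ChartDerivative

section Gradient

variable {n : ℕ} {M : Type*} [TopologicalSpace M] [ChartedSpace (EuclideanSpace ℝ (Fin n)) M]
  [RiemannianBundle (fun x : M ↦ TangentSpace (𝓡 n) x)]

lemma metricAt_self (x : M) (v : TangentSpace (𝓡 n) x) : metricAt x v v = ‖v‖ ^ 2 :=
  real_inner_self_eq_norm_sq v

lemma inner_gradient (φ : M → ℝ) (x : M) (v : TangentSpace (𝓡 n) x) :
    inner ℝ (gradient n φ x) v = mvfderiv (𝓡 n) φ x v := by
  have : FiniteDimensional ℝ (TangentSpace (𝓡 n) x) :=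
    inferInstanceAs (FiniteDimensional ℝ (EuclideanSpace ℝ (Fin n)))
  have : CompleteSpace (TangentSpace (𝓡 n) x) := FiniteDimensional.complete ℝ _
  exact InnerProductSpace.toDual_symm_apply

lemma gradient_eq_of_forall {φ : M → ℝ} {x : M} {p : TangentSpace (𝓡 n) x}
    (h : ∀ v : TangentSpace (𝓡 n) x, inner ℝ p v = mvfderiv (𝓡 n) φ x v) :
    gradient n φ x = p :=
  ext_inner_right ℝ fun v ↦ by rw [inner_gradient, h]

lemma norm_gradient_le {φ : M → ℝ} {x : M} {c : ℝ} (hc : 0 ≤ c)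
    (h : ∀ v : TangentSpace (𝓡 n) x, mvfderiv (𝓡 n) φ x v ≤ c * ‖v‖) :
    ‖gradient n φ x‖ ≤ c := by
  by_cases h0 : gradient n φ x = 0
  · rwa [h0, norm_zero]
  · have h1 := h (gradient n φ x)
    rw [← inner_gradient, real_inner_self_eq_norm_sq, sq] at h1
    exact le_of_mul_le_mul_right h1 (norm_pos_iff.2 h0)

lemma abs_mvfderiv_le (φ : M → ℝ) (x : M) (v : TangentSpace (𝓡 n) x) :
    |mvfderiv (𝓡 n) φ x v| ≤ ‖gradient n φ x‖ * ‖v‖ := by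
  rw [← inner_gradient]
  exact abs_real_inner_le_norm _ _

lemma gradient_const (c : ℝ) (x : M) : gradient n (fun _ : M ↦ c) x = 0 :=
  gradient_eq_of_forall fun v ↦ by simp [mvfderiv_const]

lemma gradient_add {f g : M → ℝ} {x : M} (hf : MDifferentiableAt (𝓡 n) 𝓘(ℝ, ℝ) f x)
    (hg : MDifferentiableAt (𝓡 n) 𝓘(ℝ, ℝ) g x) :
    gradient n (fun z ↦ f z + g z) x = gradient n f x + gradient n g x :=
  gradient_eq_of_forall fun v ↦ by
    rw [inner_add_left, inner_gradient, inner_gradient]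
    exact (congrArg (fun L ↦ L v) (mvfderiv_add hf hg)).symm

lemma gradient_mul {f g : M → ℝ} {x : M} (hf : MDifferentiableAt (𝓡 n) 𝓘(ℝ, ℝ) f x)
    (hg : MDifferentiableAt (𝓡 n) 𝓘(ℝ, ℝ) g x) :
    gradient n (fun z ↦ f z * g z) x = f x • gradient n g x + g x • gradient n f x :=
  gradient_eq_of_forall fun v ↦ by
    rw [inner_add_left, real_inner_smul_left, real_inner_smul_left, inner_gradient, inner_gradient]
    exact (congrArg (fun L ↦ L v) (mvfderiv_mul hf hg)).symm

lemma gradient_congr {f g : M → ℝ} {x : M} (h : f =ᶠ[𝓝 x] g) :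
    gradient n f x = gradient n g x :=
  gradient_eq_of_forall fun v ↦ by
    rw [inner_gradient]
    exact congrArg (fun L : TangentSpace (𝓡 n) x →L[ℝ] ℝ ↦ L v) (h.mfderiv_eq (I' := 𝓘(ℝ, ℝ))).symm

lemma gradient_comp {η : ℝ → ℝ} {f : M → ℝ} {x : M} (hη : DifferentiableAt ℝ η (f x))
    (hf : MDifferentiableAt (𝓡 n) 𝓘(ℝ, ℝ) f x) :
    gradient n (fun z ↦ η (f z)) x = deriv η (f x) • gradient n f x :=
  gradient_eq_of_forall fun v ↦ by
    rw [real_inner_smul_left, inner_gradient]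
    have h := mfderiv_comp_apply x hη.mdifferentiableAt hf v
    rw [mfderiv_eq_fderiv] at h
    refine Eq.trans ?_ h.symm
    refine Eq.trans ?_ (fderiv_eq_smul_deriv (mvfderiv (𝓡 n) f x v)).symm
    rw [smul_eq_mul, mul_comm]

lemma gradient_sum {ι : Type*} (s : Finset ι) {f : ι → M → ℝ} {x : M}
    (hf : ∀ i ∈ s, MDifferentiableAt (𝓡 n) 𝓘(ℝ, ℝ) (f i) x) :
    gradient n (fun z ↦ ∑ i ∈ s, f i z) x = ∑ i ∈ s, gradient n (f i) x := by
  classical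
  induction s using Finset.induction_on with
  | empty => simpa using gradient_const 0 x
  | insert a s ha ih =>
    simp only [Finset.sum_insert ha]
    rw [gradient_add (hf a (by simp)) (mdifferentiableAt_sum s fun i hi ↦ hf i (by simp [hi])),
      ih fun i hi ↦ hf i (by simp [hi])]

variable [IsManifold (𝓡 n) ∞ M]

/-- The squared norm of the gradient in a chart, `|∇φ|² = gⁱʲ ∂ᵢφ ∂ⱼφ`. -/
lemma norm_gradient_sq_eq {x₀ : M} {y : EuclideanSpace ℝ (Fin n)}
    (hy : y ∈ (extChartAt (𝓡 n) x₀).target) {φ : M → ℝ}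
    (hφ : MDifferentiableAt (𝓡 n) 𝓘(ℝ, ℝ) φ ((extChartAt (𝓡 n) x₀).symm y)) :
    ‖gradient n φ ((extChartAt (𝓡 n) x₀).symm y)‖ ^ 2
      = ∑ i, ∑ j, (metricMatrix x₀ y)⁻¹ i j
        * partialDeriv j (fun z ↦ φ ((extChartAt (𝓡 n) x₀).symm z)) y
        * partialDeriv i (fun z ↦ φ ((extChartAt (𝓡 n) x₀).symm z)) y := by
  set φ' := fun z ↦ φ ((extChartAt (𝓡 n) x₀).symm z)
  set G := metricMatrix x₀ y with hG
  obtain ⟨a, ha⟩ := (chartSymmDeriv_bijective hy).surjective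
    (gradient n φ ((extChartAt (𝓡 n) x₀).symm y))
  have h1 (v : EuclideanSpace ℝ (Fin n)) :
      metricAt ((extChartAt (𝓡 n) x₀).symm y) (chartSymmDeriv x₀ y a) (chartSymmDeriv x₀ y v)
        = fderiv ℝ φ' y v := by
    rw [ha, ← mvfderiv_chartSymmDeriv hy hφ]
    exact inner_gradient _ _ _
  have h2 : G.mulVec (fun i ↦ a i) = fun j ↦ partialDeriv j φ' y := by
    ext j
    have h3 := h1 (EuclideanSpace.single j 1)
    rw [metricAt_chartSymmDeriv] at h3
    rw [partialDeriv, ← h3, ← metricMatrix_symm]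
    simp [Matrix.mulVec, dotProduct, mul_comm, ← hG]
  have h4 : (fun i ↦ a i) = G⁻¹.mulVec (fun j ↦ partialDeriv j φ' y) := by
    rw [← h2, Matrix.mulVec_mulVec, Matrix.nonsing_inv_mul _
      (isUnit_iff_ne_zero.2 (metricMatrix_det_pos hy).ne'), Matrix.one_mulVec]
  have h5 : ‖gradient n φ ((extChartAt (𝓡 n) x₀).symm y)‖ ^ 2 = fderiv ℝ φ' y a := by
    rw [← h1 a, ha]
    exact (metricAt_self _ _).symm
  rw [h5, ← (EuclideanSpace.basisFun (Fin n) ℝ).sum_repr a, map_sum]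
  refine Finset.sum_congr rfl fun i _ ↦ ?_
  rw [map_smul, ← Finset.sum_mul]
  have h6 : a i = ∑ j, G⁻¹ i j * partialDeriv j φ' y := congrFun h4 i
  rw [← h6]
  simp [partialDeriv]

variable [IsContMDiffRiemannianBundle (𝓡 n) ∞ (EuclideanSpace ℝ (Fin n))
      (fun x : M ↦ TangentSpace (𝓡 n) x)]

lemma continuous_norm_gradient_sq {φ : M → ℝ} (hφ : ContMDiff (𝓡 n) 𝓘(ℝ, ℝ) ∞ φ) :
    Continuous fun x ↦ ‖gradient n φ x‖ ^ 2 := by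
  rw [continuous_iff_continuousAt]
  intro x₀
  have hmem := mem_extChartAt_target (I := 𝓡 n) x₀
  have hpd (i : Fin n) := (contDiffAt_partialDeriv
    (contDiffAt_comp_extChartAt_symm hmem hφ) i).continuousAt
  have hinv (i j : Fin n) := (contDiffAt_inv_apply (contDiffAt_metricMatrix hmem)
    (metricMatrix_det_pos hmem).ne' i j).continuousAt
  have h1 : ContinuousAt (fun y ↦ ∑ i, ∑ j, (metricMatrix x₀ y)⁻¹ i j
      * partialDeriv j (fun z ↦ φ ((extChartAt (𝓡 n) x₀).symm z)) y
      * partialDeriv i (fun z ↦ φ ((extChartAt (𝓡 n) x₀).symm z)) y) (extChartAt (𝓡 n) x₀ x₀) :=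
    tendsto_finsetSum _ fun i _ ↦ tendsto_finsetSum _ fun j _ ↦
      ((hinv i j).mul (hpd j)).mul (hpd i)
  refine (h1.comp (continuousAt_extChartAt x₀)).congr ?_
  filter_upwards [extChartAt_source_mem_nhds (I := 𝓡 n) x₀] with x hx
  have h := norm_gradient_sq_eq ((extChartAt (𝓡 n) x₀).map_source hx)
    (hφ.mdifferentiable (by simp) _)
  rw [(extChartAt (𝓡 n) x₀).left_inv hx] at h
  exact h.symm

lemma continuous_norm_gradient {φ : M → ℝ} (hφ : ContMDiff (𝓡 n) 𝓘(ℝ, ℝ) ∞ φ) :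
    Continuous fun x ↦ ‖gradient n φ x‖ := by
  have h := (continuous_norm_gradient_sq hφ).sqrt
  simpa [Real.sqrt_sq (norm_nonneg _)] using h

/-- On a compact part of a chart, the Riemannian norm is bounded by the Euclidean norm. -/
lemma exists_metricAt_le {x₀ : M} {K : Set (EuclideanSpace ℝ (Fin n))} (hK : IsCompact K)
    (hKt : K ⊆ (extChartAt (𝓡 n) x₀).target) :
    ∃ C : ℝ, 0 ≤ C ∧ ∀ y ∈ K, ∀ v : EuclideanSpace ℝ (Fin n),
      metricAt ((extChartAt (𝓡 n) x₀).symm y) (chartSymmDeriv x₀ y v) (chartSymmDeriv x₀ y v)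
        ≤ C * ‖v‖ ^ 2 := by
  have hcont : ContinuousOn (fun y ↦ ∑ i, ∑ j, |metricMatrix x₀ y i j|) K := by
    intro y hy
    refine (tendsto_finsetSum _ fun i _ ↦ tendsto_finsetSum _ fun j _ ↦ ?_)
    exact ((contDiffAt_metricMatrix (hKt hy) i j).continuousAt.abs).continuousWithinAt
  obtain ⟨C, hC⟩ := hK.bddAbove_image hcont
  refine ⟨max C 0, le_max_right _ _, fun y hy v ↦ ?_⟩
  rw [metricAt_chartSymmDeriv]
  calc ∑ i, ∑ j, v i * v j * metricMatrix x₀ y i j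
      ≤ ∑ i, ∑ j, ‖v‖ ^ 2 * |metricMatrix x₀ y i j| := by
        refine Finset.sum_le_sum fun i _ ↦ Finset.sum_le_sum fun j _ ↦ ?_
        have hi : |v i| ≤ ‖v‖ := PiLp.norm_apply_le v i
        have hj : |v j| ≤ ‖v‖ := PiLp.norm_apply_le v j
        calc v i * v j * metricMatrix x₀ y i j ≤ |v i * v j * metricMatrix x₀ y i j| := le_abs_self _
          _ = |v i| * |v j| * |metricMatrix x₀ y i j| := by rw [abs_mul, abs_mul]
          _ ≤ ‖v‖ * ‖v‖ * |metricMatrix x₀ y i j| := by gcongr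
          _ = _ := by rw [sq]
    _ = (∑ i, ∑ j, |metricMatrix x₀ y i j|) * ‖v‖ ^ 2 := by
        simp only [← Finset.mul_sum]
        rw [mul_comm]
    _ ≤ max C 0 * ‖v‖ ^ 2 := by
        gcongr
        exact (hC ⟨y, hy, rfl⟩).trans (le_max_left _ _)

/-- On a compact part of a chart, the Euclidean gradient is bounded by the Riemannian gradient. -/
lemma exists_norm_fderiv_le {x₀ : M} {K : Set (EuclideanSpace ℝ (Fin n))} (hK : IsCompact K)
    (hKt : K ⊆ (extChartAt (𝓡 n) x₀).target) :
    ∃ C : ℝ, 0 ≤ C ∧ ∀ φ : M → ℝ, MDifferentiable (𝓡 n) 𝓘(ℝ, ℝ) φ → ∀ y ∈ K,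
      ‖fderiv ℝ (fun z ↦ φ ((extChartAt (𝓡 n) x₀).symm z)) y‖
        ≤ C * ‖gradient n φ ((extChartAt (𝓡 n) x₀).symm y)‖ := by
  obtain ⟨C, hC0, hC⟩ := exists_metricAt_le hK hKt
  refine ⟨√C, Real.sqrt_nonneg _, fun φ hφ y hy ↦ ?_⟩
  refine ContinuousLinearMap.opNorm_le_bound _ (by positivity) fun v ↦ ?_
  rw [← mvfderiv_chartSymmDeriv (hKt hy) (hφ _), Real.norm_eq_abs]
  refine (abs_mvfderiv_le φ _ _).trans ?_
  have h := hC y hy v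
  replace h := (metricAt_self _ (show TangentSpace (𝓡 n) ((extChartAt (𝓡 n) x₀).symm y) from
    chartSymmDeriv x₀ y v)).symm.trans_le h
  have h1 := Real.le_sqrt_of_sq_le h
  rw [Real.sqrt_mul hC0, Real.sqrt_sq (norm_nonneg v)] at h1
  calc _ ≤ ‖gradient n φ ((extChartAt (𝓡 n) x₀).symm y)‖ * (√C * ‖v‖) := by gcongr
    _ = _ := by ring

end Gradient

/-! ### The Sobolev inequality -/

section PartitionOfUnity

variable {n : ℕ} {M : Type*} [TopologicalSpace M] [ChartedSpace (EuclideanSpace ℝ (Fin n)) M]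

/-- A function supported in the domain of the preferred chart at `x₀`, read in this chart and
extended by zero. -/
def chartExtend (x₀ : M) (u : M → ℝ) : EuclideanSpace ℝ (Fin n) → ℝ :=
  (extChartAt (𝓡 n) x₀).target.indicator fun y ↦ u ((extChartAt (𝓡 n) x₀).symm y)

lemma chartExtend_eventuallyEq {x₀ : M} (u : M → ℝ) {y : EuclideanSpace ℝ (Fin n)}
    (hy : y ∈ (extChartAt (𝓡 n) x₀).target) :
    chartExtend x₀ u =ᶠ[𝓝 y] fun y ↦ u ((extChartAt (𝓡 n) x₀).symm y) := by
  filter_upwards [(isOpen_extChartAt_target x₀).mem_nhds hy] with z hz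
  exact indicator_of_mem hz _

lemma chartExtend_eq_zero {x₀ : M} {K : Set M} {u : M → ℝ} (hu : ∀ x ∉ K, u x = 0)
    {y : EuclideanSpace ℝ (Fin n)} (hy : y ∉ extChartAt (𝓡 n) x₀ '' K) :
    chartExtend x₀ u y = 0 := by
  by_cases h : y ∈ (extChartAt (𝓡 n) x₀).target
  · rw [chartExtend, indicator_of_mem h]
    exact hu _ fun hK ↦ hy ⟨_, hK, (extChartAt (𝓡 n) x₀).right_inv h⟩
  · exact indicator_of_notMem h _

lemma isCompact_extChartAt_image {x₀ : M} {K : Set M} (hK : IsCompact K)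
    (hKs : K ⊆ (extChartAt (𝓡 n) x₀).source) : IsCompact (extChartAt (𝓡 n) x₀ '' K) :=
  hK.image_of_continuousOn ((continuousOn_extChartAt x₀).mono hKs)

lemma extChartAt_image_subset {x₀ : M} {K : Set M}
    (hKs : K ⊆ (extChartAt (𝓡 n) x₀).source) :
    extChartAt (𝓡 n) x₀ '' K ⊆ (extChartAt (𝓡 n) x₀).target := by
  rintro _ ⟨x, hx, rfl⟩
  exact (extChartAt (𝓡 n) x₀).map_source (hKs hx)

variable [IsManifold (𝓡 n) ∞ M]

variable (n M) in
/-- A compact manifold has a finite smooth partition of unity subordinate to chart domains. -/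
lemma exists_finite_partition [T2Space M] [CompactSpace M] :
    ∃ (t : Finset M) (ρ : M → M → ℝ), (∀ i, ContMDiff (𝓡 n) 𝓘(ℝ, ℝ) ∞ (ρ i)) ∧
      (∀ i x, 0 ≤ ρ i x) ∧ (∀ i x, ρ i x ≤ 1) ∧ (∀ x, ∑ i ∈ t, ρ i x = 1) ∧
      ∀ i, tsupport (ρ i) ⊆ (extChartAt (𝓡 n) i).source := by
  obtain ⟨f, hf⟩ := SmoothPartitionOfUnity.exists_isSubordinate_chartAt_source (𝓡 n) M
  have hfin := f.locallyFinite.finite_nonempty_of_compact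
  refine ⟨hfin.toFinset, fun i ↦ f i, fun i ↦ (f i).contMDiff, f.nonneg, f.le_one, fun x ↦ ?_,
    fun i ↦ ?_⟩
  · rw [← f.sum_eq_one (mem_univ x)]
    refine (finsum_eq_sum_of_support_subset _ fun i hi ↦ ?_).symm
    simp only [Finite.coe_toFinset, mem_ofPred_eq]
    exact ⟨x, hi⟩
  · rw [extChartAt_source]
    exact hf i

lemma contDiff_chartExtend {x₀ : M} {K : Set M} (hK : IsCompact K)
    (hKs : K ⊆ (extChartAt (𝓡 n) x₀).source) {u : M → ℝ} (hu : ContMDiff (𝓡 n) 𝓘(ℝ, ℝ) ∞ u)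
    (hu0 : ∀ x ∉ K, u x = 0) : ContDiff ℝ ∞ (chartExtend (n := n) x₀ u) := by
  rw [contDiff_iff_contDiffAt]
  intro y
  by_cases hy : y ∈ (extChartAt (𝓡 n) x₀).target
  · exact (contDiffAt_comp_extChartAt_symm hy hu).congr_of_eventuallyEq
      (chartExtend_eventuallyEq u hy)
  · have hKc := (isCompact_extChartAt_image hK hKs).isClosed.isOpen_compl
    refine contDiffAt_const (c := (0 : ℝ)) |>.congr_of_eventuallyEq ?_
    filter_upwards [hKc.mem_nhds fun h ↦ hy (extChartAt_image_subset hKs h)] with z hz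
    exact chartExtend_eq_zero hu0 hz

end PartitionOfUnity

section Sobolev

variable {n : ℕ} {M : Type*} [TopologicalSpace M] [ChartedSpace (EuclideanSpace ℝ (Fin n)) M]
  [RiemannianBundle (fun x : M ↦ TangentSpace (𝓡 n) x)] [IsManifold (𝓡 n) ∞ M]
  [IsContMDiffRiemannianBundle (𝓡 n) ∞ (EuclideanSpace ℝ (Fin n))
      (fun x : M ↦ TangentSpace (𝓡 n) x)]

lemma exists_volumeDensity_bounds {x₀ : M} {K : Set (EuclideanSpace ℝ (Fin n))} (hK : IsCompact K)
    (hKt : K ⊆ (extChartAt (𝓡 n) x₀).target) :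
    ∃ D : ℝ≥0∞, D ≠ ⊤ ∧ ∀ y ∈ K, volumeDensity x₀ y ≤ D ∧ 1 ≤ D * volumeDensity x₀ y := by
  have hcont : ContinuousOn (fun y ↦ √(metricMatrix x₀ y).det) K := fun y hy ↦
    (Real.continuous_sqrt.continuousAt.comp
      (contDiffAt_det (contDiffAt_metricMatrix (hKt hy))).continuousAt).continuousWithinAt
  have hpos : ∀ y ∈ K, 0 < √(metricMatrix x₀ y).det := fun y hy ↦
    Real.sqrt_pos.2 (metricMatrix_det_pos (hKt hy))
  obtain ⟨C₁, hC₁⟩ := hK.bddAbove_image hcont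
  obtain ⟨C₂, hC₂⟩ := hK.bddAbove_image (hcont.inv₀ fun y hy ↦ (hpos y hy).ne')
  refine ⟨ENNReal.ofReal (max C₁ C₂), ENNReal.ofReal_ne_top, fun y hy ↦ ⟨?_, ?_⟩⟩
  · exact ENNReal.ofReal_le_ofReal ((hC₁ ⟨y, hy, rfl⟩).trans (le_max_left _ _))
  · have h2 : (√(metricMatrix x₀ y).det)⁻¹ ≤ max C₁ C₂ := (hC₂ ⟨y, hy, rfl⟩).trans (le_max_right _ _)
    rw [volumeDensity, ← ENNReal.ofReal_mul ((inv_nonneg.2 (Real.sqrt_nonneg _)).trans h2),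
      ← ENNReal.ofReal_one]
    refine ENNReal.ofReal_le_ofReal ?_
    rw [← inv_mul_cancel₀ (hpos y hy).ne']
    gcongr

lemma exists_norm_gradient_mul_le [CompactSpace M] {ρ : M → ℝ}
    (hρ : ContMDiff (𝓡 n) 𝓘(ℝ, ℝ) ∞ ρ) (hρ1 : ∀ x, |ρ x| ≤ 1) :
    ∃ B : ℝ, 0 ≤ B ∧ ∀ φ : M → ℝ, ContMDiff (𝓡 n) 𝓘(ℝ, ℝ) ∞ φ → ∀ x,
      ‖gradient n (fun z ↦ ρ z * φ z) x‖ ≤ ‖gradient n φ x‖ + B * |φ x| := by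
  obtain ⟨B, hB⟩ := isCompact_univ.bddAbove_image (continuous_norm_gradient hρ).continuousOn
  refine ⟨max B 0, le_max_right _ _, fun φ hφ x ↦ ?_⟩
  rw [gradient_mul (hρ.mdifferentiable (by simp) x) (hφ.mdifferentiable (by simp) x)]
  refine (norm_add_le _ _).trans ?_
  rw [norm_smul, norm_smul, Real.norm_eq_abs, Real.norm_eq_abs, mul_comm |φ x|]
  have h1 := hB ⟨x, mem_univ x, rfl⟩
  refine add_le_add (mul_le_of_le_one_left (norm_nonneg _) (hρ1 x)) ?_
  gcongr
  exact h1.trans (le_max_left _ _)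

variable [MeasurableSpace M] [BorelSpace M]

lemma lintegral_riemannianVolume_le {x₀ : M} {K : Set M}
    (hKs : K ⊆ (extChartAt (𝓡 n) x₀).source) {D : ℝ≥0∞}
    (hD : ∀ y ∈ extChartAt (𝓡 n) x₀ '' K, volumeDensity x₀ y ≤ D)
    {f : M → ℝ≥0∞} (hf : Measurable f) (hf0 : ∀ x ∉ K, f x = 0) :
    ∫⁻ x, f x ∂riemannianVolume n M
      ≤ D * ∫⁻ y, (extChartAt (𝓡 n) x₀).target.indicator
        (fun y ↦ f ((extChartAt (𝓡 n) x₀).symm y)) y := by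
  have hsrc : ∫⁻ x, f x ∂riemannianVolume n M
      = ∫⁻ x in (extChartAt (𝓡 n) x₀).source, f x ∂riemannianVolume n M := by
    rw [← lintegral_indicator (isOpen_extChartAt_source x₀).measurableSet]
    refine lintegral_congr fun x ↦ ?_
    by_cases hx : x ∈ (extChartAt (𝓡 n) x₀).source
    · rw [indicator_of_mem hx]
    · rw [indicator_of_notMem hx, hf0 x fun h ↦ hx (hKs h)]
  have hms : AEMeasurable (fun y ↦ f ((extChartAt (𝓡 n) x₀).symm y))
      (volume.restrict (extChartAt (𝓡 n) x₀).target) :=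
    hf.comp_aemeasurable ((continuousOn_extChartAt_symm x₀).aemeasurable
      (isOpen_extChartAt_target x₀).measurableSet)
  rw [hsrc, setLIntegral_riemannianVolume x₀ hf, lintegral_indicator
    (isOpen_extChartAt_target x₀).measurableSet, ← lintegral_const_mul'' _ hms]
  refine setLIntegral_mono' (isOpen_extChartAt_target x₀).measurableSet fun y hy ↦ ?_
  by_cases hyK : (extChartAt (𝓡 n) x₀).symm y ∈ K
  · gcongr
    exact hD y ⟨_, hyK, (extChartAt (𝓡 n) x₀).right_inv hy⟩
  · rw [hf0 _ hyK]
    simp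

lemma setLIntegral_chart_le {x₀ : M} {K : Set (EuclideanSpace ℝ (Fin n))} (hK : IsCompact K)
    (hKt : K ⊆ (extChartAt (𝓡 n) x₀).target) {D : ℝ≥0∞} (hDt : D ≠ ⊤)
    (hD : ∀ y ∈ K, 1 ≤ D * volumeDensity x₀ y) {f : M → ℝ≥0∞} (hf : Measurable f) :
    ∫⁻ y in K, f ((extChartAt (𝓡 n) x₀).symm y) ≤ D * ∫⁻ x, f x ∂riemannianVolume n M := by
  calc ∫⁻ y in K, f ((extChartAt (𝓡 n) x₀).symm y)
      ≤ ∫⁻ y in K, D * (volumeDensity x₀ y * f ((extChartAt (𝓡 n) x₀).symm y)) := by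
        refine setLIntegral_mono' hK.measurableSet fun y hy ↦ ?_
        rw [← mul_assoc]
        exact le_mul_of_one_le_left' (hD y hy)
    _ = D * ∫⁻ y in K, volumeDensity x₀ y * f ((extChartAt (𝓡 n) x₀).symm y) :=
        lintegral_const_mul' _ _ hDt
    _ ≤ D * ∫⁻ y in (extChartAt (𝓡 n) x₀).target,
          volumeDensity x₀ y * f ((extChartAt (𝓡 n) x₀).symm y) := by
        gcongr
    _ = D * ∫⁻ x in (extChartAt (𝓡 n) x₀).source, f x ∂riemannianVolume n M := by
        rw [setLIntegral_riemannianVolume x₀ hf]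
    _ ≤ D * ∫⁻ x, f x ∂riemannianVolume n M := by
        gcongr
        exact Measure.restrict_le_self

/-- The Sobolev inequality for functions supported in a compact part of a chart: it is the
Gagliardo–Nirenberg–Sobolev inequality of `ℝⁿ`, transported by the chart. -/
lemma exists_sobolev_chart (hn : 3 ≤ n) {q : NNReal}
    (hq : (q : ℝ) = 2 * (n : ℝ) / ((n : ℝ) - 2)) {x₀ : M} {K : Set M} (hK : IsCompact K)
    (hKs : K ⊆ (extChartAt (𝓡 n) x₀).source) :
    ∃ C : ℝ≥0∞, C ≠ ⊤ ∧ ∀ u : M → ℝ, ContMDiff (𝓡 n) 𝓘(ℝ, ℝ) ∞ u → (∀ x ∉ K, u x = 0) →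
      eLpNorm u q (riemannianVolume n M)
        ≤ C * eLpNorm (fun x ↦ ‖gradient n u x‖) 2 (riemannianVolume n M) := by
  have hn3 : (3 : ℝ) ≤ n := by exact_mod_cast hn
  have hq0 : 0 < (q : ℝ) := by
    rw [hq]
    have : 0 < (n : ℝ) - 2 := by linarith
    positivity
  set L := extChartAt (𝓡 n) x₀ '' K with hL
  have hLc : IsCompact L := isCompact_extChartAt_image hK hKs
  have hLt : L ⊆ (extChartAt (𝓡 n) x₀).target := extChartAt_image_subset hKs
  obtain ⟨D, hDt, hD⟩ := exists_volumeDensity_bounds hLc hLt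
  obtain ⟨C, hC0, hC⟩ := exists_norm_fderiv_le hLc hLt
  set S : NNReal := SNormLESNormFDerivOfEqConst ℝ
    (volume : Measure (EuclideanSpace ℝ (Fin n))) 2 with hS
  have hp' : ((q : NNReal) : ℝ)⁻¹ = (2 : NNReal)⁻¹
      - (Module.finrank ℝ (EuclideanSpace ℝ (Fin n)) : ℝ)⁻¹ := by
    have h1 : (n : ℝ) - 2 ≠ 0 := by linarith
    have h2 : (n : ℝ) ≠ 0 := by linarith
    rw [hq, finrank_euclideanSpace_fin]
    push_cast
    field_simp
  refine ⟨D ^ (1 / (q : ℝ)) * (S * (ENNReal.ofReal C * D ^ (1 / (2 : ℝ)))), ?_, fun u hu hu0 ↦ ?_⟩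
  · refine ENNReal.mul_ne_top (ENNReal.rpow_ne_top_of_nonneg (by positivity) hDt)
      (ENNReal.mul_ne_top ENNReal.coe_ne_top (ENNReal.mul_ne_top ENNReal.ofReal_ne_top
        (ENNReal.rpow_ne_top_of_nonneg (by positivity) hDt)))
  set v := chartExtend (n := n) x₀ u with hv
  have hvs : ContDiff ℝ ∞ v := contDiff_chartExtend hK hKs hu hu0
  have hv0 : ∀ y ∉ L, v y = 0 := fun y hy ↦ chartExtend_eq_zero hu0 hy
  have hGNS : eLpNorm v q volume ≤ S * eLpNorm (fderiv ℝ v) 2 volume := by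
    refine eLpNorm_le_eLpNorm_fderiv_of_eq volume (hvs.of_le (by norm_cast)) ?_
      (p := 2) (by norm_num) ?_ hp'
    · exact HasCompactSupport.intro hLc hv0
    · rw [finrank_euclideanSpace_fin]
      omega
  have h1 : eLpNorm u q (riemannianVolume n M) ≤ D ^ (1 / (q : ℝ)) * eLpNorm v q volume := by
    rw [eLpNorm_nnreal_eq_lintegral (by exact_mod_cast hq0.ne'),
      eLpNorm_nnreal_eq_lintegral (by exact_mod_cast hq0.ne'),
      ← ENNReal.mul_rpow_of_nonneg _ _ (by positivity)]
    refine ENNReal.rpow_le_rpow ?_ (by positivity)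
    have hum : Measurable fun x ↦ ‖u x‖ₑ ^ (q : ℝ) :=
      (hu.continuous.measurable.enorm).pow_const _
    refine (lintegral_riemannianVolume_le hKs (fun y hy ↦ (hD y hy).1) hum
      fun x hx ↦ by simp [hu0 x hx, hq0]).trans_eq ?_
    congr 1
    refine lintegral_congr fun y ↦ ?_
    by_cases hy : y ∈ (extChartAt (𝓡 n) x₀).target
    · rw [hv, chartExtend, indicator_of_mem hy, indicator_of_mem hy]
    · rw [hv, chartExtend, indicator_of_notMem hy, indicator_of_notMem hy]
      simp [hq0]
  have h2 : eLpNorm (fderiv ℝ v) 2 volume ≤ ENNReal.ofReal C * D ^ (1 / (2 : ℝ))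
      * eLpNorm (fun x ↦ ‖gradient n u x‖) 2 (riemannianVolume n M) := by
    have hCr : ENNReal.ofReal C = (ENNReal.ofReal C ^ (2 : ℝ)) ^ (1 / (2 : ℝ)) := by
      rw [← ENNReal.rpow_mul]
      simp
    rw [eLpNorm_eq_lintegral_rpow_enorm_toReal (by simp) (by simp),
      eLpNorm_eq_lintegral_rpow_enorm_toReal (by simp) (by simp), ENNReal.toReal_ofNat, hCr,
      ← ENNReal.mul_rpow_of_nonneg _ _ (by positivity),
      ← ENNReal.mul_rpow_of_nonneg _ _ (by positivity)]
    refine ENNReal.rpow_le_rpow ?_ (by positivity)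
    have hgm : Measurable fun x ↦ ‖‖gradient n u x‖‖ₑ ^ (2 : ℝ) :=
      ((continuous_norm_gradient hu).measurable.enorm).pow_const _
    have hf0 : ∀ y ∉ L, fderiv ℝ v y = 0 := fun y hy ↦ by
      have : v =ᶠ[𝓝 y] fun _ ↦ 0 := by
        filter_upwards [hLc.isClosed.isOpen_compl.mem_nhds hy] with z hz using hv0 z hz
      rw [this.fderiv_eq]
      simp
    calc ∫⁻ y, ‖fderiv ℝ v y‖ₑ ^ (2 : ℝ)
        = ∫⁻ y in L, ‖fderiv ℝ v y‖ₑ ^ (2 : ℝ) := by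
          rw [← lintegral_indicator hLc.measurableSet]
          refine lintegral_congr fun y ↦ ?_
          by_cases hy : y ∈ L
          · rw [indicator_of_mem hy]
          · rw [indicator_of_notMem hy, ← ofReal_norm, hf0 y hy, norm_zero]
            simp
      _ ≤ ∫⁻ y in L, ENNReal.ofReal C ^ (2 : ℝ)
            * ‖‖gradient n u ((extChartAt (𝓡 n) x₀).symm y)‖‖ₑ ^ (2 : ℝ) := by
          refine setLIntegral_mono' hLc.measurableSet fun y hy ↦ ?_
          rw [← ENNReal.mul_rpow_of_nonneg _ _ (by positivity)]
          refine ENNReal.rpow_le_rpow ?_ (by positivity)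
          rw [(chartExtend_eventuallyEq u (hLt hy)).fderiv_eq,
            ← ofReal_norm, ← ofReal_norm, ← ENNReal.ofReal_mul hC0]
          refine ENNReal.ofReal_le_ofReal ?_
          rw [norm_norm]
          exact hC u (hu.mdifferentiable (by simp)) y hy
      _ = ENNReal.ofReal C ^ (2 : ℝ) * ∫⁻ y in L,
            ‖‖gradient n u ((extChartAt (𝓡 n) x₀).symm y)‖‖ₑ ^ (2 : ℝ) :=
          lintegral_const_mul' _ _ (ENNReal.rpow_ne_top_of_nonneg (by positivity)
            ENNReal.ofReal_ne_top)
      _ ≤ ENNReal.ofReal C ^ (2 : ℝ) * (D * ∫⁻ x, ‖‖gradient n u x‖‖ₑ ^ (2 : ℝ)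
            ∂riemannianVolume n M) := by
          gcongr
          exact setLIntegral_chart_le hLc hLt hDt (fun y hy ↦ (hD y hy).2) hgm
      _ = _ := by rw [mul_assoc]
  calc eLpNorm u q (riemannianVolume n M) ≤ D ^ (1 / (q : ℝ)) * eLpNorm v q volume := h1
    _ ≤ D ^ (1 / (q : ℝ)) * (S * (ENNReal.ofReal C * D ^ (1 / (2 : ℝ))
      * eLpNorm (fun x ↦ ‖gradient n u x‖) 2 (riemannianVolume n M))) := by
        gcongr
        refine hGNS.trans ?_
        gcongr
    _ = _ := by ring

/-- The Sobolev inequality on a closed manifold, from the one in charts by a partition of unity; the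
derivatives of the partition account for the `L²` norm of the function on the right. -/
lemma exists_sobolev [T2Space M] [CompactSpace M] (hn : 3 ≤ n) {q : NNReal}
    (hq : (q : ℝ) = 2 * (n : ℝ) / ((n : ℝ) - 2)) :
    ∃ C : ℝ≥0∞, C ≠ ⊤ ∧ ∀ φ : M → ℝ, ContMDiff (𝓡 n) 𝓘(ℝ, ℝ) ∞ φ →
      eLpNorm φ q (riemannianVolume n M)
        ≤ C * (eLpNorm (fun x ↦ ‖gradient n φ x‖) 2 (riemannianVolume n M)
          + eLpNorm φ 2 (riemannianVolume n M)) := by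
  have hn3 : (3 : ℝ) ≤ n := by exact_mod_cast hn
  have hq1 : (1 : ℝ≥0∞) ≤ q := by
    have : (1 : ℝ) ≤ q := by
      rw [hq, le_div_iff₀ (by linarith)]
      linarith
    exact_mod_cast this
  obtain ⟨t, ρ, hρs, hρ0, hρ1, hρsum, hρsupp⟩ := exists_finite_partition n M
  have hK (i : M) : IsCompact (tsupport (ρ i)) := (isClosed_tsupport _).isCompact
  choose C hCt hC using fun i ↦ exists_sobolev_chart hn hq (hK i) (hρsupp i)
  choose B hB0 hB using fun i ↦ exists_norm_gradient_mul_le (hρs i)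
    fun x ↦ (abs_of_nonneg (hρ0 i x)).trans_le (hρ1 i x)
  refine ⟨∑ i ∈ t, C i * (1 + ENNReal.ofReal (B i)), ?_, fun φ hφ ↦ ?_⟩
  · refine ENNReal.sum_ne_top.2 fun i _ ↦ ENNReal.mul_ne_top (hCt i) ?_
    exact ENNReal.add_ne_top.2 ⟨ENNReal.one_ne_top, ENNReal.ofReal_ne_top⟩
  have hsum : φ = ∑ i ∈ t, fun x ↦ ρ i x * φ x := by
    ext x
    rw [Finset.sum_apply, ← Finset.sum_mul, hρsum, one_mul]
  have hloc (i : M) : eLpNorm (fun x ↦ ρ i x * φ x) q (riemannianVolume n M)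
      ≤ C i * (1 + ENNReal.ofReal (B i))
        * (eLpNorm (fun x ↦ ‖gradient n φ x‖) 2 (riemannianVolume n M)
          + eLpNorm φ 2 (riemannianVolume n M)) := by
    have h1 := hC i _ ((hρs i).mul hφ) fun x hx ↦ by
      have : ρ i x = 0 := image_eq_zero_of_notMem_tsupport hx
      simp [this]
    have h2 : eLpNorm (fun x ↦ ‖gradient n (fun z ↦ ρ i z * φ z) x‖) 2 (riemannianVolume n M)
        ≤ eLpNorm (fun x ↦ ‖gradient n φ x‖) 2 (riemannianVolume n M)
          + ENNReal.ofReal (B i) * eLpNorm φ 2 (riemannianVolume n M) := by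
      calc _ ≤ eLpNorm ((fun x ↦ ‖gradient n φ x‖) + B i • fun x ↦ |φ x|) 2
            (riemannianVolume n M) := by
            refine eLpNorm_mono_real fun x ↦ ?_
            rw [norm_norm]
            exact hB i φ hφ x
        _ ≤ eLpNorm (fun x ↦ ‖gradient n φ x‖) 2 (riemannianVolume n M)
            + eLpNorm (B i • fun x ↦ |φ x|) 2 (riemannianVolume n M) :=
            eLpNorm_add_le (continuous_norm_gradient hφ).aestronglyMeasurable
              (hφ.continuous.abs.const_smul _).aestronglyMeasurable (by norm_num)
        _ = _ := by
            rw [eLpNorm_const_smul, Real.enorm_of_nonneg (hB0 i)]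
            congr 2
            exact eLpNorm_norm φ
    calc _ ≤ C i * (eLpNorm (fun x ↦ ‖gradient n φ x‖) 2 (riemannianVolume n M)
          + ENNReal.ofReal (B i) * eLpNorm φ 2 (riemannianVolume n M)) := by
          refine h1.trans ?_
          gcongr
          exact h2
      _ ≤ C i * ((1 + ENNReal.ofReal (B i))
          * (eLpNorm (fun x ↦ ‖gradient n φ x‖) 2 (riemannianVolume n M)
          + eLpNorm φ 2 (riemannianVolume n M))) := by
          rw [mul_add (1 + ENNReal.ofReal (B i))]
          gcongr
          · exact le_mul_of_one_le_left' le_self_add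
          · exact le_add_self
      _ = _ := by rw [mul_assoc]
  calc eLpNorm φ q (riemannianVolume n M)
      = eLpNorm (∑ i ∈ t, fun x ↦ ρ i x * φ x) q (riemannianVolume n M) := by rw [← hsum]
    _ ≤ ∑ i ∈ t, eLpNorm (fun x ↦ ρ i x * φ x) q (riemannianVolume n M) :=
        eLpNorm_sum_le (fun i _ ↦ ((hρs i).continuous.mul hφ.continuous).aestronglyMeasurable) hq1
    _ ≤ _ := by
        rw [Finset.sum_mul]
        exact Finset.sum_le_sum fun i _ ↦ hloc i

/-- On a compact space, continuous functions are in every `Lᵖ` space of a finite measure. -/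
lemma memLp_of_continuous [CompactSpace M] {μ : Measure M} [IsFiniteMeasure μ] {f : M → ℝ}
    (hf : Continuous f) (p : ℝ≥0∞) : MemLp f p μ := by
  obtain ⟨C, hC⟩ := isCompact_univ.exists_bound_of_continuousOn hf.continuousOn
  exact MemLp.of_bound hf.aestronglyMeasurable C (ae_of_all _ fun x ↦ hC x (mem_univ x))

lemma integrable_of_continuous [CompactSpace M] {μ : Measure M} [IsFiniteMeasure μ] {f : M → ℝ}
    (hf : Continuous f) : Integrable f μ :=
  memLp_one_iff_integrable.1 (memLp_of_continuous hf 1)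

lemma exists_sobolev_integral [T2Space M] [CompactSpace M] (hn : 3 ≤ n) :
    ∃ C : ℝ, 0 < C ∧ ∀ φ : M → ℝ, ContMDiff (𝓡 n) 𝓘(ℝ, ℝ) ∞ φ → (∀ x, 0 < φ x) →
      (∫ x, φ x ^ (2 * (n : ℝ) / ((n : ℝ) - 2)) ∂riemannianVolume n M) ^ (((n : ℝ) - 2) / (n : ℝ))
        ≤ C * ((∫ x, ‖gradient n φ x‖ ^ 2 ∂riemannianVolume n M)
          + ∫ x, φ x ^ 2 ∂riemannianVolume n M) := by
  have hn3 : (3 : ℝ) ≤ n := by exact_mod_cast hn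
  have hn2 : 0 < (n : ℝ) - 2 := by linarith
  set μ := riemannianVolume n M
  set q : NNReal := ⟨2 * (n : ℝ) / ((n : ℝ) - 2), by positivity⟩ with hqdef
  have hq : (q : ℝ) = 2 * (n : ℝ) / ((n : ℝ) - 2) := rfl
  have hq0 : 0 < (q : ℝ) := by rw [hq]; positivity
  obtain ⟨C, hCt, hC⟩ := exists_sobolev (M := M) hn hq
  refine ⟨2 * (C.toReal ^ 2 + 1), by positivity, fun φ hφ hpos ↦ ?_⟩
  have hg := continuous_norm_gradient hφ
  have h2 (f : M → ℝ) (hf : Continuous f) :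
      eLpNorm f 2 μ = ENNReal.ofReal (√(∫ x, f x ^ 2 ∂μ)) := by
    rw [(memLp_of_continuous hf 2).eLpNorm_eq_integral_rpow_norm (by simp) (by simp)]
    simp [Real.sqrt_eq_rpow]
  have hqn : eLpNorm φ q μ = ENNReal.ofReal ((∫ x, φ x ^ (q : ℝ) ∂μ) ^ (q : ℝ)⁻¹) := by
    rw [(memLp_of_continuous hφ.continuous q).eLpNorm_eq_integral_rpow_norm
      (by exact_mod_cast hq0.ne') (by simp)]
    simp [abs_of_pos (hpos _)]
  have h := hC φ hφ
  rw [hqn, h2 _ hg, h2 _ hφ.continuous, ← ENNReal.ofReal_toReal hCt,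
    ← ENNReal.ofReal_add (Real.sqrt_nonneg _) (Real.sqrt_nonneg _),
    ← ENNReal.ofReal_mul ENNReal.toReal_nonneg, ENNReal.ofReal_le_ofReal_iff (by positivity)] at h
  set I := ∫ x, φ x ^ (q : ℝ) ∂μ with hI
  set X := ∫ x, ‖gradient n φ x‖ ^ 2 ∂μ
  set Z := ∫ x, φ x ^ 2 ∂μ
  have hX : 0 ≤ X := integral_nonneg fun x ↦ by positivity
  have hZ : 0 ≤ Z := integral_nonneg fun x ↦ by positivity
  have hI0 : 0 ≤ I := integral_nonneg fun x ↦ Real.rpow_nonneg (hpos x).le _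
  have hpow : I ^ (((n : ℝ) - 2) / (n : ℝ)) = (I ^ (q : ℝ)⁻¹) ^ 2 := by
    rw [← Real.rpow_natCast, ← Real.rpow_mul hI0, hq]
    congr 1
    field_simp
    norm_num
  have hsq : (√X + √Z) ^ 2 ≤ 2 * (X + Z) := by
    nlinarith [Real.sq_sqrt hX, Real.sq_sqrt hZ, sq_nonneg (√X - √Z)]
  change I ^ (((n : ℝ) - 2) / (n : ℝ)) ≤ _
  rw [hpow]
  calc (I ^ (q : ℝ)⁻¹) ^ 2 ≤ (C.toReal * (√X + √Z)) ^ 2 := by gcongr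
    _ = C.toReal ^ 2 * (√X + √Z) ^ 2 := by ring
    _ ≤ C.toReal ^ 2 * (2 * (X + Z)) := by gcongr
    _ ≤ 2 * (C.toReal ^ 2 + 1) * (X + Z) := by nlinarith

end Sobolev

/-! ### The Yamabe constant -/

section Yamabe

variable {n : ℕ} {M : Type*} [TopologicalSpace M] [ChartedSpace (EuclideanSpace ℝ (Fin n)) M]
  [RiemannianBundle (fun x : M ↦ TangentSpace (𝓡 n) x)] [IsManifold (𝓡 n) ∞ M]
  [IsContMDiffRiemannianBundle (𝓡 n) ∞ (EuclideanSpace ℝ (Fin n))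
      (fun x : M ↦ TangentSpace (𝓡 n) x)] [MeasurableSpace M] [BorelSpace M]
  [T2Space M] [CompactSpace M]

/-- The Yamabe quotients are bounded below by a positive number, by the Sobolev inequality. -/
lemma exists_le_yamabeQuotient [Nonempty M] (hn : 3 ≤ n)
    (hR : ∀ x : M, 0 < scalarCurvature n x) :
    ∃ c : ℝ, 0 < c ∧ ∀ φ : M → ℝ, ContMDiff (𝓡 n) 𝓘(ℝ, ℝ) ∞ φ → (∀ x, 0 < φ x) →
      0 < (∫ x, φ x ^ (2 * (n : ℝ) / ((n : ℝ) - 2)) ∂riemannianVolume n M) ∧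
      c ≤ yamabeQuotient n φ := by
  have hn3 : (3 : ℝ) ≤ n := by exact_mod_cast hn
  have hn2 : 0 < (n : ℝ) - 2 := by linarith
  have hcR := continuous_scalarCurvature (n := n) (M := M)
  obtain ⟨C, hC0, hC⟩ := exists_sobolev_integral (M := M) hn
  obtain ⟨x₀, -, hx₀⟩ := isCompact_univ.exists_isMinOn univ_nonempty hcR.continuousOn
  set a := 4 * ((n : ℝ) - 1) / ((n : ℝ) - 2) with ha
  have ha0 : 0 < a := by
    have : 0 < (n : ℝ) - 1 := by linarith
    positivity
  set m := min a (scalarCurvature n x₀) with hm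
  have hm0 : 0 < m := lt_min ha0 (hR x₀)
  refine ⟨m / C, by positivity, fun φ hφ hpos ↦ ?_⟩
  set I := ∫ x, φ x ^ (2 * (n : ℝ) / ((n : ℝ) - 2)) ∂riemannianVolume n M with hI
  have hI0 : 0 < I := by
    have hc : Continuous fun x ↦ φ x ^ (2 * (n : ℝ) / ((n : ℝ) - 2)) :=
      hφ.continuous.rpow_const fun x ↦ Or.inl (hpos x).ne'
    exact hc.integral_pos_of_hasCompactSupport_nonneg_nonzero
      (HasCompactSupport.of_compactSpace _) (fun x ↦ Real.rpow_nonneg (hpos x).le _)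
      (x := x₀) (Real.rpow_pos_of_pos (hpos x₀) _).ne'
  refine ⟨hI0, ?_⟩
  have hRφ : m * ∫ x, φ x ^ 2 ∂riemannianVolume n M
      ≤ ∫ x, scalarCurvature n x * φ x ^ 2 ∂riemannianVolume n M := by
    rw [← integral_const_mul]
    refine integral_mono (integrable_of_continuous (by have := hφ.continuous; fun_prop))
      (integrable_of_continuous (hcR.mul (hφ.continuous.pow 2))) fun x ↦ ?_
    have : m ≤ scalarCurvature n x := (min_le_right _ _).trans (hx₀ (mem_univ x))
    dsimp only
    gcongr
  have hX : 0 ≤ ∫ x, ‖gradient n φ x‖ ^ 2 ∂riemannianVolume n M :=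
    integral_nonneg fun x ↦ by positivity
  have hma : m ≤ a := min_le_left _ _
  rw [yamabeQuotient, ← hI, ← ha, div_le_div_iff₀ hC0 (Real.rpow_pos_of_pos hI0 _)]
  calc m * I ^ (((n : ℝ) - 2) / (n : ℝ))
      ≤ m * (C * ((∫ x, ‖gradient n φ x‖ ^ 2 ∂riemannianVolume n M)
          + ∫ x, φ x ^ 2 ∂riemannianVolume n M)) := by
        gcongr
        exact hC φ hφ hpos
    _ = (m * (∫ x, ‖gradient n φ x‖ ^ 2 ∂riemannianVolume n M)
          + m * ∫ x, φ x ^ 2 ∂riemannianVolume n M) * C := by ring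
    _ ≤ _ := by gcongr

theorem yamabeConstant_pos [Nonempty M] (hn : 3 ≤ n) (hR : ∀ x : M, 0 < scalarCurvature n x) :
    0 < yamabeConstant n M := by
  obtain ⟨c, hc, h⟩ := exists_le_yamabeQuotient hn hR
  have : Nonempty {φ : M → ℝ // ContMDiff (𝓡 n) 𝓘(ℝ, ℝ) ∞ φ ∧ ∀ x, 0 < φ x} :=
    ⟨fun _ ↦ 1, contMDiff_const, fun _ ↦ one_pos⟩
  exact hc.trans_le (le_ciInf fun φ ↦ (h φ.1 φ.2.1 φ.2.2).2)

/-- The inequality expressed by the Yamabe constant, for positive smooth functions. -/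
lemma yamabeConstant_mul_le [Nonempty M] (hn : 3 ≤ n) (hR : ∀ x : M, 0 < scalarCurvature n x)
    {φ : M → ℝ} (hφ : ContMDiff (𝓡 n) 𝓘(ℝ, ℝ) ∞ φ) (hpos : ∀ x, 0 < φ x) :
    yamabeConstant n M
        * (∫ x, φ x ^ (2 * (n : ℝ) / ((n : ℝ) - 2)) ∂riemannianVolume n M)
          ^ (((n : ℝ) - 2) / (n : ℝ))
      ≤ 4 * ((n : ℝ) - 1) / ((n : ℝ) - 2) * (∫ x, ‖gradient n φ x‖ ^ 2 ∂riemannianVolume n M)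
        + ∫ x, scalarCurvature n x * φ x ^ 2 ∂riemannianVolume n M := by
  obtain ⟨c, hc, h⟩ := exists_le_yamabeQuotient hn hR
  have hbdd : BddBelow (range fun φ : {φ : M → ℝ // ContMDiff (𝓡 n) 𝓘(ℝ, ℝ) ∞ φ ∧ ∀ x, 0 < φ x} ↦
      yamabeQuotient n φ.1) := by
    refine ⟨c, ?_⟩
    rintro _ ⟨φ, rfl⟩
    exact (h φ.1 φ.2.1 φ.2.2).2
  rw [← le_div_iff₀ (Real.rpow_pos_of_pos (h φ hφ hpos).1 _)]
  exact ciInf_le hbdd ⟨φ, hφ, hpos⟩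

end Yamabe

/-! ### The distance in a chart -/

section MetricComparison

variable {n : ℕ} {M : Type*} [TopologicalSpace M] [ChartedSpace (EuclideanSpace ℝ (Fin n)) M]
  [RiemannianBundle (fun x : M ↦ TangentSpace (𝓡 n) x)]

lemma metricAt_chartSymmDeriv_nonneg (x₀ : M) (y v : EuclideanSpace ℝ (Fin n)) :
    0 ≤ metricAt ((extChartAt (𝓡 n) x₀).symm y) (chartSymmDeriv x₀ y v) (chartSymmDeriv x₀ y v) :=
  real_inner_self_nonneg

lemma enorm_le_of_metricAt_le {x : M} {u : TangentSpace (𝓡 n) x} {c : ℝ} (hc : 0 ≤ c)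
    (h : metricAt x u u ≤ c ^ 2) : ‖u‖ₑ ≤ ENNReal.ofReal c := by
  rw [← ofReal_norm]
  exact ENNReal.ofReal_le_ofReal (abs_le_of_sq_le_sq' ((metricAt_self x u).symm.trans_le h) hc).2

lemma metricAt_chartSymmDeriv_smul (x₀ : M) (y v : EuclideanSpace ℝ (Fin n)) (a : ℝ) :
    metricAt ((extChartAt (𝓡 n) x₀).symm y) (chartSymmDeriv x₀ y (a • v))
        (chartSymmDeriv x₀ y (a • v))
      = a ^ 2 * metricAt ((extChartAt (𝓡 n) x₀).symm y) (chartSymmDeriv x₀ y v)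
        (chartSymmDeriv x₀ y v) := by
  rw [metricAt_chartSymmDeriv, metricAt_chartSymmDeriv]
  simp only [Finset.mul_sum, PiLp.smul_apply, smul_eq_mul]
  exact Finset.sum_congr rfl fun i _ ↦ Finset.sum_congr rfl fun j _ ↦ by ring

variable [IsManifold (𝓡 n) ∞ M]

lemma metricAt_chartSymmDeriv_pos {x₀ : M} {y v : EuclideanSpace ℝ (Fin n)}
    (hy : y ∈ (extChartAt (𝓡 n) x₀).target) (hv : v ≠ 0) :
    0 < metricAt ((extChartAt (𝓡 n) x₀).symm y) (chartSymmDeriv x₀ y v) (chartSymmDeriv x₀ y v) := by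
  refine real_inner_self_pos.2 fun h ↦ hv ?_
  exact (chartSymmDeriv_bijective hy).injective (h.trans (map_zero (chartSymmDeriv x₀ y)).symm)

variable [IsContMDiffRiemannianBundle (𝓡 n) ∞ (EuclideanSpace ℝ (Fin n))
      (fun x : M ↦ TangentSpace (𝓡 n) x)]

/-- On a compact part of a chart, the Euclidean norm is bounded by the Riemannian norm. -/
lemma exists_norm_sq_le_metricAt {x₀ : M} {L : Set (EuclideanSpace ℝ (Fin n))} (hL : IsCompact L)
    (hLt : L ⊆ (extChartAt (𝓡 n) x₀).target) :
    ∃ C : ℝ, 0 < C ∧ ∀ y ∈ L, ∀ v : EuclideanSpace ℝ (Fin n), ‖v‖ ^ 2 ≤ C *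
      metricAt ((extChartAt (𝓡 n) x₀).symm y) (chartSymmDeriv x₀ y v) (chartSymmDeriv x₀ y v) := by
  set Q : EuclideanSpace ℝ (Fin n) × EuclideanSpace ℝ (Fin n) → ℝ := fun p ↦
    metricAt ((extChartAt (𝓡 n) x₀).symm p.1) (chartSymmDeriv x₀ p.1 p.2)
      (chartSymmDeriv x₀ p.1 p.2) with hQ
  have hpos : ∀ p ∈ L ×ˢ Metric.sphere (0 : EuclideanSpace ℝ (Fin n)) 1, 0 < Q p := by
    rintro ⟨y, v⟩ ⟨hy, hv⟩
    exact metricAt_chartSymmDeriv_pos (hLt hy) (ne_zero_of_mem_unit_sphere ⟨v, hv⟩)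
  have hcont : ContinuousOn Q (L ×ˢ Metric.sphere (0 : EuclideanSpace ℝ (Fin n)) 1) := by
    rintro ⟨y, v⟩ ⟨hy, hv⟩
    simp only [hQ, metricAt_chartSymmDeriv]
    refine tendsto_finsetSum _ fun i _ ↦ tendsto_finsetSum _ fun j _ ↦ ?_
    have h1 : ContinuousAt (fun p : EuclideanSpace ℝ (Fin n) × EuclideanSpace ℝ (Fin n) ↦
        metricMatrix x₀ p.1 i j) (y, v) :=
      ContinuousAt.comp (f := Prod.fst) (g := fun z ↦ metricMatrix x₀ z i j)
        (contDiffAt_metricMatrix (hLt hy) i j).continuousAt continuousAt_fst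
    have h2 : ContinuousAt (fun p : EuclideanSpace ℝ (Fin n) × EuclideanSpace ℝ (Fin n) ↦
        p.2 i * p.2 j) (y, v) := by fun_prop
    exact (h2.mul h1).continuousWithinAt
  obtain ⟨C, hC⟩ := (hL.prod (isCompact_sphere _ _)).bddAbove_image
    (hcont.inv₀ fun p hp ↦ (hpos p hp).ne')
  refine ⟨max C 1, by positivity, fun y hy v ↦ ?_⟩
  rcases eq_or_ne v 0 with rfl | hv
  · rw [norm_zero, zero_pow two_ne_zero]
    exact mul_nonneg (by positivity) (metricAt_chartSymmDeriv_nonneg x₀ y 0)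
  · have hv0 := norm_pos_iff.2 hv
    have hu : ‖v‖⁻¹ • v ∈ Metric.sphere (0 : EuclideanSpace ℝ (Fin n)) 1 := by
      simp [norm_smul, hv0.ne']
    have hm : (y, ‖v‖⁻¹ • v) ∈ L ×ˢ Metric.sphere (0 : EuclideanSpace ℝ (Fin n)) 1 :=
      mk_mem_prod hy hu
    have h1 : (Q (y, ‖v‖⁻¹ • v))⁻¹ ≤ max C 1 :=
      (hC (mem_image_of_mem (fun p ↦ (Q p)⁻¹) hm)).trans (le_max_left _ _)
    have h2 := (inv_le_iff_one_le_mul₀ (hpos _ hm)).1 h1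
    simp only [hQ, metricAt_chartSymmDeriv_smul] at h2
    rw [inv_pow, mul_left_comm, inv_mul_eq_div, le_div_iff₀ (by positivity), one_mul] at h2
    exact h2

/-- The metric varies slowly in a chart: at nearby points the norms of a vector are comparable. -/
lemma exists_metricAt_le_mul {x₀ : M} {L : Set (EuclideanSpace ℝ (Fin n))} (hL : IsCompact L)
    (hLt : L ⊆ (extChartAt (𝓡 n) x₀).target) {κ : ℝ} (hκ : 0 < κ) :
    ∃ δ > 0, Metric.cthickening δ L ⊆ (extChartAt (𝓡 n) x₀).target ∧
      ∀ y ∈ L, ∀ w, dist w y ≤ δ → ∀ v : EuclideanSpace ℝ (Fin n),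
        metricAt ((extChartAt (𝓡 n) x₀).symm w) (chartSymmDeriv x₀ w v) (chartSymmDeriv x₀ w v)
          ≤ (1 + κ) * metricAt ((extChartAt (𝓡 n) x₀).symm y) (chartSymmDeriv x₀ y v)
            (chartSymmDeriv x₀ y v) := by
  obtain ⟨δ₀, hδ₀, hsub⟩ := hL.exists_cthickening_subset_open (isOpen_extChartAt_target x₀) hLt
  obtain ⟨C, hC0, hC⟩ := exists_norm_sq_le_metricAt hL hLt
  have hcont : ContinuousOn (fun y (i j : Fin n) ↦ metricMatrix x₀ y i j)
      (Metric.cthickening δ₀ L) := by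
    intro y hy
    refine (tendsto_pi_nhds.2 fun i ↦ tendsto_pi_nhds.2 fun j ↦ ?_)
    exact (contDiffAt_metricMatrix (hsub hy) i j).continuousAt.continuousWithinAt
  have hunif := hL.cthickening.uniformContinuousOn_of_continuous hcont
  set η : ℝ := κ / (C * ((n : ℝ) ^ 2 + 1)) with hη
  have hη0 : 0 < η := by positivity
  obtain ⟨δ₁, hδ₁, h₁⟩ := Metric.uniformContinuousOn_iff_le.1 hunif η hη0
  refine ⟨min δ₀ δ₁, lt_min hδ₀ hδ₁,
    (Metric.cthickening_mono (min_le_left _ _) _).trans hsub, fun y hy w hw v ↦ ?_⟩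
  have hwmem : w ∈ Metric.cthickening δ₀ L :=
    Metric.mem_cthickening_of_dist_le w y δ₀ L hy (hw.trans (min_le_left _ _))
  have hd := h₁ w hwmem y (Metric.self_subset_cthickening L hy) (hw.trans (min_le_right _ _))
  have hentry (i j : Fin n) : metricMatrix x₀ w i j - metricMatrix x₀ y i j ≤ η ∧
      -η ≤ metricMatrix x₀ w i j - metricMatrix x₀ y i j := by
    have h : |metricMatrix x₀ w i j - metricMatrix x₀ y i j| ≤ η :=
      ((dist_le_pi_dist (fun j ↦ metricMatrix x₀ w i j) (fun j ↦ metricMatrix x₀ y i j) j).trans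
        (dist_le_pi_dist (fun i j ↦ metricMatrix x₀ w i j)
          (fun i j ↦ metricMatrix x₀ y i j) i)).trans hd
    exact ⟨(abs_le.1 h).2, (abs_le.1 h).1⟩
  have hdiff : ∑ i, ∑ j, v i * v j * metricMatrix x₀ w i j
      - ∑ i, ∑ j, v i * v j * metricMatrix x₀ y i j ≤ (n : ℝ) ^ 2 * η * ‖v‖ ^ 2 := by
    rw [← Finset.sum_sub_distrib]
    calc _ ≤ ∑ _i : Fin n, ∑ _j : Fin n, η * ‖v‖ ^ 2 := by
          refine Finset.sum_le_sum fun i _ ↦ ?_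
          rw [← Finset.sum_sub_distrib]
          refine Finset.sum_le_sum fun j _ ↦ ?_
          have hi : |v i| ≤ ‖v‖ := PiLp.norm_apply_le v i
          have hj : |v j| ≤ ‖v‖ := PiLp.norm_apply_le v j
          calc v i * v j * metricMatrix x₀ w i j - v i * v j * metricMatrix x₀ y i j
              = v i * v j * (metricMatrix x₀ w i j - metricMatrix x₀ y i j) := by ring
            _ ≤ |v i| * |v j| * |metricMatrix x₀ w i j - metricMatrix x₀ y i j| := by
                rw [← abs_mul, ← abs_mul]
                exact le_abs_self _
            _ ≤ ‖v‖ * ‖v‖ * η := by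
                gcongr
                exact abs_le.2 ⟨(hentry i j).2, (hentry i j).1⟩
            _ = _ := by ring
      _ = _ := by simp; ring
  have h2 := hC y hy v
  have hQ0 := metricAt_chartSymmDeriv_nonneg x₀ y v
  rw [metricAt_chartSymmDeriv x₀ w]
  rw [← metricAt_chartSymmDeriv x₀ y] at hdiff
  set Q := metricAt ((extChartAt (𝓡 n) x₀).symm y) (chartSymmDeriv x₀ y v) (chartSymmDeriv x₀ y v)
  have h3 : (n : ℝ) ^ 2 * η * ‖v‖ ^ 2 ≤ κ * Q := by
    calc (n : ℝ) ^ 2 * η * ‖v‖ ^ 2 ≤ ((n : ℝ) ^ 2 + 1) * η * (C * Q) := by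
          gcongr
          linarith
      _ = κ * Q := by rw [hη]; field_simp
  linarith

end MetricComparison

section Segment

variable {n : ℕ} {M : Type*} [EMetricSpace M] [ChartedSpace (EuclideanSpace ℝ (Fin n)) M]
  [RiemannianBundle (fun x : M ↦ TangentSpace (𝓡 n) x)] [IsManifold (𝓡 n) ∞ M]
  [IsRiemannianManifold (𝓡 n) M]

/-- The distance of two points in a chart is at most the Riemannian length of the coordinate
segment between them. -/
lemma edist_extChartAt_symm_le {x₀ : M} {w w' : EuclideanSpace ℝ (Fin n)} {c : ℝ} (hc : 0 ≤ c)
    (hmem : ∀ t ∈ Icc (0 : ℝ) 1, AffineMap.lineMap (k := ℝ) w w' t ∈ (extChartAt (𝓡 n) x₀).target)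
    (hle : ∀ t ∈ Icc (0 : ℝ) 1, metricAt ((extChartAt (𝓡 n) x₀).symm
        (AffineMap.lineMap (k := ℝ) w w' t))
      (chartSymmDeriv x₀ (AffineMap.lineMap (k := ℝ) w w' t) (w' - w))
      (chartSymmDeriv x₀ (AffineMap.lineMap (k := ℝ) w w' t) (w' - w)) ≤ c ^ 2) :
    edist ((extChartAt (𝓡 n) x₀).symm w) ((extChartAt (𝓡 n) x₀).symm w') ≤ ENNReal.ofReal c := by
  have : IsManifold (𝓡 n) 1 M := IsManifold.of_le (m := 1) (n := ∞) (by simp)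
  set η : ℝ → EuclideanSpace ℝ (Fin n) := ⇑(AffineMap.lineMap (k := ℝ) w w') with hη
  set γ : ℝ → M := fun t ↦ (extChartAt (𝓡 n) x₀).symm (η t) with hγ
  have hηd : ContDiff ℝ 1 η := by
    simp only [hη, AffineMap.coe_lineMap, vsub_eq_sub, vadd_eq_add]
    fun_prop
  have hηs : ContMDiffOn 𝓘(ℝ, ℝ) 𝓘(ℝ, EuclideanSpace ℝ (Fin n)) 1 η (Icc 0 1) :=
    hηd.contMDiff.contMDiffOn
  rw [IsRiemannianManifold.out (I := 𝓡 n)]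
  have h1 : Manifold.riemannianEDist (𝓡 n) ((extChartAt (𝓡 n) x₀).symm w)
      ((extChartAt (𝓡 n) x₀).symm w')
      ≤ Manifold.pathELength (𝓡 n) γ 0 1 := by
    apply Manifold.riemannianEDist_le_pathELength _ _ _ zero_le_one
    · exact (contMDiffOn_extChartAt_symm x₀).comp hηs hmem
    · simp [hγ, hη]
    · simp [hγ, hη]
  refine h1.trans ?_
  rw [Manifold.pathELength_eq_lintegral_mfderivWithin_Icc]
  calc _ ≤ ∫⁻ _t in Icc (0 : ℝ) 1, ENNReal.ofReal c := by
        refine setLIntegral_mono' measurableSet_Icc fun t ht ↦ ?_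
        have hu : UniqueMDiffWithinAt 𝓘(ℝ, ℝ) (Icc (0 : ℝ) 1) t := by
          rw [uniqueMDiffWithinAt_iff_uniqueDiffWithinAt]
          exact uniqueDiffOn_Icc zero_lt_one t ht
        have hη' : HasDerivAt η (w' - w) t := AffineMap.hasDerivAt_lineMap
        have h2 : HasMFDerivAt 𝓘(ℝ, ℝ) 𝓘(ℝ, EuclideanSpace ℝ (Fin n)) η t
            (ContinuousLinearMap.toSpanSingleton ℝ (w' - w)) := hη'.hasFDerivAt.hasMFDerivAt
        have h3 := (mdifferentiableAt_extChartAt_symm' (hmem t ht)).hasMFDerivAt.comp t h2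
        have h4 := (h3.hasMFDerivWithinAt (s := Icc 0 1)).mfderivWithin hu
        have h5 : mfderivWithin 𝓘(ℝ, ℝ) (𝓡 n) γ (Icc 0 1) t 1
            = chartSymmDeriv x₀ (η t) (w' - w) := by
          refine (congrArg (fun L ↦ L (1 : ℝ)) h4).trans ?_
          exact congrArg (chartSymmDeriv x₀ (η t)) (one_smul ℝ (w' - w))
        refine enorm_le_of_metricAt_le hc ?_
        have h6 := hle t ht
        rwa [← h5] at h6
    _ = ENNReal.ofReal c := by simp

end Segment

/-! ### Mollification of Lipschitz functions -/

section Euclidean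

variable {n : ℕ}

/-- A bound for the difference quotients of `g` in the direction `v` at all points near `y` carries
over to the derivative of a mollification of `g` at `y`. -/
lemma fderiv_normed_convolution_le (φ : ContDiffBump (0 : EuclideanSpace ℝ (Fin n)))
    {g : EuclideanSpace ℝ (Fin n) → ℝ} (hg : LocallyIntegrable g volume)
    {y v : EuclideanSpace ℝ (Fin n)} {c τ : ℝ} (hτ : 0 < τ)
    (h : ∀ t : ℝ, 0 < t → t < τ → ∀ u ∈ Metric.ball (0 : EuclideanSpace ℝ (Fin n)) φ.rOut,
      g (y + t • v - u) - g (y - u) ≤ t * c) :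
    fderiv ℝ (convolution (φ.normed volume) g (ContinuousLinearMap.lsmul ℝ ℝ) volume) y v ≤ c := by
  set Ψ := convolution (φ.normed volume) g (ContinuousLinearMap.lsmul ℝ ℝ) volume with hΨ
  have hsupp : HasCompactSupport (φ.normed volume) := φ.hasCompactSupport_normed
  have hΨd : ContDiff ℝ 1 Ψ := hsupp.contDiff_convolution_left _ φ.contDiff_normed hg
  have hex (z : EuclideanSpace ℝ (Fin n)) :
      Integrable (fun u ↦ φ.normed volume u * g (z - u)) volume :=
    hsupp.convolutionExists_left (ContinuousLinearMap.lsmul ℝ ℝ) φ.continuous_normed hg z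
  have hval (z : EuclideanSpace ℝ (Fin n)) : Ψ z = ∫ u, φ.normed volume u * g (z - u) := rfl
  have hder : HasDerivAt (fun t : ℝ ↦ Ψ (y + t • v)) (fderiv ℝ Ψ y v) 0 :=
    ((hΨd.differentiable one_ne_zero) y).hasFDerivAt.hasLineDerivAt v
  refine le_of_tendsto hder.tendsto_slope_zero_right ?_
  filter_upwards [Ioo_mem_nhdsGT hτ] with t ht
  simp only [zero_add, zero_smul, add_zero, smul_eq_mul]
  rw [inv_mul_le_iff₀ ht.1, hval, hval, ← integral_sub (hex _) (hex _)]
  calc _ ≤ ∫ u, φ.normed volume u * (t * c) := by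
        refine integral_mono ((hex _).sub (hex _)) (φ.integrable_normed.mul_const _) fun u ↦ ?_
        simp only
        rw [← mul_sub]
        by_cases hu : u ∈ Metric.ball (0 : EuclideanSpace ℝ (Fin n)) φ.rOut
        · exact mul_le_mul_of_nonneg_left (h t ht.1 ht.2 u hu) (φ.nonneg_normed u)
        · rw [← φ.support_normed_eq (μ := volume), Function.notMem_support] at hu
          rw [hu, zero_mul, zero_mul]
    _ = t * c := by rw [integral_mul_const, φ.integral_normed, one_mul]

end Euclidean

section Local

variable {n : ℕ} {M : Type*} [EMetricSpace M] [ChartedSpace (EuclideanSpace ℝ (Fin n)) M]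
  [RiemannianBundle (fun x : M ↦ TangentSpace (𝓡 n) x)] [IsManifold (𝓡 n) ∞ M]
  [IsContMDiffRiemannianBundle (𝓡 n) ∞ (EuclideanSpace ℝ (Fin n))
      (fun x : M ↦ TangentSpace (𝓡 n) x)] [IsRiemannianManifold (𝓡 n) M]

lemma abs_sub_le_of_edist_le {f : M → ℝ} (hf : LipschitzWith 1 f) {x y : M} {c : ℝ} (hc : 0 ≤ c)
    (h : edist x y ≤ ENNReal.ofReal c) : |f x - f y| ≤ c := by
  have h1 := (hf x y).trans (by simpa using h)
  rwa [edist_dist, ENNReal.ofReal_le_ofReal_iff hc, Real.dist_eq] at h1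

/-- The convolution of a `1`-Lipschitz function in a chart with a bump function of small support:
the difference quotients in the direction `v` at `y` average difference quotients of the function
along segments of the same direction at points near `y`, where the metric is nearly the same. -/
lemma exists_chart_mollification {x₀ : M} {L : Set (EuclideanSpace ℝ (Fin n))} (hL : IsCompact L)
    (hLt : L ⊆ (extChartAt (𝓡 n) x₀).target) {f : M → ℝ} (hf : LipschitzWith 1 f) {ε : ℝ}
    (hε : 0 < ε) :
    ∃ Ψ : EuclideanSpace ℝ (Fin n) → ℝ, ContDiff ℝ ∞ Ψ ∧
      (∀ y ∈ L, |Ψ y - f ((extChartAt (𝓡 n) x₀).symm y)| ≤ ε) ∧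
      ∀ y ∈ L, ∀ v, fderiv ℝ Ψ y v ≤ √((1 + ε) * metricAt ((extChartAt (𝓡 n) x₀).symm y)
        (chartSymmDeriv x₀ y v) (chartSymmDeriv x₀ y v)) := by
  obtain ⟨δ, hδ, hsub, hcomp⟩ := exists_metricAt_le_mul hL hLt hε
  have hcpt : IsCompact (Metric.cthickening δ L) := hL.cthickening
  set F : EuclideanSpace ℝ (Fin n) → ℝ := fun y ↦ f ((extChartAt (𝓡 n) x₀).symm y) with hF
  have hFc : ContinuousOn F (Metric.cthickening δ L) :=
    hf.continuous.comp_continuousOn ((continuousOn_extChartAt_symm x₀).mono hsub)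
  obtain ⟨δ', hδ', hunif⟩ := Metric.uniformContinuousOn_iff_le.1
    (hcpt.uniformContinuousOn_of_continuous hFc) ε hε
  set s := min δ δ' with hs
  have hs0 : 0 < s := lt_min hδ hδ'
  let φ : ContDiffBump (0 : EuclideanSpace ℝ (Fin n)) :=
    ⟨s / 4, s / 2, by positivity, by linarith⟩
  set G := (Metric.cthickening δ L).indicator F with hG
  have hGint : Integrable G volume :=
    (hFc.integrableOn_compact hcpt).integrable_indicator hcpt.measurableSet
  have hnear {y w : EuclideanSpace ℝ (Fin n)} (hy : y ∈ L) (hw : dist w y ≤ s) :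
      w ∈ Metric.cthickening δ L :=
    Metric.mem_cthickening_of_dist_le w y δ L hy (hw.trans (min_le_left _ _))
  refine ⟨convolution (φ.normed volume) G (ContinuousLinearMap.lsmul ℝ ℝ) volume,
    φ.hasCompactSupport_normed.contDiff_convolution_left _ φ.contDiff_normed
      hGint.locallyIntegrable, fun y hy ↦ ?_, fun y hy v ↦ ?_⟩
  · have hGy : G y = F y := indicator_of_mem (hnear hy (by simp [hs0.le])) F
    have h := φ.dist_normed_convolution_le (μ := volume) (x₀ := y) (ε := ε)
      hGint.aestronglyMeasurable fun x hx ↦ by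
        have hx' : dist x y ≤ s := (Metric.mem_ball.1 hx).le.trans (half_le_self hs0.le)
        have hxm := hnear hy hx'
        rw [hGy, hG, indicator_of_mem hxm]
        exact hunif x hxm y (hnear hy (by simp [hs0.le])) (hx'.trans (min_le_right _ _))
    rwa [hGy] at h
  · set Q := metricAt ((extChartAt (𝓡 n) x₀).symm y) (chartSymmDeriv x₀ y v)
      (chartSymmDeriv x₀ y v)
    have hQ : 0 ≤ Q := metricAt_chartSymmDeriv_nonneg x₀ y v
    refine fderiv_normed_convolution_le φ hGint.locallyIntegrable
      (τ := s / 2 / (‖v‖ + 1)) (by positivity) fun t ht0 ht u hu ↦ ?_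
    have hu' : ‖u‖ < s / 2 := mem_ball_zero_iff.1 hu
    have htv : t * ‖v‖ ≤ s / 2 := by
      rw [lt_div_iff₀ (by positivity)] at ht
      nlinarith
    -- the segment from `y - u` to `y + t • v - u` stays within distance `s` of `y`
    have hseg (a : ℝ) (ha : a ∈ Icc (0 : ℝ) 1) :
        dist (AffineMap.lineMap (k := ℝ) (y - u) (y + t • v - u) a) y ≤ s := by
      have h1 : AffineMap.lineMap (k := ℝ) (y - u) (y + t • v - u) a - y = (a * t) • v - u := by
        rw [AffineMap.lineMap_apply, vsub_eq_sub, vadd_eq_add, mul_smul,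
          show y + t • v - u - (y - u) = t • v by abel]
        abel
      rw [dist_eq_norm, h1]
      calc ‖(a * t) • v - u‖ ≤ ‖(a * t) • v‖ + ‖u‖ := norm_sub_le _ _
        _ = a * (t * ‖v‖) + ‖u‖ := by
            rw [norm_smul, Real.norm_of_nonneg (mul_nonneg ha.1 ht0.le), mul_assoc]
        _ ≤ 1 * (s / 2) + s / 2 := by
            have := ha.1
            have := ha.2
            gcongr
        _ = s := by ring
    have hm0 : y - u ∈ Metric.cthickening δ L := hnear hy (by simpa using hseg 0 (by simp))
    have hm1 : y + t • v - u ∈ Metric.cthickening δ L :=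
      hnear hy (by simpa using hseg 1 (by simp))
    rw [hG, indicator_of_mem hm0, indicator_of_mem hm1]
    refine (le_abs_self _).trans (abs_sub_le_of_edist_le hf (by positivity) ?_)
    rw [edist_comm]
    refine edist_extChartAt_symm_le (by positivity) (fun a ha ↦ hsub (hnear hy (hseg a ha)))
      fun a ha ↦ ?_
    rw [show y + t • v - u - (y - u) = t • v by abel, metricAt_chartSymmDeriv_smul, mul_pow,
      Real.sq_sqrt (by positivity)]
    exact mul_le_mul_of_nonneg_left
      (hcomp y hy _ ((hseg a ha).trans (min_le_left _ _)) v) (sq_nonneg t)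

/-- A `1`-Lipschitz function can be approximated near a compact subset of a chart domain by smooth
functions with gradient at most `1 + ε`. -/
lemma exists_local_mollification {x₀ : M} {K : Set M} (hK : IsCompact K)
    (hKs : K ⊆ (extChartAt (𝓡 n) x₀).source) {f : M → ℝ} (hf : LipschitzWith 1 f) {ε : ℝ}
    (hε : 0 < ε) :
    ∃ g : M → ℝ, (∀ x ∈ K, ContMDiffAt (𝓡 n) 𝓘(ℝ, ℝ) ∞ g x) ∧ (∀ x ∈ K, |g x - f x| ≤ ε) ∧
      ∀ x ∈ K, ‖gradient n g x‖ ≤ 1 + ε := by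
  obtain ⟨Ψ, hΨ, happ, hder⟩ := exists_chart_mollification (isCompact_extChartAt_image hK hKs)
    (extChartAt_image_subset hKs) hf hε
  have hsm {x : M} (hx : x ∈ K) :
      ContMDiffAt (𝓡 n) 𝓘(ℝ, ℝ) ∞ (fun z ↦ Ψ (extChartAt (𝓡 n) x₀ z)) x :=
    (hΨ.contMDiff.contMDiffAt).comp x (contMDiffAt_extChartAt' (by simpa using hKs hx))
  refine ⟨fun z ↦ Ψ (extChartAt (𝓡 n) x₀ z), fun x hx ↦ hsm hx, fun x hx ↦ ?_, fun x hx ↦ ?_⟩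
  · have h := happ _ (mem_image_of_mem _ hx)
    rwa [(extChartAt (𝓡 n) x₀).left_inv (hKs hx)] at h
  · have hy : extChartAt (𝓡 n) x₀ x ∈ (extChartAt (𝓡 n) x₀).target :=
      (extChartAt (𝓡 n) x₀).map_source (hKs hx)
    obtain ⟨y, hyx⟩ : ∃ y, y = extChartAt (𝓡 n) x₀ x := ⟨_, rfl⟩
    have hxy : x = (extChartAt (𝓡 n) x₀).symm y := by
      rw [hyx, (extChartAt (𝓡 n) x₀).left_inv (hKs hx)]
    have hdy := hder _ (mem_image_of_mem _ hx)
    have hmd := (hsm hx).mdifferentiableAt (by simp)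
    rw [← hyx] at hy hdy
    subst hxy
    refine norm_gradient_le (by positivity) fun u ↦ ?_
    obtain ⟨v, hv⟩ := (chartSymmDeriv_bijective hy).surjective u
    have h1 := mvfderiv_chartSymmDeriv hy hmd v
    have h2 : (fun z ↦ Ψ (extChartAt (𝓡 n) x₀ ((extChartAt (𝓡 n) x₀).symm z))) =ᶠ[𝓝 y] Ψ := by
      filter_upwards [(isOpen_extChartAt_target x₀).mem_nhds hy] with z hz
      rw [(extChartAt (𝓡 n) x₀).right_inv hz]
    rw [h2.fderiv_eq] at h1
    have h3 := hdy v
    rw [← h1, hv] at h3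
    refine h3.trans (Real.sqrt_le_iff.2 ⟨by positivity, ?_⟩)
    rw [metricAt_self, mul_pow]
    exact mul_le_mul_of_nonneg_right (by nlinarith) (sq_nonneg _)

end Local

/-! ### Smooth cutoff functions of geodesic balls -/

section Step

/-- A smooth step function descending from `1` to `0` inside the interval `(a, b)`, with slope
nearly as small as that of the affine one. -/
lemma exists_smooth_step {a b ε : ℝ} (hab : a < b) (hε : 0 < ε) :
    ∃ (χ : ℝ → ℝ) (η : ℝ), 0 < η ∧ ContDiff ℝ ∞ χ ∧ (∀ s, 0 ≤ χ s) ∧ (∀ s, χ s ≤ 1) ∧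
      (∀ s ≤ a + η, χ s = 1) ∧ (∀ s ≥ b - η, χ s = 0) ∧ (∀ s ≥ b - η, deriv χ s = 0) ∧
      ∀ s, |deriv χ s| ≤ (1 + ε) ^ 2 / (b - a) := by
  set d := (b - a) / 2 with hd
  have hd0 : 0 < d := by linarith
  let φ : ContDiffBump ((a + b) / 2 : ℝ) := ⟨d / (1 + ε) ^ 2, d / (1 + ε), by positivity, by
    gcongr
    nlinarith⟩
  set k := φ.normed volume with hk
  have hkc : Continuous k := φ.continuous_normed
  have hk0 (s : ℝ) : 0 ≤ k s := φ.nonneg_normed s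
  set η := d - d / (1 + ε) with hη
  have hη0 : 0 < η := sub_pos.2 (div_lt_self hd0 (by linarith))
  have hηd : η < d := sub_lt_self d (by positivity)
  have hsupp : Function.support k = Ioo (a + η) (b - η) := by
    rw [hk, φ.support_normed_eq, Real.ball_eq_Ioo]
    congr 1
    · change (a + b) / 2 - d / (1 + ε) = _
      rw [hη, hd]
      ring
    · change (a + b) / 2 + d / (1 + ε) = _
      rw [hη, hd]
      ring
  set χ : ℝ → ℝ := fun s ↦ 1 - ∫ t in a..s, k t with hχ
  have hder (s : ℝ) : HasDerivAt χ (-k s) s := by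
    have h := (intervalIntegral.integral_hasDerivAt_right (hkc.intervalIntegrable a s)
      (hkc.stronglyMeasurableAtFilter _ _) hkc.continuousAt).const_sub 1
    exact h
  have hderiv : deriv χ = fun s ↦ -k s := funext fun s ↦ (hder s).deriv
  have hanti : Antitone χ := antitone_of_deriv_nonpos (fun s ↦ (hder s).differentiableAt)
    fun s ↦ by simp [hderiv, hk0]
  have hone (s : ℝ) (hs : s ≤ a + η) : χ s = 1 := by
    have h : ∫ t in a..s, k t = ∫ t in a..s, (0 : ℝ) := by
      refine intervalIntegral.integral_congr fun t ht ↦ ?_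
      rw [← Function.notMem_support, hsupp]
      have h1 : t ≤ max a s := ht.2
      exact fun h2 ↦ (h2.1.trans_le h1).not_ge (max_le (by linarith) hs)
    simp [hχ, h]
  have hzero (s : ℝ) (hs : b - η ≤ s) : χ s = 0 := by
    have h : ∫ t in a..s, k t = ∫ t, k t := by
      refine intervalIntegral.integral_eq_integral_of_support_subset ?_
      rw [hsupp]
      exact fun t ht ↦ ⟨by linarith [ht.1], by linarith [ht.2]⟩
    simp only [hχ, h]
    rw [hk, φ.integral_normed, sub_self]
  refine ⟨χ, η, hη0, ?_, fun s ↦ ?_, fun s ↦ ?_, hone, hzero, fun s hs ↦ ?_, fun s ↦ ?_⟩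
  · rw [contDiff_infty_iff_deriv]
    refine ⟨fun s ↦ (hder s).differentiableAt, ?_⟩
    rw [hderiv]
    exact φ.contDiff_normed.neg
  · rw [← hzero (max s (b - η)) (le_max_right _ _)]
    exact hanti (le_max_left _ _)
  · rw [← hone (min s (a + η)) (min_le_right _ _)]
    exact hanti (min_le_left _ _)
  · rw [hderiv, neg_eq_zero, ← Function.notMem_support, hsupp]
    exact fun h ↦ hs.not_gt h.2
  · -- the normalized bump is at most `1 / (2 rIn)`, with `rIn = (b - a) / (2 (1 + ε) ^ 2)`
    rw [hderiv, abs_neg, abs_of_nonneg (hk0 s)]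
    refine (φ.normed_le_div_measure_closedBall_rIn volume s).trans_eq ?_
    rw [Real.volume_real_closedBall φ.rIn_pos.le]
    change 1 / (2 * (d / (1 + ε) ^ 2)) = _
    rw [hd]
    field_simp

end Step

section Global

lemma lipschitzWith_edist_truncated {M : Type*} [EMetricSpace M] (p : M) (r : ℝ) :
    LipschitzWith 1 fun x ↦ (min (edist p x) (ENNReal.ofReal r)).toReal := by
  have hfin (x : M) : min (edist p x) (ENNReal.ofReal r) ≠ ⊤ :=
    ((min_le_right _ _).trans_lt ENNReal.ofReal_lt_top).ne
  have key {x y : M} (h : edist x y ≠ ⊤) : (min (edist p x) (ENNReal.ofReal r)).toReal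
      ≤ (min (edist p y) (ENNReal.ofReal r)).toReal + (edist x y).toReal := by
    rw [← ENNReal.toReal_add (hfin y) h]
    refine ENNReal.toReal_mono (ENNReal.add_ne_top.2 ⟨hfin y, h⟩) ?_
    rw [← min_add_add_right]
    refine min_le_min ?_ le_self_add
    rw [edist_comm x y]
    exact edist_triangle p y x
  intro x y
  rw [ENNReal.coe_one, one_mul]
  rcases eq_or_ne (edist x y) ⊤ with h | h
  · rw [h]
    exact le_top
  · rw [edist_dist, Real.dist_eq]
    refine ENNReal.ofReal_le_of_le_toReal (abs_sub_le_iff.2 ⟨?_, ?_⟩)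
    · linarith [key h]
    · rw [edist_comm] at h ⊢
      linarith [key h]

variable {n : ℕ} {M : Type*} [EMetricSpace M] [CompactSpace M]
  [ChartedSpace (EuclideanSpace ℝ (Fin n)) M]
  [RiemannianBundle (fun x : M ↦ TangentSpace (𝓡 n) x)] [IsManifold (𝓡 n) ∞ M]
  [IsContMDiffRiemannianBundle (𝓡 n) ∞ (EuclideanSpace ℝ (Fin n))
      (fun x : M ↦ TangentSpace (𝓡 n) x)] [IsRiemannianManifold (𝓡 n) M]

/-- Smooth approximation of `1`-Lipschitz functions, with gradient at most `1 + ε`: local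
approximations `gᵢ` are glued by a partition of unity `ρᵢ`; since `∑ ∇ρᵢ = 0`, the terms with
derivatives of the partition sum up to `∑ (gᵢ - f) ∇ρᵢ`, which is small. -/
lemma exists_smooth_approximation {f : M → ℝ} (hf : LipschitzWith 1 f) {ε : ℝ} (hε : 0 < ε) :
    ∃ g : M → ℝ, ContMDiff (𝓡 n) 𝓘(ℝ, ℝ) ∞ g ∧ (∀ x, |g x - f x| ≤ ε) ∧
      ∀ x, ‖gradient n g x‖ ≤ 1 + ε := by
  obtain ⟨t, ρ, hρ, hρ0, hρ1, hsum, hsupp⟩ := exists_finite_partition n M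
  obtain ⟨B, hB⟩ := isCompact_univ.bddAbove_image (f := fun x ↦ ∑ i ∈ t, ‖gradient n (ρ i) x‖)
    (continuous_finsetSum t fun i _ ↦ continuous_norm_gradient (hρ i)).continuousOn
  replace hB (x : M) : ∑ i ∈ t, ‖gradient n (ρ i) x‖ ≤ max B 0 :=
    (hB (mem_image_of_mem _ (mem_univ x))).trans (le_max_left _ _)
  have hB0 : 0 ≤ max B 0 := le_max_right _ _
  set ε' := ε / (1 + max B 0) with hε'
  have hε'0 : 0 < ε' := by positivity
  have hε'1 : ε' + ε' * max B 0 = ε := by rw [hε']; field_simp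
  have hε'2 : ε' ≤ ε := div_le_self hε.le (by linarith)
  choose g hgs hga hgd using fun i ↦ exists_local_mollification (n := n)
    (isClosed_tsupport (ρ i)).isCompact (hsupp i) hf hε'0
  have hmul (i : M) : ContMDiff (𝓡 n) 𝓘(ℝ, ℝ) ∞ (fun x ↦ ρ i x * g i x) := by
    refine contMDiff_of_tsupport fun x hx ↦ ?_
    exact (hρ i x).mul (hgs i x (tsupport_mul_subset_left hx))
  refine ⟨fun x ↦ ∑ i ∈ t, ρ i x * g i x, contMDiff_finsetSum fun i _ ↦ hmul i,
    fun x ↦ ?_, fun x ↦ ?_⟩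
  · have h1 : ∑ i ∈ t, ρ i x * g i x - f x = ∑ i ∈ t, ρ i x * (g i x - f x) := by
      simp only [mul_sub, Finset.sum_sub_distrib, ← Finset.sum_mul, hsum, one_mul]
    rw [h1]
    calc |∑ i ∈ t, ρ i x * (g i x - f x)| ≤ ∑ i ∈ t, |ρ i x * (g i x - f x)| :=
          Finset.abs_sum_le_sum_abs _ _
      _ ≤ ∑ i ∈ t, ρ i x * ε' := by
          refine Finset.sum_le_sum fun i _ ↦ ?_
          rw [abs_mul, abs_of_nonneg (hρ0 i x)]
          rcases (hρ0 i x).eq_or_lt with h | h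
          · rw [← h, zero_mul, zero_mul]
          · exact mul_le_mul_of_nonneg_left (hga i x (subset_tsupport _ h.ne')) h.le
      _ = ε' := by rw [← Finset.sum_mul, hsum, one_mul]
      _ ≤ ε := hε'2
  · have hzero : ∑ i ∈ t, gradient n (ρ i) x = 0 := by
      rw [← gradient_sum t fun i _ ↦ (hρ i).mdifferentiable (by simp) x]
      simp only [hsum]
      exact gradient_const 1 x
    rw [gradient_sum t fun i _ ↦ (hmul i).mdifferentiable (by simp) x]
    have h1 : ∑ i ∈ t, gradient n (fun z ↦ ρ i z * g i z) x
        = ∑ i ∈ t, (gradient n (fun z ↦ ρ i z * g i z) x - f x • gradient n (ρ i) x) := by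
      rw [Finset.sum_sub_distrib, ← Finset.smul_sum, hzero, smul_zero, sub_zero]
    have h2 (i : M) : ‖gradient n (fun z ↦ ρ i z * g i z) x - f x • gradient n (ρ i) x‖
        ≤ ρ i x * (1 + ε') + ε' * ‖gradient n (ρ i) x‖ := by
      by_cases hx : x ∈ tsupport (ρ i)
      · rw [gradient_mul ((hρ i).mdifferentiable (by simp) x)
          ((hgs i x hx).mdifferentiableAt (by simp)), add_sub_assoc, ← sub_smul]
        refine (norm_add_le _ _).trans ?_
        rw [norm_smul, norm_smul, Real.norm_of_nonneg (hρ0 i x), Real.norm_eq_abs]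
        have := hρ0 i x
        gcongr
        · exact hgd i x hx
        · exact hga i x hx
      · have h3 : ρ i =ᶠ[𝓝 x] fun _ ↦ 0 := notMem_tsupport_iff_eventuallyEq.1 hx
        have h4 : (fun z ↦ ρ i z * g i z) =ᶠ[𝓝 x] fun _ ↦ 0 := by
          filter_upwards [h3] with z hz
          rw [hz, zero_mul]
        rw [gradient_congr h3, gradient_congr h4, gradient_const, smul_zero, sub_zero, norm_zero]
        have := hρ0 i x
        positivity
    rw [h1]
    calc _ ≤ ∑ i ∈ t, (ρ i x * (1 + ε') + ε' * ‖gradient n (ρ i) x‖) :=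
          norm_sum_le_of_le _ fun i _ ↦ h2 i
      _ = 1 + ε' + ε' * ∑ i ∈ t, ‖gradient n (ρ i) x‖ := by
          rw [Finset.sum_add_distrib, ← Finset.sum_mul, hsum, one_mul, Finset.mul_sum]
      _ ≤ 1 + ε' + ε' * max B 0 := by
          gcongr
          exact hB x
      _ = 1 + ε := by rw [add_assoc, hε'1]

/-- Smooth cutoff functions of a geodesic ball with gradient nearly as small as that of the
piecewise affine function of the distance. -/
lemma exists_smooth_cutoff (p : M) {r ε : ℝ} (hr : 0 < r) (hε : 0 < ε) :
    ∃ h : M → ℝ, ContMDiff (𝓡 n) 𝓘(ℝ, ℝ) ∞ h ∧ (∀ x, 0 ≤ h x) ∧ (∀ x, h x ≤ 1) ∧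
      (∀ x ∈ geodesicBall p (r / 2), h x = 1) ∧ (∀ x ∉ geodesicBall p r, h x = 0) ∧
      (∀ x ∉ geodesicBall p r, gradient n h x = 0) ∧
      ∀ x, ‖gradient n h x‖ ≤ (1 + ε) ^ 3 * (2 / r) := by
  obtain ⟨χ, η, hη, hχ, hχ0, hχ1, hone, hzero, hderiv, hslope⟩ :=
    exists_smooth_step (half_lt_self hr) hε
  obtain ⟨g, hg, happ, hgrad⟩ := exists_smooth_approximation (n := n)
    (lipschitzWith_edist_truncated p r) (lt_min hε hη)
  have hin (x : M) (hx : x ∈ geodesicBall p (r / 2)) : g x ≤ r / 2 + η := by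
    have h1 : (min (edist p x) (ENNReal.ofReal r)).toReal ≤ r / 2 := by
      refine ENNReal.toReal_le_of_le_ofReal (by positivity) ((min_le_left _ _).trans ?_)
      rw [edist_comm]
      exact (Metric.mem_eball.1 hx).le
    have h2 := (abs_le.1 (happ x)).2
    linarith [min_le_right ε η]
  have hout (x : M) (hx : x ∉ geodesicBall p r) : r - η ≤ g x := by
    have h1 : (min (edist p x) (ENNReal.ofReal r)).toReal = r := by
      rw [min_eq_right, ENNReal.toReal_ofReal hr.le]
      rw [edist_comm]
      exact not_lt.1 hx
    have h2 := (abs_le.1 (happ x)).1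
    rw [h1] at h2
    linarith [min_le_right ε η]
  have hcomp (x : M) : gradient n (fun z ↦ χ (g z)) x = deriv χ (g x) • gradient n g x :=
    gradient_comp (hχ.differentiable (by simp) _) (hg.mdifferentiable (by simp) x)
  refine ⟨fun x ↦ χ (g x), hχ.contMDiff.comp hg, fun x ↦ hχ0 _, fun x ↦ hχ1 _,
    fun x hx ↦ hone _ (hin x hx), fun x hx ↦ hzero _ (hout x hx), fun x hx ↦ ?_, fun x ↦ ?_⟩
  · rw [hcomp, hderiv _ (hout x hx), zero_smul]
  · rw [hcomp, norm_smul, Real.norm_eq_abs]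
    calc |deriv χ (g x)| * ‖gradient n g x‖
        ≤ (1 + ε) ^ 2 / (r - r / 2) * (1 + ε) := by
          gcongr
          · exact (abs_nonneg _).trans (hslope (g x))
          · exact hslope _
          · exact (hgrad x).trans (by linarith [min_le_left ε η])
      _ = _ := by field_simp; ring

end Global

/-! ### The Yamabe inequality on geodesic balls -/

/-- Hölder's inequality for functions supported in a set, between the exponents `2` and
`2n / (n - 2)`. -/
lemma integral_sq_le_of_support {M : Type*} [TopologicalSpace M]
    [CompactSpace M] [MeasurableSpace M] [BorelSpace M] {n : ℕ} {μ : Measure M}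
    [IsFiniteMeasure μ] (hn : 3 ≤ n) {h : M → ℝ}
    (hh : Continuous h) (h0 : ∀ x, 0 ≤ h x) {s : Set M} (hs : MeasurableSet s)
    (hsupp : ∀ x ∉ s, h x = 0) :
    ∫ x, h x ^ 2 ∂μ ≤ (∫ x, h x ^ (2 * (n : ℝ) / ((n : ℝ) - 2)) ∂μ) ^ (((n : ℝ) - 2) / (n : ℝ))
      * μ.real s ^ (2 / (n : ℝ)) := by
  have hn3 : (3 : ℝ) ≤ n := by exact_mod_cast hn
  have hn2 : (0 : ℝ) < (n : ℝ) - 2 := by linarith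
  have hpq : ((n : ℝ) / ((n : ℝ) - 2)).HolderConjugate ((n : ℝ) / 2) := by
    rw [Real.holderConjugate_iff]
    refine ⟨(one_lt_div hn2).2 (by linarith), ?_⟩
    field_simp
    ring
  have h1 := integral_mul_le_Lp_mul_Lq_of_nonneg hpq (μ := μ) (f := fun x ↦ h x ^ 2)
    (g := s.indicator fun _ ↦ 1) (ae_of_all _ fun x ↦ sq_nonneg (h x))
    (ae_of_all _ fun x ↦ indicator_nonneg (fun _ _ ↦ zero_le_one) x)
    (memLp_of_continuous (hh.pow 2) _) (memLp_indicator_const _ hs _ (Or.inr (measure_ne_top _ _)))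
  have h2 (x : M) : h x ^ 2 * s.indicator (fun _ ↦ (1 : ℝ)) x = h x ^ 2 := by
    by_cases hx : x ∈ s
    · rw [indicator_of_mem hx, mul_one]
    · simp [hsupp x hx]
  have h3 (x : M) : (h x ^ 2) ^ ((n : ℝ) / ((n : ℝ) - 2))
      = h x ^ (2 * (n : ℝ) / ((n : ℝ) - 2)) := by
    rw [← Real.rpow_natCast, ← Real.rpow_mul (h0 x), mul_div_assoc]
    norm_num
  have h4 (x : M) : (s.indicator (fun _ ↦ (1 : ℝ)) x) ^ ((n : ℝ) / 2)
      = s.indicator (fun _ ↦ (1 : ℝ)) x := by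
    by_cases hx : x ∈ s
    · rw [indicator_of_mem hx, Real.one_rpow]
    · rw [indicator_of_notMem hx, Real.zero_rpow (by positivity)]
  simp only [h2, h3, h4] at h1
  rw [integral_indicator hs, setIntegral_const, smul_eq_mul, mul_one, one_div_div, one_div_div]
    at h1
  exact h1

section NonnegTest

variable {n : ℕ} {M : Type*} [TopologicalSpace M] [T2Space M] [CompactSpace M]
  [ChartedSpace (EuclideanSpace ℝ (Fin n)) M]
  [RiemannianBundle (fun x : M ↦ TangentSpace (𝓡 n) x)] [IsManifold (𝓡 n) ∞ M]
  [IsContMDiffRiemannianBundle (𝓡 n) ∞ (EuclideanSpace ℝ (Fin n))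
      (fun x : M ↦ TangentSpace (𝓡 n) x)] [MeasurableSpace M] [BorelSpace M]

/-- The inequality expressed by the Yamabe constant, for nonnegative smooth functions `h`: it is the
limit as `δ → 0` of the inequalities for `h + δ`. -/
lemma yamabeConstant_mul_le_of_nonneg [Nonempty M] (hn : 3 ≤ n)
    (hR : ∀ x : M, 0 < scalarCurvature n x) {h : M → ℝ} (hh : ContMDiff (𝓡 n) 𝓘(ℝ, ℝ) ∞ h)
    (h0 : ∀ x, 0 ≤ h x) :
    yamabeConstant n M
        * (∫ x, h x ^ (2 * (n : ℝ) / ((n : ℝ) - 2)) ∂riemannianVolume n M)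
          ^ (((n : ℝ) - 2) / (n : ℝ))
      ≤ 4 * ((n : ℝ) - 1) / ((n : ℝ) - 2) * (∫ x, ‖gradient n h x‖ ^ 2 ∂riemannianVolume n M)
        + ∫ x, scalarCurvature n x * h x ^ 2 ∂riemannianVolume n M := by
  have hn3 : (3 : ℝ) ≤ n := by exact_mod_cast hn
  have hn2 : (0 : ℝ) < (n : ℝ) - 2 := by linarith
  have hq : 0 ≤ 2 * (n : ℝ) / ((n : ℝ) - 2) := by positivity
  have hRc : Continuous (scalarCurvature n : M → ℝ) := continuous_scalarCurvature
  have hhc : Continuous h := hh.continuous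
  set A := ∫ x, ‖gradient n h x‖ ^ 2 ∂riemannianVolume n M
  have key (δ : ℝ) (hδ : 0 < δ) : yamabeConstant n M
        * (∫ x, h x ^ (2 * (n : ℝ) / ((n : ℝ) - 2)) ∂riemannianVolume n M)
          ^ (((n : ℝ) - 2) / (n : ℝ))
      ≤ 4 * ((n : ℝ) - 1) / ((n : ℝ) - 2) * A
        + ((∫ x, scalarCurvature n x * h x ^ 2 ∂riemannianVolume n M)
          + (δ * (2 * ∫ x, scalarCurvature n x * h x ∂riemannianVolume n M)
            + δ ^ 2 * ∫ x, scalarCurvature n x ∂riemannianVolume n M)) := by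
    have h1 := yamabeConstant_mul_le hn hR (φ := fun x ↦ h x + δ) (hh.add contMDiff_const)
      fun x ↦ by linarith [h0 x]
    have h2 (x : M) : gradient n (fun z ↦ h z + δ) x = gradient n h x := by
      rw [gradient_add (hh.mdifferentiable (by simp) x) mdifferentiableAt_const, gradient_const,
        add_zero]
    simp only [h2] at h1
    have h3 : ∫ x, scalarCurvature n x * (h x + δ) ^ 2 ∂riemannianVolume n M
        = (∫ x, scalarCurvature n x * h x ^ 2 ∂riemannianVolume n M)
          + (δ * (2 * ∫ x, scalarCurvature n x * h x ∂riemannianVolume n M)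
            + δ ^ 2 * ∫ x, scalarCurvature n x ∂riemannianVolume n M) := by
      rw [← integral_const_mul, ← integral_const_mul, ← integral_const_mul,
        ← integral_add (integrable_of_continuous (by fun_prop))
          (integrable_of_continuous (by fun_prop)),
        ← integral_add (integrable_of_continuous (by fun_prop))
          (integrable_of_continuous (by fun_prop))]
      exact integral_congr_ae (ae_of_all _ fun x ↦ by ring)
    rw [h3] at h1
    refine le_trans ?_ h1
    refine mul_le_mul_of_nonneg_left ?_ (yamabeConstant_pos hn hR).le
    refine Real.rpow_le_rpow (integral_nonneg fun x ↦ Real.rpow_nonneg (h0 x) _) ?_ (by positivity)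
    refine integral_mono (integrable_of_continuous ?_) (integrable_of_continuous ?_) fun x ↦ ?_
    · exact hhc.rpow_const fun _ ↦ Or.inr hq
    · exact (hhc.add continuous_const).rpow_const fun _ ↦ Or.inr hq
    · exact Real.rpow_le_rpow (h0 x) (by linarith) hq
  refine ge_of_tendsto (x := 𝓝[>] (0 : ℝ)) (f := fun δ ↦ 4 * ((n : ℝ) - 1) / ((n : ℝ) - 2) * A
        + ((∫ x, scalarCurvature n x * h x ^ 2 ∂riemannianVolume n M)
          + (δ * (2 * ∫ x, scalarCurvature n x * h x ∂riemannianVolume n M)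
            + δ ^ 2 * ∫ x, scalarCurvature n x ∂riemannianVolume n M))) ?_
    (eventually_nhdsWithin_of_forall key)
  refine Tendsto.mono_left (Continuous.tendsto' (by fun_prop) 0 _ (by simp)) nhdsWithin_le_nhds

end NonnegTest

section Balls

variable {n : ℕ} {M : Type*} [EMetricSpace M] [CompactSpace M]
  [ChartedSpace (EuclideanSpace ℝ (Fin n)) M]
  [RiemannianBundle (fun x : M ↦ TangentSpace (𝓡 n) x)] [IsManifold (𝓡 n) ∞ M]
  [IsContMDiffRiemannianBundle (𝓡 n) ∞ (EuclideanSpace ℝ (Fin n))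
      (fun x : M ↦ TangentSpace (𝓡 n) x)] [MeasurableSpace M] [BorelSpace M]

lemma isOpen_geodesicBall {X : Type*} [EMetricSpace X] (p : X) (r : ℝ) :
    IsOpen (geodesicBall p r) :=
  Metric.isOpen_eball

lemma ballVolume_pos (p : M) {r : ℝ} (hr : 0 < r) : 0 < ballVolume n p r := by
  refine ENNReal.toReal_pos ?_ (measure_ne_top _ _)
  exact ((isOpen_geodesicBall p r).measure_pos _
    ⟨p, Metric.mem_eball_self (ENNReal.ofReal_pos.2 hr)⟩).ne'

lemma integral_le_setIntegral_geodesicBall {u w : M → ℝ} (hu : Continuous u) (hw : Continuous w)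
    {p : M} {r : ℝ} (hle : ∀ x, u x ≤ w x) (hzero : ∀ x ∉ geodesicBall p r, u x = 0) :
    ∫ x, u x ∂riemannianVolume n M ≤ ∫ x in geodesicBall p r, w x ∂riemannianVolume n M := by
  rw [← setIntegral_eq_integral_of_forall_compl_eq_zero hzero]
  exact setIntegral_mono (integrable_of_continuous hu).integrableOn
    (integrable_of_continuous hw).integrableOn hle

/-- The Yamabe inequality for cutoff functions of a geodesic ball, combined with Hölder's
inequality; the slopes of the cutoff functions are taken to the limit `2 / r`. -/
lemma yamabeConstant_mul_ballVolume_le [IsRiemannianManifold (𝓡 n) M] (hn : 3 ≤ n)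
    (hR : ∀ x : M, 0 < scalarCurvature n x) (p : M) {r : ℝ} (hr : 0 < r) :
    yamabeConstant n M * ballVolume n p (r / 2) ≤ ballVolume n p r ^ (2 / (n : ℝ))
      * (4 * (4 * ((n : ℝ) - 1) / ((n : ℝ) - 2)) / r ^ 2 * ballVolume n p r
        + ∫ x in geodesicBall p r, scalarCurvature n x ∂riemannianVolume n M) := by
  have : Nonempty M := ⟨p⟩
  have hn3 : (3 : ℝ) ≤ n := by exact_mod_cast hn
  have hn2 : (0 : ℝ) < (n : ℝ) - 2 := by linarith
  have hn1 : (0 : ℝ) < (n : ℝ) - 1 := by linarith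
  have hRc : Continuous (scalarCurvature n : M → ℝ) := continuous_scalarCurvature
  have hY := yamabeConstant_pos (n := n) hn hR
  have hV := ballVolume_pos (n := n) p hr
  set a := 4 * ((n : ℝ) - 1) / ((n : ℝ) - 2) with ha
  have ha0 : 0 < a := by positivity
  set S := ∫ x in geodesicBall p r, scalarCurvature n x ∂riemannianVolume n M
  have key (ε : ℝ) (hε : 0 < ε) : yamabeConstant n M * ballVolume n p (r / 2)
      ≤ ballVolume n p r ^ (2 / (n : ℝ))
        * (a * (((1 + ε) ^ 3 * (2 / r)) ^ 2 * ballVolume n p r) + S) := by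
    obtain ⟨h, hh, h0, h1, hone, hzero, hgzero, hgrad⟩ :=
      exists_smooth_cutoff (n := n) p hr hε
    have hW : ballVolume n p (r / 2) ≤ ∫ x, h x ^ 2 ∂riemannianVolume n M := by
      have h2 : ∫ x in geodesicBall p (r / 2), h x ^ 2 ∂riemannianVolume n M
          = ballVolume n p (r / 2) := by
        rw [setIntegral_congr_fun (g := fun _ ↦ 1) (isOpen_geodesicBall p _).measurableSet
          fun x hx ↦ by simp [hone x hx]]
        simp [ballVolume]
      rw [← h2]
      exact setIntegral_le_integral (integrable_of_continuous (hh.continuous.pow 2))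
        (ae_of_all _ fun x ↦ sq_nonneg (h x))
    have hG : ∫ x, ‖gradient n h x‖ ^ 2 ∂riemannianVolume n M
        ≤ ((1 + ε) ^ 3 * (2 / r)) ^ 2 * ballVolume n p r := by
      refine (integral_le_setIntegral_geodesicBall (p := p) (r := r)
        (w := fun _ ↦ ((1 + ε) ^ 3 * (2 / r)) ^ 2) (continuous_norm_gradient_sq hh)
        continuous_const (fun x ↦ ?_) fun x hx ↦ ?_).trans_eq ?_
      · exact pow_le_pow_left₀ (norm_nonneg _) (hgrad x) 2
      · rw [hgzero x hx, norm_zero, zero_pow two_ne_zero]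
      · rw [setIntegral_const, smul_eq_mul, mul_comm]
        rfl
    have hS : ∫ x, scalarCurvature n x * h x ^ 2 ∂riemannianVolume n M ≤ S := by
      refine integral_le_setIntegral_geodesicBall
        (u := fun x ↦ scalarCurvature n x * h x ^ 2) (hRc.mul (hh.continuous.pow 2)) hRc
        (fun x ↦ ?_) fun x hx ↦ ?_
      · exact mul_le_of_le_one_right (hR x).le (pow_le_one₀ (h0 x) (h1 x))
      · rw [hzero x hx, zero_pow two_ne_zero, mul_zero]
    have hH := integral_sq_le_of_support (μ := riemannianVolume n M) hn hh.continuous h0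
      (isOpen_geodesicBall p r).measurableSet hzero
    have hE := yamabeConstant_mul_le_of_nonneg hn hR hh h0
    set N := (∫ x, h x ^ (2 * (n : ℝ) / ((n : ℝ) - 2)) ∂riemannianVolume n M)
      ^ (((n : ℝ) - 2) / (n : ℝ))
    calc yamabeConstant n M * ballVolume n p (r / 2)
        ≤ yamabeConstant n M * (N * ballVolume n p r ^ (2 / (n : ℝ))) :=
          mul_le_mul_of_nonneg_left (hW.trans hH) hY.le
      _ = ballVolume n p r ^ (2 / (n : ℝ)) * (yamabeConstant n M * N) := by ring
      _ ≤ _ := by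
          refine mul_le_mul_of_nonneg_left (hE.trans ?_) (by positivity)
          gcongr
  refine ge_of_tendsto (x := 𝓝[>] (0 : ℝ)) (f := fun ε ↦ ballVolume n p r ^ (2 / (n : ℝ))
        * (a * (((1 + ε) ^ 3 * (2 / r)) ^ 2 * ballVolume n p r) + S)) ?_
    (eventually_nhdsWithin_of_forall key)
  refine Tendsto.mono_left (Continuous.tendsto' (by fun_prop) 0 _ ?_) nhdsWithin_le_nhds
  congr 2
  field_simp
  ring

end Balls

/-- If `Y ≤ V ^ (2 / n) X`, then `log Y ≤ (2 / n) log V + log X`, and `log X` lies below the tangent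
line of the logarithm at `n / (2 r²)`; this is the point for which the coefficient of `X` becomes
`r²`. -/
lemma log_le_of_le_rpow_mul {n Y V X r : ℝ} (hn : 0 < n) (hY : 0 < Y) (hV : 0 < V) (hX : 0 < X)
    (hr : 0 < r) (h : Y ≤ V ^ (2 / n) * X) :
    n / 2 * Real.log (2 * Real.exp 1 * Y / n) ≤ r ^ 2 * X + Real.log V - n * Real.log r := by
  have h1 : Real.log Y ≤ 2 / n * Real.log V + Real.log X := by
    rw [← Real.log_rpow hV, ← Real.log_mul (by positivity) hX.ne']
    exact Real.log_le_log hY h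
  have h2 : Real.log (2 / n * r ^ 2 * X) ≤ 2 / n * r ^ 2 * X - 1 :=
    Real.log_le_sub_one_of_pos (by positivity)
  rw [Real.log_mul (by positivity) hX.ne', Real.log_mul (by positivity) (by positivity),
    Real.log_pow] at h2
  have h3 : Real.log (2 * Real.exp 1 * Y / n) = Real.log (2 / n) + 1 + Real.log Y := by
    rw [show 2 * Real.exp 1 * Y / n = 2 / n * Real.exp 1 * Y by ring,
      Real.log_mul (by positivity) hY.ne', Real.log_mul (by positivity) (by positivity),
      Real.log_exp]
  push_cast at h2
  calc n / 2 * Real.log (2 * Real.exp 1 * Y / n)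
      ≤ n / 2 * (2 / n * r ^ 2 * X - 2 * Real.log r + 2 / n * Real.log V) := by
        refine mul_le_mul_of_nonneg_left ?_ (by positivity)
        linarith
    _ = _ := by
        field_simp
        ring

end RiemannianGeometry

end

theorem theorem2p2 {n : ℕ} (hn : 3 ≤ n) {M : Type*} [EMetricSpace M] [CompactSpace M]
    [ChartedSpace (EuclideanSpace ℝ (Fin n)) M] [IsManifold (𝓡 n) ∞ M]
    [RiemannianBundle (fun x : M ↦ TangentSpace (𝓡 n) x)]
    [IsContMDiffRiemannianBundle (𝓡 n) ∞ (EuclideanSpace ℝ (Fin n))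
      (fun x : M ↦ TangentSpace (𝓡 n) x)]
    [IsRiemannianManifold (𝓡 n) M] [MeasurableSpace M] [BorelSpace M]
    (hR : ∀ x : M, 0 < scalarCurvature n x)
    (p : M) (r : ℝ) (hr : 0 < r) :
    0 < yamabeConstant n M ∧
    IntegrableOn (fun x ↦ scalarCurvature n x)
      (geodesicBall p r) (riemannianVolume n M) ∧
    (n : ℝ) / 2 * Real.log (2 * Real.exp 1 * yamabeConstant n M / n) ≤
      16 * ((n : ℝ) - 1) / ((n : ℝ) - 2) *
          (ballVolume n p r / ballVolume n p (r / 2))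
        + r ^ 2 / ballVolume n p (r / 2) *
          (∫ x in geodesicBall p r, scalarCurvature n x
            ∂riemannianVolume n M)
        + Real.log (ballVolume n p r / r ^ n) := by
  have : Nonempty M := ⟨p⟩
  have hY : 0 < yamabeConstant n M := yamabeConstant_pos hn hR
  refine ⟨hY, (integrable_of_continuous continuous_scalarCurvature).integrableOn, ?_⟩
  have hn3 : (3 : ℝ) ≤ n := by exact_mod_cast hn
  have hn2 : (0 : ℝ) < (n : ℝ) - 2 := by linarith
  have hn1 : (0 : ℝ) < (n : ℝ) - 1 := by linarith
  have hV := ballVolume_pos (n := n) p hr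
  have hV2 := ballVolume_pos (n := n) p (half_pos hr)
  have hS : 0 ≤ ∫ x in geodesicBall p r, scalarCurvature n x ∂riemannianVolume n M :=
    integral_nonneg fun x ↦ (hR x).le
  have hle := yamabeConstant_mul_ballVolume_le hn hR p hr
  rw [← le_div_iff₀ hV2, mul_div_assoc] at hle
  -- the logarithmic estimate for `X = (4 a V(p, r) / r² + ∫ R) / V(p, r / 2)` with
  -- `a = 4 (n - 1) / (n - 2)`, so that `4 a` is the constant of the first term
  refine (log_le_of_le_rpow_mul (by linarith) hY hV (by positivity) hr hle).trans_eq ?_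
  rw [Real.log_div hV.ne' (by positivity), Real.log_pow]
  field_simp
  ring
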